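/- Let $\partial_x^{-1}$ be the Fourier multiplier with symbol $\frac1{i\xi}$. For an integer $N\ge 0$ let $X^N$ and $Y^N$ be the spaces of real-valued $u\in L^2(\mathbb R^2)$ for which the respective norm $$\|u\|_{X^N}^2=\int_{\mathbb R^2}\Big(u^2+\sum_{|\alpha|\le N}\big[(\partial^\alpha u_{xxx})^2+(\partial^\alpha\partial_x^{-1}u_{yy})^2\big]\Big)\,dx\,dy,$$ $$\|u\|_{Y^N}^2=\int_{\mathbb R^2}\Big(u^2+\sum_{|\alpha|\le N}\big[(\partial^\alpha u_{xxx})^2+(\partial^\alpha\partial_x^{-1}u_{yy})^2+(\partial^\alpha u_{yy})^2\big]\Big)\,dx\,dy$$ is finite. By $u\in L^\infty([0,S];B)$ we mean $\sup_{0\le t\le S}\|u(t)\|_B<\infty$. A solution on $[0,S]$ with data $\phi$ of the KP-I equation $$u_t+u_{xxx}+u_x+u\,u_x-\partial_x^{-1}u_{yy}=0,\qquad u(\cdot,\cdot,0)=\phi,$$ is a function $u\in L^\infty([0,S];X^0)$ with weak time derivative $u_t\in L^\infty([0,S];L^2(\mathbb R^2))$, taking the value $\phi$ at $t=0$ (as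 a continuous function of $t\in[0,S]$ with values in $L^2(\mathbb R^2)$), for which the equation holds in $L^2(\mathbb R^2)$ for almost every $t\in[0,S]$. For $\phi\in Y^N$, the life span $T\in[0,\infty]$ in $Y^N$ is the supremum of all $S>0$ such that there is a solution on $[0,S]$ with data $\phi$ in $L^\infty([0,S];Y^N)$. Then for every $K\ge 0$ there is a time $T'>0$, depending only on $K$, such that the following holds for every integer $N\ge 0$ and every $\phi\in Y^N$ with $\|\phi\|_{X^0}\le K$. The life span $T$ in $Y^N$ satisfies $T'\le T$; there is a unique $u$ on $[0,T)$ that is, for every $0<S<T$, a solution on $[0,S]$ with data $\phi$ in $L^\infty([0,S];Y^N)$; and this $u$ (extended to $t=T$ if $T'=T$) is a solution on $[0,T']$ with $u\in L^\infty([0,T'];X^N)$. -/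

import Mathlib

open MeasureTheory
open scoped ENNReal NNReal FourierTransform

namespace KPI

/-- The plane with its Euclidean structure; coordinate `0` is `x` and coordinate `1` is `y`
(on the Fourier side, `ξ` and `η`). -/
abbrev Plane := EuclideanSpace ℝ (Fin 2)

/-- Real-valued `L²` functions on the plane. -/
noncomputable abbrev L2R := Lp ℝ 2 (volume : Measure Plane)

/-- Complex-valued `L²` functions on the plane. -/
noncomputable abbrev L2C := Lp ℂ 2 (volume : Measure Plane)

/-- A real `L²` function regarded as a complex one. -/
noncomputable def toC (f : L2R) : L2C := Complex.ofRealCLM.compLp f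

/-- The symbol of `∂ₓᵃ ∂_yᵇ`. Mathlib's Fourier transform has kernel `exp (-2πi⟨z, ζ⟩)`,
so `∂ₓ` and `∂_y` are multiplication by `2πi ξ` and `2πi η`. -/
noncomputable def derivSym (a b : ℕ) (ζ : Plane) : ℂ :=
  (2 * Real.pi * Complex.I * (ζ 0 : ℂ)) ^ a * (2 * Real.pi * Complex.I * (ζ 1 : ℂ)) ^ b

/-- The symbol of `∂ₓᵃ ∂_yᵇ ∂ₓ⁻¹ ∂_y²` (the value on the null set `ξ = 0` is irrelevant). -/
noncomputable def invSym (a b : ℕ) (ζ : Plane) : ℂ :=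
  derivSym a (b + 2) ζ / (2 * Real.pi * Complex.I * (ζ 0 : ℂ))

/-- The Fourier multiplier operator `𝓕⁻¹ (m · 𝓕 f)` on its domain, the set of `f ∈ L²` with
`m · 𝓕 f ∈ L²`. Outside of the domain the value is the dummy `0`. -/
noncomputable def fourierMul (m : Plane → ℂ) (f : L2R) : L2C :=
  open Classical in
  if h : MemLp (fun ζ => m ζ * (𝓕 (toC f) : L2C) ζ) 2 (volume : Measure Plane) then
    𝓕⁻ (h.toLp (fun ζ => m ζ * (𝓕 (toC f) : L2C) ζ))
  else 0

/-- The squared `L²` norm of `𝓕⁻¹ (m · 𝓕 f)`, by Plancherel's theorem; it is `∞` exactly when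
`f` is not in the domain of the multiplier `m`. -/
noncomputable def sqNorm (m : Plane → ℂ) (f : L2R) : ℝ≥0∞ :=
  ∫⁻ ζ, ‖m ζ * (𝓕 (toC f) : L2C) ζ‖ₑ ^ 2

/-- The multi-indices `α = (α₁, α₂)` with `α₁ + α₂ ≤ N`. -/
def multiIdx (N : ℕ) : Finset (ℕ × ℕ) :=
  (Finset.range (N + 1) ×ˢ Finset.range (N + 1)).filter (fun α => α.1 + α.2 ≤ N)

/-- The norm of `X^N`:
`‖u‖² = ∫ u² + ∑_{|α| ≤ N} [(∂^α u_xxx)² + (∂^α ∂ₓ⁻¹ u_yy)²]`, with value `∞` off `X^N`. -/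
noncomputable def XNorm (N : ℕ) (f : L2R) : ℝ≥0∞ :=
  (sqNorm 1 f + ∑ α ∈ multiIdx N,
    (sqNorm (derivSym (α.1 + 3) α.2) f + sqNorm (invSym α.1 α.2) f)) ^ (1 / 2 : ℝ)

/-- The norm of `Y^N`:
`‖u‖² = ∫ u² + ∑_{|α| ≤ N} [(∂^α u_xxx)² + (∂^α ∂ₓ⁻¹ u_yy)² + (∂^α u_yy)²]`,
with value `∞` off `Y^N`. -/
noncomputable def YNorm (N : ℕ) (f : L2R) : ℝ≥0∞ :=
  (sqNorm 1 f + ∑ α ∈ multiIdx N,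
    (sqNorm (derivSym (α.1 + 3) α.2) f + sqNorm (invSym α.1 α.2) f
      + sqNorm (derivSym α.1 (α.2 + 2)) f)) ^ (1 / 2 : ℝ)

/-- `f ∈ Y^N`, i.e. `f`, `f_xxx`, `f_yy`, `∂ₓ⁻¹ f_yy` all lie in `H^N`. Finiteness of the norm
says this: it contains `f ∈ H^N`, as `|ξ^a η^b| ≤ 1 + |ξ|^(N+3) + |η|^(N+2)` for `a + b ≤ N`. -/
def MemY (N : ℕ) (f : L2R) : Prop := YNorm N f < ∞

/-- `u ∈ L^∞([0,T]; B)` for the space `B` with norm `nrm`: `sup_{0 ≤ t ≤ T} ‖u(t)‖_B < ∞`. -/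
def BoundedIn (nrm : L2R → ℝ≥0∞) (T : ℝ) (u : ℝ → L2R) : Prop :=
  ∃ C : ℝ≥0, ∀ t ∈ Set.Icc 0 T, nrm (u t) ≤ C

/-- `u` solves `u_t + u_xxx + u_x + u u_x - ∂ₓ⁻¹ u_yy = 0` on `[0,T]` with `u(0) = φ`:
`u ∈ L^∞([0,T]; X⁰)`, `u` has a weak time derivative `v = u_t ∈ L^∞([0,T]; L²)`, and the equation
holds in `L²` for almost every time. -/
structure IsSolutionOn (T : ℝ) (φ : L2R) (u : ℝ → L2R) : Prop where
  bounded : BoundedIn (XNorm 0) T u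
  equation : ∃ v : ℝ → L2R,
    MemLp v ∞ (volume.restrict (Set.Icc 0 T)) ∧
    (∀ t ∈ Set.Icc 0 T, u t = φ + ∫ s in (0 : ℝ)..t, v s) ∧
    ∀ᵐ t ∂(volume.restrict (Set.Icc 0 T)), ∀ᵐ z ∂(volume : Measure Plane),
      (v t z : ℂ) + fourierMul (derivSym 3 0) (u t) z + fourierMul (derivSym 1 0) (u t) z
        + (u t z : ℂ) * fourierMul (derivSym 1 0) (u t) z
        - fourierMul (invSym 0 0) (u t) z = 0

/-- `u` is a solution on `[0,T]` with data `φ`, of class `L^∞([0,T]; Y^N)`. -/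
def IsYSolutionOn (N : ℕ) (T : ℝ) (φ : L2R) (u : ℝ → L2R) : Prop :=
  IsSolutionOn T φ u ∧ BoundedIn (YNorm N) T u

/-- The life span in `Y^N` of the solution with data `φ`: the supremum, in `[0,∞]`, of the times
`S > 0` such that there is a solution on `[0,S]` of class `L^∞([0,S]; Y^N)`. -/
noncomputable def lifespan (N : ℕ) (φ : L2R) : ℝ≥0∞ :=
  sSup {s | ∃ S : ℝ, 0 < S ∧ s = ENNReal.ofReal S ∧ ∃ u, IsYSolutionOn N S φ u}

/-- `u`, on `[0, lifespan N φ)`, is the solution in `Y^N` with data `φ`. The values at other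
times are irrelevant. -/
def IsMaximalSolution (N : ℕ) (φ : L2R) (u : ℝ → L2R) : Prop :=
  ∀ S : ℝ, 0 < S → ENNReal.ofReal S < lifespan N φ → IsYSolutionOn N S φ u

end KPI

/-! Everything takes place on the Fourier side. With `a` the transform of `u`, the equation reads
`a_t = -disp · a - nlSym · (a * a)`, where `disp` is purely imaginary, `nlSym` is the symbol of `½
∂ₓ`, and `a` has the Hermitian symmetry of a real function. For an even weight `M` the derivative of
`∫ M |a|²` therefore sees only the quadratic term. It is a trilinear integral over frequencies with
`ζ₀ + ζ₁ + ζ₂ = 0`, with multiplier `ξ₀ M(ζ₀)`, and symmetrising replaces the multiplier by a third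
of `∑ ξᵢ M(ζᵢ)`.

The heart of the proof is the algebraic estimate `TriBound` for this sum. A weight is a sum of
squares of `m = x^j y^k` or of `y^k / x`. Expanding a power of `ζ₀ = -(ζ₁ + ζ₂)` and using `x₀ + x₁
+ x₂ = 0`, the multiplier is bounded by terms in which two frequencies carry the square root `√M`
and the third carries a milder coefficient weight `c`. The singular weight `y^k / x` behaves well
because multiplying it by `x` gives a polynomial. Consequently `d/dt ∫ M |a|²` is at most a constant
times `(∫ c |a|) ∫ M |a|²`, and `∫ c |a|` is controlled by a lower energy through Cauchy–Schwarz
(`Dominates`).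

The choice of `c` makes the time depend on the `X⁰` norm alone. For the `X⁰` weight and for the `Y⁰`
weight, `c = |x| + |y|^(2/3)`, and `∫ c |a|` is bounded by the `X⁰` norm. So the `X⁰` energy obeys a
Riccati inequality, bounded on a time fixed by `K`, while the `Y⁰` energy obeys a linear one on the
same interval. For `Y^(N+1)` the coefficient is controlled by the `Y^N` energy, so induction on `N`
gives linear inequalities on that same interval.

Existence comes from restricting the equation to the frequencies in `band n`, where it is a locally
Lipschitz ODE that conserves the `L²` norm (`exists_galerkin`), with the energy bounds uniform in
`n`. The truncated solutions solve the full equation up to an `L²` error of size `1/n`. The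
stability estimate `exists_stability` makes them Cauchy in `L²` at each time. It rests on `a₁ * a₁ -
a₂ * a₂ = (a₁ + a₂) * (a₁ - a₂)` and on moving the derivative from the difference onto the sum. The
limit solves the equation, and the energies pass to it by Fatou's lemma. The same stability estimate
with zero error gives uniqueness, which glues the solutions up to the life span. `equation_iff`
translates between the physical and Fourier forms of the equation. -/

namespace KPI

/-! ### Weights, and the algebra of the symmetrised cubic multiplier -/

/-- The weight of `X⁰` on the Fourier side. -/
noncomputable def weightX (x y : ℝ) : ℝ := 1 + x ^ 6 + y ^ 4 / x ^ 2

/-- A weight equivalent to that of `Y^N` on the Fourier side. -/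
noncomputable def weightY (N : ℕ) (x y : ℝ) : ℝ :=
  weightX x y + x ^ (2 * N + 6) + x ^ 6 * y ^ (2 * N) + y ^ (2 * N + 4) + y ^ (2 * N + 4) / x ^ 2

/-- The coefficient weight for the energy estimates that only use the `X⁰` norm. -/
noncomputable def coefX (x y : ℝ) : ℝ := |x| + |y| ^ (2 / 3 : ℝ)

/-- The coefficient weight for the energy estimate in `Y^(N+1)`. -/
noncomputable def coefY (N : ℕ) (x y : ℝ) : ℝ := |x| + |y| + |y| ^ (N + 1)

/-- The symmetrised cubic multiplier `∑ ξᵢ f(ζᵢ)` on `ζ₀ + ζ₁ + ζ₂ = 0` is bounded by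
`C ∑ c(ζᵢ) W(ζⱼ) W(ζₖ)`. -/
def TriBound (f W c : ℝ → ℝ → ℝ) (C : ℝ) : Prop :=
  ∀ x₀ x₁ x₂ y₀ y₁ y₂ : ℝ, x₀ + x₁ + x₂ = 0 → y₀ + y₁ + y₂ = 0 → x₀ ≠ 0 → x₁ ≠ 0 → x₂ ≠ 0 →
    |x₀ * f x₀ y₀ + x₁ * f x₁ y₁ + x₂ * f x₂ y₂| ≤
      C * (c x₀ y₀ * (W x₁ y₁ * W x₂ y₂) + c x₁ y₁ * (W x₀ y₀ * W x₂ y₂)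
        + c x₂ y₂ * (W x₀ y₀ * W x₁ y₁))

theorem abs_mul_mul_le {m w W₀ B : ℝ} (h1 : |m| ≤ W₀) (h2 : |w| ≤ B) : |m * w| ≤ W₀ * B := by
  rw [abs_mul]
  exact mul_le_mul h1 h2 (abs_nonneg _) ((abs_nonneg _).trans h1)

/-- In each `xᵢ mᵢ²` one factor `mᵢ` is replaced by `s (mⱼ + mₖ + dᵢ)`, where `dᵢ` measures the
failure of `m` to be additive. The cross terms combine to `mᵢ mⱼ (xᵢ + xⱼ) = -xₖ mᵢ mⱼ`, so the
derivative lands on the frequency without a weight. In the defect terms `xᵢ = -(xⱼ + xₖ)` moves the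
derivative onto the arguments of `dᵢ`. Each product on the right occurs in two defect terms, whence
`1 + 2 * C`. -/
theorem abs_tri_le {x₀ x₁ x₂ m₀ m₁ m₂ d₀ d₁ d₂ W₀ W₁ W₂ c₀ c₁ c₂ s C : ℝ} (hs : |s| = 1)
    (hx : x₀ + x₁ + x₂ = 0)
    (h₀ : m₀ = s * (m₁ + m₂ + d₀)) (h₁ : m₁ = s * (m₀ + m₂ + d₁)) (h₂ : m₂ = s * (m₀ + m₁ + d₂))
    (hm₀ : |m₀| ≤ W₀) (hm₁ : |m₁| ≤ W₁) (hm₂ : |m₂| ≤ W₂)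
    (hc₀ : |x₀| ≤ c₀) (hc₁ : |x₁| ≤ c₁) (hc₂ : |x₂| ≤ c₂)
    (hd₀ : |d₀| * (|x₁| + |x₂|) ≤ C * (c₁ * W₂ + c₂ * W₁))
    (hd₁ : |d₁| * (|x₀| + |x₂|) ≤ C * (c₀ * W₂ + c₂ * W₀))
    (hd₂ : |d₂| * (|x₀| + |x₁|) ≤ C * (c₀ * W₁ + c₁ * W₀)) :
    |x₀ * m₀ ^ 2 + x₁ * m₁ ^ 2 + x₂ * m₂ ^ 2| ≤
      (1 + 2 * C) * (c₀ * (W₁ * W₂) + c₁ * (W₀ * W₂) + c₂ * (W₀ * W₁)) := by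
  have key : x₀ * m₀ ^ 2 + x₁ * m₁ ^ 2 + x₂ * m₂ ^ 2 =
      s * (-(x₀ * (m₁ * m₂)) + -(x₁ * (m₀ * m₂)) + -(x₂ * (m₀ * m₁))
        + -(m₀ * (d₀ * (x₁ + x₂))) + -(m₁ * (d₁ * (x₀ + x₂))) + -(m₂ * (d₂ * (x₀ + x₁)))) := by
    linear_combination (x₀ * m₀) * h₀ + (x₁ * m₁) * h₁ + (x₂ * m₂) * h₂
      + s * (m₁ * m₂ + m₀ * m₂ + m₀ * m₁ + m₀ * d₀ + m₁ * d₁ + m₂ * d₂) * hx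
  have hd (d x x' B : ℝ) (h : |d| * (|x| + |x'|) ≤ B) : |d * (x + x')| ≤ B := by
    rw [abs_mul]
    exact (mul_le_mul_of_nonneg_left (abs_add_le x x') (abs_nonneg d)).trans h
  have e0 := abs_mul_mul_le hc₀ (abs_mul_mul_le hm₁ hm₂)
  have e1 := abs_mul_mul_le hc₁ (abs_mul_mul_le hm₀ hm₂)
  have e2 := abs_mul_mul_le hc₂ (abs_mul_mul_le hm₀ hm₁)
  have f0 := abs_mul_mul_le hm₀ (hd _ _ _ _ hd₀)
  have f1 := abs_mul_mul_le hm₁ (hd _ _ _ _ hd₁)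
  have f2 := abs_mul_mul_le hm₂ (hd _ _ _ _ hd₂)
  rw [key, abs_mul, hs, one_mul]
  rw [abs_le] at *
  constructor <;> linarith

/-- For `w = p / x` the derivative cancels the singularity: `x w² = w p`. Only `p` is expanded, and
`wᵢ pⱼ + wⱼ pᵢ = wᵢ wⱼ (xᵢ + xⱼ) = -xₖ wᵢ wⱼ`. The defect terms are `wᵢ dᵢ` with no frequency factor
at all, so the hypotheses on `dᵢ` are free of `x`. -/
theorem abs_tri_singular_le {x₀ x₁ x₂ p₀ p₁ p₂ w₀ w₁ w₂ d₀ d₁ d₂ W₀ W₁ W₂ c₀ c₁ c₂ s C : ℝ}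
    (hs : |s| = 1) (hx : x₀ + x₁ + x₂ = 0)
    (h₀ : p₀ = s * (p₁ + p₂ + d₀)) (h₁ : p₁ = s * (p₀ + p₂ + d₁)) (h₂ : p₂ = s * (p₀ + p₁ + d₂))
    (hp₀ : w₀ * x₀ = p₀) (hp₁ : w₁ * x₁ = p₁) (hp₂ : w₂ * x₂ = p₂)
    (hm₀ : |w₀| ≤ W₀) (hm₁ : |w₁| ≤ W₁) (hm₂ : |w₂| ≤ W₂)
    (hc₀ : |x₀| ≤ c₀) (hc₁ : |x₁| ≤ c₁) (hc₂ : |x₂| ≤ c₂)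
    (hd₀ : |d₀| ≤ C * (c₁ * W₂ + c₂ * W₁)) (hd₁ : |d₁| ≤ C * (c₀ * W₂ + c₂ * W₀))
    (hd₂ : |d₂| ≤ C * (c₀ * W₁ + c₁ * W₀)) :
    |x₀ * w₀ ^ 2 + x₁ * w₁ ^ 2 + x₂ * w₂ ^ 2| ≤
      (1 + 2 * C) * (c₀ * (W₁ * W₂) + c₁ * (W₀ * W₂) + c₂ * (W₀ * W₁)) := by
  have key : x₀ * w₀ ^ 2 + x₁ * w₁ ^ 2 + x₂ * w₂ ^ 2 =
      s * (-(x₀ * (w₁ * w₂)) + -(x₁ * (w₀ * w₂)) + -(x₂ * (w₀ * w₁))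
        + w₀ * d₀ + w₁ * d₁ + w₂ * d₂) := by
    subst hp₀ hp₁ hp₂
    linear_combination w₀ * h₀ + w₁ * h₁ + w₂ * h₂ + s * (w₁ * w₂ + w₀ * w₂ + w₀ * w₁) * hx
  have e0 := abs_mul_mul_le hc₀ (abs_mul_mul_le hm₁ hm₂)
  have e1 := abs_mul_mul_le hc₁ (abs_mul_mul_le hm₀ hm₂)
  have e2 := abs_mul_mul_le hc₂ (abs_mul_mul_le hm₀ hm₁)
  have f0 := abs_mul_mul_le hm₀ hd₀
  have f1 := abs_mul_mul_le hm₁ hd₁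
  have f2 := abs_mul_mul_le hm₂ hd₂
  rw [key, abs_mul, hs, one_mul]
  rw [abs_le] at *
  constructor <;> linarith

theorem pow_mul_pow_le_add {a b : ℝ} (ha : 0 ≤ a) (hb : 0 ≤ b) (m n : ℕ) :
    a ^ m * b ^ n ≤ a ^ (m + n) + b ^ (m + n) := by
  rcases le_total a b with h | h
  · calc a ^ m * b ^ n ≤ b ^ m * b ^ n := by gcongr
      _ = b ^ (m + n) := (pow_add b m n).symm
      _ ≤ _ := le_add_of_nonneg_left (by positivity)
  · calc a ^ m * b ^ n ≤ a ^ m * a ^ n := by gcongr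
      _ = a ^ (m + n) := (pow_add a m n).symm
      _ ≤ _ := le_add_of_nonneg_right (by positivity)

theorem pow_le_one_add_pow {a : ℝ} (ha : 0 ≤ a) {m n : ℕ} (h : m ≤ n) : a ^ m ≤ 1 + a ^ n := by
  obtain ⟨k, rfl⟩ := Nat.exists_eq_add_of_le h
  simpa [add_comm] using pow_mul_pow_le_add ha zero_le_one m k

/-- The mixed terms of the binomial expansion. -/
theorem abs_add_pow_sub_le (a b : ℝ) (k : ℕ) :
    |(a + b) ^ (k + 2) - a ^ (k + 2) - b ^ (k + 2)| ≤
      4 ^ (k + 1) * (|a| * |b| ^ (k + 1) + |b| * |a| ^ (k + 1)) := by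
  induction k with
  | zero =>
    have : (a + b) ^ 2 - a ^ 2 - b ^ 2 = 2 * (a * b) := by ring
    simp only [zero_add, this, abs_mul, pow_one, Nat.abs_ofNat]
    nlinarith [mul_nonneg (abs_nonneg a) (abs_nonneg b)]
  | succ k ih =>
    have e : (a + b) ^ (k + 1 + 2) - a ^ (k + 1 + 2) - b ^ (k + 1 + 2) =
        (a + b) * ((a + b) ^ (k + 2) - a ^ (k + 2) - b ^ (k + 2))
          + (a * b ^ (k + 2) + b * a ^ (k + 2)) := by ring
    have h1 := abs_mul_mul_le (abs_add_le a b) ih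
    have h2 : |a * b ^ (k + 2) + b * a ^ (k + 2)| ≤ |a| * |b| ^ (k + 2) + |b| * |a| ^ (k + 2) := by
      refine (abs_add_le _ _).trans_eq ?_
      simp [abs_mul, abs_pow]
    have ha := abs_nonneg a
    have hb := abs_nonneg b
    set A := |a|
    set B := |b|
    have h3 : A * (A * B ^ (k + 1)) ≤ A * B ^ (k + 2) + B * A ^ (k + 2) := by
      have := mul_le_mul_of_nonneg_left (pow_mul_pow_le_add ha hb 1 k) (mul_nonneg ha hb)
      calc A * (A * B ^ (k + 1)) = A * B * (A ^ 1 * B ^ k) := by ring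
        _ ≤ _ := this
        _ = _ := by ring
    have h4 : B * (B * A ^ (k + 1)) ≤ A * B ^ (k + 2) + B * A ^ (k + 2) := by
      have := mul_le_mul_of_nonneg_left (pow_mul_pow_le_add hb ha 1 k) (mul_nonneg ha hb)
      calc B * (B * A ^ (k + 1)) = A * B * (B ^ 1 * A ^ k) := by ring
        _ ≤ _ := this
        _ = _ := by ring
    have h5 : (1 : ℝ) ≤ 4 ^ (k + 1) := one_le_pow₀ (by norm_num)
    have h6 : 0 ≤ A * B ^ (k + 2) + B * A ^ (k + 2) := by positivity
    rw [e]
    refine (abs_add_le _ _).trans ((add_le_add h1 h2).trans ?_)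
    have : (A + B) * (4 ^ (k + 1) * (A * B ^ (k + 1) + B * A ^ (k + 1))) =
      4 ^ (k + 1) * (A * (A * B ^ (k + 1)) + B * (B * A ^ (k + 1))
        + (A * B ^ (k + 2) + B * A ^ (k + 2))) := by ring
    rw [this]
    -- The constant grows by the factor 4: multiplying the inductive bound by `A + B` produces three
    -- copies of the mixed sum, and the two new terms a fourth.
    calc _ ≤ 4 ^ (k + 1) * (3 * (A * B ^ (k + 2) + B * A ^ (k + 2)))
          + 4 ^ (k + 1) * (A * B ^ (k + 2) + B * A ^ (k + 2)) := by
            gcongr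
            · linarith
            · exact le_mul_of_one_le_left h6 h5
      _ = _ := by ring

/-- Hypotheses for `abs_tri_le` and `abs_tri_singular_le` from powers. -/
theorem pow_eq_sign_mul {y₀ y₁ y₂ : ℝ} (hy : y₀ + y₁ + y₂ = 0) (k : ℕ) :
    y₀ ^ k = (-1) ^ k * (y₁ ^ k + y₂ ^ k + ((y₁ + y₂) ^ k - y₁ ^ k - y₂ ^ k)) := by
  have : y₀ = -1 * (y₁ + y₂) := by linarith
  rw [this, mul_pow]
  ring

theorem abs_neg_one_pow_eq (k : ℕ) : |(-1 : ℝ) ^ k| = 1 := by simp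

end KPI
-- Cubic multiplier bounds for the weights of `X⁰` and `Y^N`
namespace KPI

theorem TriBound.add {f g W c : ℝ → ℝ → ℝ} {C D : ℝ} (hf : TriBound f W c C)
    (hg : TriBound g W c D) : TriBound (fun x y => f x y + g x y) W c (C + D) := by
  intro x₀ x₁ x₂ y₀ y₁ y₂ hx hy h₀ h₁ h₂
  have e : x₀ * (f x₀ y₀ + g x₀ y₀) + x₁ * (f x₁ y₁ + g x₁ y₁) + x₂ * (f x₂ y₂ + g x₂ y₂) =
      (x₀ * f x₀ y₀ + x₁ * f x₁ y₁ + x₂ * f x₂ y₂)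
        + (x₀ * g x₀ y₀ + x₁ * g x₁ y₁ + x₂ * g x₂ y₂) := by ring
  rw [e, add_mul]
  exact (abs_add_le _ _).trans
    (add_le_add (hf _ _ _ _ _ _ hx hy h₀ h₁ h₂) (hg _ _ _ _ _ _ hx hy h₀ h₁ h₂))

theorem TriBound.one {W c : ℝ → ℝ → ℝ} : TriBound (fun _ _ => 1) W c 0 := by
  intro x₀ x₁ x₂ y₀ y₁ y₂ hx hy h₀ h₁ h₂
  simp [hx]

theorem mul_pow_add_mul_le {a b : ℝ} (ha : 0 ≤ a) (hb : 0 ≤ b) (k : ℕ) :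
    (a * b ^ (k + 1) + b * a ^ (k + 1)) * (a + b) ≤ 3 * (a * b ^ (k + 2) + b * a ^ (k + 2)) := by
  have h1 := mul_le_mul_of_nonneg_left (pow_mul_pow_le_add ha hb 1 k) (mul_nonneg ha hb)
  have h2 := mul_le_mul_of_nonneg_left (pow_mul_pow_le_add hb ha 1 k) (mul_nonneg ha hb)
  have e : (a * b ^ (k + 1) + b * a ^ (k + 1)) * (a + b) = a * b ^ (k + 2) + b * a ^ (k + 2) +
    (a * b * (a ^ 1 * b ^ k) + a * b * (b ^ 1 * a ^ k)) := by ring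
  have e1 : a * b * (a ^ (1 + k) + b ^ (1 + k)) = a * b ^ (k + 2) + b * a ^ (k + 2) := by ring
  have e2 : a * b * (b ^ (1 + k) + a ^ (1 + k)) = a * b ^ (k + 2) + b * a ^ (k + 2) := by ring
  linarith

/-- The general weight given by the square of a monomial `x ^ j * y ^ k`. -/
theorem TriBound.of_monomial {m W c : ℝ → ℝ → ℝ} {C : ℝ} (j k : ℕ)
    (hm : ∀ x y, m x y = x ^ j * y ^ k)
    (hW : ∀ x y, x ≠ 0 → |m x y| ≤ W x y) (hc : ∀ x y, |x| ≤ c x y)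
    (hd : ∀ x₁ y₁ x₂ y₂, x₁ ≠ 0 → x₂ ≠ 0 → |m (x₁ + x₂) (y₁ + y₂) - m x₁ y₁ - m x₂ y₂| *
      (|x₁| + |x₂|) ≤ C * (c x₁ y₁ * W x₂ y₂ + c x₂ y₂ * W x₁ y₁)) :
    TriBound (fun x y => m x y ^ 2) W c (1 + 2 * C) := by
  intro x₀ x₁ x₂ y₀ y₁ y₂ hx hy h₀ h₁ h₂
  have hs : ∀ x y x' y', m (-(x + x')) (-(y + y')) =
      (-1) ^ (j + k) * (m x y + m x' y' + (m (x + x') (y + y') - m x y - m x' y')) := by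
    intro x y x' y'
    rw [hm, hm (x + x'), neg_pow (x + x'), neg_pow (y + y'), pow_add]
    ring
  refine abs_tri_le (s := (-1) ^ (j + k)) (abs_neg_one_pow_eq _) hx ?_ ?_ ?_ (hW _ _ h₀) (hW _ _ h₁)
    (hW _ _ h₂) (hc _ _) (hc _ _) (hc _ _) (hd x₁ y₁ x₂ y₂ h₁ h₂) (hd x₀ y₀ x₂ y₂ h₀ h₂)
    (hd x₀ y₀ x₁ y₁ h₀ h₁)
  · rw [← hs]; congr 1 <;> linarith
  · rw [← hs]; congr 1 <;> linarith
  · rw [← hs]; congr 1 <;> linarith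

theorem TriBound.x_pow {W c : ℝ → ℝ → ℝ} (k : ℕ) (hc : ∀ x y, |x| ≤ c x y)
    (hW : ∀ x y, x ≠ 0 → |x| ^ (k + 2) ≤ W x y) :
    TriBound (fun x _ => x ^ (2 * k + 4)) W c (1 + 2 * (4 ^ (k + 1) * 3)) := by
  have h := TriBound.of_monomial (m := fun x _ => x ^ (k + 2)) (W := W) (c := c)
    (C := 4 ^ (k + 1) * 3) (k + 2) 0 (by simp) (by simpa [abs_pow] using hW) hc ?_
  · convert h using 3 with x y
    ring
  · intro x₁ y₁ x₂ y₂ h₁ h₂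
    calc _ ≤ 4 ^ (k + 1) * (|x₁| * |x₂| ^ (k + 1) + |x₂| * |x₁| ^ (k + 1)) * (|x₁| + |x₂|) := by
          gcongr; exact abs_add_pow_sub_le _ _ _
      _ = 4 ^ (k + 1) * ((|x₁| * |x₂| ^ (k + 1) + |x₂| * |x₁| ^ (k + 1)) * (|x₁| + |x₂|)) := by ring
      _ ≤ 4 ^ (k + 1) * (3 * (|x₁| * |x₂| ^ (k + 2) + |x₂| * |x₁| ^ (k + 2))) := by
          refine mul_le_mul_of_nonneg_left ?_ (by positivity)
          exact mul_pow_add_mul_le (abs_nonneg _) (abs_nonneg _) _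
      _ = 4 ^ (k + 1) * 3 * (|x₁| * |x₂| ^ (k + 2) + |x₂| * |x₁| ^ (k + 2)) := by ring
      _ ≤ _ := by
          have := hc x₁ y₁
          have := hc x₂ y₂
          have := hW x₁ y₁ h₁
          have := hW x₂ y₂ h₂
          have := (abs_nonneg x₁).trans (hc x₁ y₁)
          have := (abs_nonneg x₂).trans (hc x₂ y₂)
          gcongr

theorem TriBound.y_pow {W c : ℝ → ℝ → ℝ} {C : ℝ} (k : ℕ) (hc : ∀ x y, |x| ≤ c x y)
    (hW : ∀ x y, x ≠ 0 → |y| ^ (k + 2) ≤ W x y)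
    (hd : ∀ x₁ y₁ x₂ y₂, x₁ ≠ 0 → x₂ ≠ 0 →
      (|y₁| * |y₂| ^ (k + 1) + |y₂| * |y₁| ^ (k + 1)) * (|x₁| + |x₂|) ≤
        C * (c x₁ y₁ * W x₂ y₂ + c x₂ y₂ * W x₁ y₁)) :
    TriBound (fun _ y => y ^ (2 * k + 4)) W c (1 + 2 * (4 ^ (k + 1) * C)) := by
  have h := TriBound.of_monomial (m := fun _ y => y ^ (k + 2)) (W := W) (c := c)
    (C := 4 ^ (k + 1) * C) 0 (k + 2) (by simp) (by simpa [abs_pow] using hW) hc ?_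
  · convert h using 3 with x y
    ring
  · intro x₁ y₁ x₂ y₂ h₁ h₂
    calc _ ≤ 4 ^ (k + 1) * (|y₁| * |y₂| ^ (k + 1) + |y₂| * |y₁| ^ (k + 1)) * (|x₁| + |x₂|) := by
          gcongr; exact abs_add_pow_sub_le _ _ _
      _ = 4 ^ (k + 1) * ((|y₁| * |y₂| ^ (k + 1) + |y₂| * |y₁| ^ (k + 1)) * (|x₁| + |x₂|)) := by ring
      _ ≤ 4 ^ (k + 1) * (C * (c x₁ y₁ * W x₂ y₂ + c x₂ y₂ * W x₁ y₁)) := by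
          exact mul_le_mul_of_nonneg_left (hd _ _ _ _ h₁ h₂) (by positivity)
      _ = _ := by ring

/-- The weight is the square of `y^(k+2) / x`, so the singular form of the cubic identity applies
with `p = y^(k+2)`. Unlike for the pure power of `y`, the mixed binomial terms need not absorb a
factor `|x₁| + |x₂|`. -/
theorem TriBound.y_pow_div {W c : ℝ → ℝ → ℝ} {C : ℝ} (k : ℕ) (hc : ∀ x y, |x| ≤ c x y)
    (hW : ∀ x y, x ≠ 0 → |y| ^ (k + 2) / |x| ≤ W x y)
    (hd : ∀ x₁ y₁ x₂ y₂, x₁ ≠ 0 → x₂ ≠ 0 → |y₁| * |y₂| ^ (k + 1) + |y₂| * |y₁| ^ (k + 1) ≤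
        C * (c x₁ y₁ * W x₂ y₂ + c x₂ y₂ * W x₁ y₁)) :
    TriBound (fun x y => y ^ (2 * k + 4) / x ^ 2) W c (1 + 2 * (4 ^ (k + 1) * C)) := by
  intro x₀ x₁ x₂ y₀ y₁ y₂ hx hy h₀ h₁ h₂
  have hd' : ∀ x₁ y₁ x₂ y₂, x₁ ≠ 0 → x₂ ≠ 0 → |(y₁ + y₂) ^ (k + 2) - y₁ ^ (k + 2) - y₂ ^ (k + 2)| ≤
      4 ^ (k + 1) * C * (c x₁ y₁ * W x₂ y₂ + c x₂ y₂ * W x₁ y₁) := by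
    intro x₁ y₁ x₂ y₂ h₁ h₂
    refine (abs_add_pow_sub_le _ _ _).trans ?_
    rw [mul_assoc]
    gcongr
    exact hd _ _ _ _ h₁ h₂
  have hw : ∀ x y, x ≠ 0 → |y ^ (k + 2) / x| ≤ W x y := by
    intro x y h
    rw [abs_div, abs_pow]
    exact hW x y h
  have := abs_tri_singular_le (s := (-1) ^ (k + 2)) (abs_neg_one_pow_eq _) hx
    (pow_eq_sign_mul hy (k + 2))
    (pow_eq_sign_mul (show y₁ + y₀ + y₂ = 0 by linarith) (k + 2))
    (pow_eq_sign_mul (show y₂ + y₀ + y₁ = 0 by linarith) (k + 2))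
    (div_mul_cancel₀ _ h₀) (div_mul_cancel₀ _ h₁) (div_mul_cancel₀ _ h₂)
    (hw _ _ h₀) (hw _ _ h₁) (hw _ _ h₂) (hc x₀ y₀) (hc x₁ y₁) (hc x₂ y₂)
    (hd' _ _ _ _ h₁ h₂) (hd' _ _ _ _ h₀ h₂) (hd' _ _ _ _ h₀ h₁)
  convert this using 3 <;> ring

/-- The fractional power in `coefX` through a cube root. -/
theorem exists_cube_root (y : ℝ) : ∃ t, 0 ≤ t ∧ |y| = t ^ 3 ∧ |y| ^ (2 / 3 : ℝ) = t ^ 2 := by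
  refine ⟨|y| ^ (1 / 3 : ℝ), by positivity, ?_, ?_⟩
  · rw [← Real.rpow_natCast, ← Real.rpow_mul (abs_nonneg y)]; norm_num
  · rw [← Real.rpow_natCast, ← Real.rpow_mul (abs_nonneg y)]; norm_num

theorem abs_le_coefX (x y : ℝ) : |x| ≤ coefX x y := by
  unfold coefX; have : 0 ≤ |y| ^ (2 / 3 : ℝ) := by positivity
  linarith

theorem abs_le_coefY (N : ℕ) (x y : ℝ) : |x| ≤ coefY N x y := by
  unfold coefY; have : 0 ≤ |y| + |y| ^ (N + 1) := by positivity
  linarith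

/-- With `|yᵢ| = tᵢ³`, consider `|y₁ y₂ x₁|`. If `t₁ ≤ t₂` it is at most `|x₁| y₂²`. If `t₂ ≤ t₁` it
is at most `t₂² · t₁⁴ |x₁|`, and `t₁⁴ |x₁|` is bounded by `y₁²` or by `|x₁|³` according to whether
`|x₁|` is below or above `t₁²`. -/
theorem pair_y_bound_X {W : ℝ → ℝ → ℝ} (hx : ∀ x y, x ≠ 0 → |x| ^ 3 ≤ W x y)
    (hy : ∀ x y, x ≠ 0 → |y| ^ 2 ≤ W x y) (x₁ y₁ x₂ y₂ : ℝ) (h₁ : x₁ ≠ 0) (h₂ : x₂ ≠ 0) :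
    (|y₁| * |y₂| ^ (0 + 1) + |y₂| * |y₁| ^ (0 + 1)) * (|x₁| + |x₂|) ≤
        8 * (coefX x₁ y₁ * W x₂ y₂ + coefX x₂ y₂ * W x₁ y₁) := by
  have key : ∀ x₁ y₁ x₂ y₂ : ℝ, x₁ ≠ 0 → x₂ ≠ 0 → |y₁| * |y₂| * |x₁| ≤
      2 * (coefX x₁ y₁ * W x₂ y₂ + coefX x₂ y₂ * W x₁ y₁) := by
    intro x₁ y₁ x₂ y₂ h₁ h₂
    obtain ⟨t₁, ht₁, e₁, f₁⟩ := exists_cube_root y₁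
    obtain ⟨t₂, ht₂, e₂, f₂⟩ := exists_cube_root y₂
    have a₁ := hx x₁ y₁ h₁
    have b₁ := hy x₁ y₁ h₁
    have b₂ := hy x₂ y₂ h₂
    have ha := abs_nonneg x₁
    have hb := abs_nonneg x₂
    unfold coefX
    rw [f₁, f₂]
    rw [e₁] at b₁ ⊢
    rw [e₂] at b₂ ⊢
    set X₁ := |x₁|
    set X₂ := |x₂|
    have w₁ : 0 ≤ W x₁ y₁ := le_trans (by positivity) a₁
    have w₂ : 0 ≤ W x₂ y₂ := le_trans (by positivity) b₂
    rcases le_total t₁ t₂ with h | h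
    · have : t₁ ^ 3 * t₂ ^ 3 * X₁ ≤ X₁ * W x₂ y₂ := by
        calc t₁ ^ 3 * t₂ ^ 3 * X₁ ≤ t₂ ^ 3 * t₂ ^ 3 * X₁ := by gcongr
          _ = X₁ * (t₂ ^ 3) ^ 2 := by ring
          _ ≤ _ := by gcongr
      nlinarith [mul_nonneg ha w₂, mul_nonneg (sq_nonneg t₁) w₂,
        mul_nonneg (add_nonneg hb (sq_nonneg t₂)) w₁]
    · have k1 : t₁ ^ 4 * X₁ ≤ 2 * W x₁ y₁ := by
        rcases le_total X₁ (t₁ ^ 2) with h' | h'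
        · have : t₁ ^ 4 * X₁ ≤ t₁ ^ 4 * t₁ ^ 2 := by gcongr
          nlinarith
        · have : t₁ ^ 4 * X₁ ≤ X₁ ^ 2 * X₁ := by
            have : t₁ ^ 4 ≤ X₁ ^ 2 := by
              calc t₁ ^ 4 = (t₁ ^ 2) ^ 2 := by ring
                _ ≤ _ := by gcongr
            gcongr
          nlinarith
      have : t₁ ^ 3 * t₂ ^ 3 * X₁ ≤ t₂ ^ 2 * (2 * W x₁ y₁) := by
        calc t₁ ^ 3 * t₂ ^ 3 * X₁ = t₁ ^ 3 * t₂ ^ 2 * t₂ * X₁ := by ring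
          _ ≤ t₁ ^ 3 * t₂ ^ 2 * t₁ * X₁ := by gcongr
          _ = t₂ ^ 2 * (t₁ ^ 4 * X₁) := by ring
          _ ≤ _ := by gcongr
      nlinarith [mul_nonneg hb w₁, mul_nonneg (add_nonneg ha (sq_nonneg t₁)) w₂]
  have k1 := key x₁ y₁ x₂ y₂ h₁ h₂
  have k2 := key x₂ y₂ x₁ y₁ h₂ h₁
  have e : (|y₁| * |y₂| ^ (0 + 1) + |y₂| * |y₁| ^ (0 + 1)) * (|x₁| + |x₂|) =
    2 * (|y₁| * |y₂| * |x₁|) + 2 * (|y₂| * |y₁| * |x₂|) := by ring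
  linarith [k1, k2]

/-- This estimate explains the exponent `2/3` in `coefX`. The three lower bounds on `W` give
`|y|^(4/3) ≤ W`, by comparing `|x|` with `|y|^(2/3)`. Then `2 t₁³ t₂³ ≤ t₁² t₂⁴ + t₁⁴ t₂²` with
`|yᵢ| = tᵢ³` splits `|y₁ y₂|` into a power `2/3` on one factor and `4/3` on the other. -/
theorem pair_div_bound_X {W : ℝ → ℝ → ℝ} (h1 : ∀ x y, 1 ≤ W x y)
    (hx : ∀ x y, x ≠ 0 → |x| ^ 3 ≤ W x y)
    (hy : ∀ x y, x ≠ 0 → |y| ^ 2 / |x| ≤ W x y) (x₁ y₁ x₂ y₂ : ℝ) (h₁ : x₁ ≠ 0) (h₂ : x₂ ≠ 0) :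
    |y₁| * |y₂| ^ (0 + 1) + |y₂| * |y₁| ^ (0 + 1) ≤
        2 * (coefX x₁ y₁ * W x₂ y₂ + coefX x₂ y₂ * W x₁ y₁) := by
  have hW : ∀ x y t : ℝ, x ≠ 0 → 0 ≤ t → |y| = t ^ 3 → t ^ 4 ≤ W x y := by
    intro x y t h0 ht e
    have hx0 := abs_pos.2 h0
    rcases le_total |x| (t ^ 2) with h | h
    · refine le_trans ?_ (hy x y h0)
      rw [e, le_div_iff₀ hx0]
      calc t ^ 4 * |x| ≤ t ^ 4 * t ^ 2 := by gcongr
        _ = (t ^ 3) ^ 2 := by ring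
    · rcases le_total t 1 with h' | h'
      · exact (pow_le_one₀ ht h').trans (h1 x y)
      · refine le_trans ?_ (hx x y h0)
        calc t ^ 4 ≤ t ^ 6 := pow_le_pow_right₀ h' (by norm_num)
          _ = (t ^ 2) ^ 3 := by ring
          _ ≤ _ := by gcongr
  obtain ⟨t₁, ht₁, e₁, f₁⟩ := exists_cube_root y₁
  obtain ⟨t₂, ht₂, e₂, f₂⟩ := exists_cube_root y₂
  have w₁ := hW x₁ y₁ t₁ h₁ ht₁ e₁
  have w₂ := hW x₂ y₂ t₂ h₂ ht₂ e₂
  have v₁ : 0 ≤ |x₁| * W x₂ y₂ := mul_nonneg (abs_nonneg _) (zero_le_one.trans (h1 _ _))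
  have v₂ : 0 ≤ |x₂| * W x₁ y₁ := mul_nonneg (abs_nonneg _) (zero_le_one.trans (h1 _ _))
  have u₁ : t₁ ^ 2 * t₂ ^ 4 ≤ t₁ ^ 2 * W x₂ y₂ := by gcongr
  have u₂ : t₂ ^ 2 * t₁ ^ 4 ≤ t₂ ^ 2 * W x₁ y₁ := by gcongr
  unfold coefX
  rw [f₁, f₂, e₁, e₂]
  have : 0 ≤ t₁ ^ 2 * t₂ ^ 2 * (t₁ - t₂) ^ 2 := by positivity
  have h0 : 0 ≤ t₁ ^ 3 * t₂ ^ 3 := by positivity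
  simp only [zero_add, pow_one, add_mul]
  linarith

/-- The bounds on `W` used for the energy estimate in `Y^(N+1)`. -/
structure YLowerBounds (N : ℕ) (W : ℝ → ℝ → ℝ) : Prop where
  one : ∀ x y, 1 ≤ W x y
  x : ∀ x y, x ≠ 0 → |x| ^ (N + 4) ≤ W x y
  y : ∀ x y, x ≠ 0 → |y| ^ (N + 3) ≤ W x y
  xy : ∀ x y, x ≠ 0 → |x| ^ 3 * |y| ^ (N + 1) ≤ W x y

theorem pair_div_bound_Y {N : ℕ} {W : ℝ → ℝ → ℝ} (H : YLowerBounds N W)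
    (x₁ y₁ x₂ y₂ : ℝ) (h₁ : x₁ ≠ 0) (h₂ : x₂ ≠ 0) :
    |y₁| * |y₂| ^ (N + 1 + 1) + |y₂| * |y₁| ^ (N + 1 + 1) ≤
        2 * (coefY N x₁ y₁ * W x₂ y₂ + coefY N x₂ y₂ * W x₁ y₁) := by
  have key : ∀ x₁ y₁ x₂ y₂ : ℝ, x₂ ≠ 0 →
      |y₁| * |y₂| ^ (N + 1 + 1) ≤ coefY N x₁ y₁ * (2 * W x₂ y₂) := by
    intro x₁ y₁ x₂ y₂ h
    have : |y₂| ^ (N + 1 + 1) ≤ 2 * W x₂ y₂ := by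
      have := pow_le_one_add_pow (abs_nonneg y₂) (show N + 1 + 1 ≤ N + 3 by omega)
      linarith [H.one x₂ y₂, H.y x₂ y₂ h]
    have hc : |y₁| ≤ coefY N x₁ y₁ := by
      unfold coefY
      have : 0 ≤ |x₁| + |y₁| ^ (N + 1) := by positivity
      linarith
    exact mul_le_mul hc this (by positivity) ((abs_nonneg _).trans hc)
  linarith [key x₁ y₁ x₂ y₂ h₂, key x₂ y₂ x₁ y₁ h₁]

theorem pair_y_bound_Y {N : ℕ} {W : ℝ → ℝ → ℝ} (H : YLowerBounds N W)
    (x₁ y₁ x₂ y₂ : ℝ) (h₁ : x₁ ≠ 0) (h₂ : x₂ ≠ 0) :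
    (|y₁| * |y₂| ^ (N + 1 + 1) + |y₂| * |y₁| ^ (N + 1 + 1)) * (|x₁| + |x₂|) ≤
        4 * (coefY N x₁ y₁ * W x₂ y₂ + coefY N x₂ y₂ * W x₁ y₁) := by
  -- If `|x| ≤ |y|` the power `|y|^(N+3)` suffices. Otherwise the product is at most 1 when `|x| ≤
  -- 1`, and for `|x| ≥ 1` the mixed bound `|x|³ |y|^(N+1)` takes over.
  have hW : ∀ x y : ℝ, x ≠ 0 → |x| * |y| ^ (N + 2) ≤ W x y := by
    intro x y h
    have hx0 := abs_pos.2 h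
    rcases le_total |x| |y| with h' | h'
    · refine le_trans ?_ (H.y x y h)
      calc |x| * |y| ^ (N + 2) ≤ |y| * |y| ^ (N + 2) := by gcongr
        _ = _ := by ring
    · rcases le_total |x| 1 with h2 | h2
      · refine le_trans ?_ (H.one x y)
        exact mul_le_one₀ h2 (by positivity) (pow_le_one₀ (abs_nonneg _) (h'.trans h2))
      · refine le_trans ?_ (H.xy x y h)
        calc |x| * |y| ^ (N + 2) = |x| * |y| * |y| ^ (N + 1) := by ring
          _ ≤ |x| * |x| * |y| ^ (N + 1) := by gcongr
          _ = |x| ^ 2 * |y| ^ (N + 1) := by ring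
          _ ≤ _ := by gcongr; norm_num
  have c0 : ∀ x y : ℝ, 0 ≤ coefY N x y := fun x y => (abs_nonneg x).trans (abs_le_coefY N x y)
  have key : ∀ x₁ y₁ x₂ y₂ : ℝ, x₁ ≠ 0 → x₂ ≠ 0 →
      |y₁| * |y₂| ^ (N + 2) * |x₁| + |y₁| * |y₂| ^ (N + 2) * |x₂| ≤
        2 * (coefY N x₁ y₁ * W x₂ y₂) + coefY N x₂ y₂ * W x₁ y₁ := by
    intro x₁ y₁ x₂ y₂ h₁ h₂
    have w₁ := zero_le_one.trans (H.one x₁ y₁)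
    have w₂ := zero_le_one.trans (H.one x₂ y₂)
    have cy : ∀ x y : ℝ, |y| ≤ coefY N x y := by
      intro x y; unfold coefY
      have : 0 ≤ |x| + |y| ^ (N + 1) := by positivity
      linarith
    have a1 : |y₁| * |y₂| ^ (N + 2) * |x₂| ≤ coefY N x₁ y₁ * W x₂ y₂ := by
      calc _ = |y₁| * (|x₂| * |y₂| ^ (N + 2)) := by ring
        _ ≤ _ := mul_le_mul (cy _ _) (hW _ _ h₂) (by positivity) (c0 _ _)
    have a2 : |y₁| * |y₂| ^ (N + 2) * |x₁| ≤
        coefY N x₁ y₁ * W x₂ y₂ + coefY N x₂ y₂ * W x₁ y₁ := by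
      rcases le_total |y₁| |y₂| with h | h
      · have : |y₁| * |y₂| ^ (N + 2) * |x₁| ≤ coefY N x₁ y₁ * W x₂ y₂ := by
          calc _ ≤ |y₂| * |y₂| ^ (N + 2) * |x₁| := by gcongr
            _ = |x₁| * |y₂| ^ (N + 3) := by ring
            _ ≤ _ := mul_le_mul (abs_le_coefY _ _ _) (H.y _ _ h₂) (by positivity) (c0 _ _)
        linarith [mul_nonneg (c0 x₂ y₂) w₁]
      · have : |y₁| * |y₂| ^ (N + 2) * |x₁| ≤ coefY N x₂ y₂ * W x₁ y₁ := by
          calc _ = |y₁| * |y₂| * |y₂| ^ (N + 1) * |x₁| := by ring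
            _ ≤ |y₁| * |y₂| * |y₁| ^ (N + 1) * |x₁| := by gcongr
            _ = |y₂| * (|x₁| * |y₁| ^ (N + 2)) := by ring
            _ ≤ _ := mul_le_mul (cy _ _) (hW _ _ h₁) (by positivity) (c0 _ _)
        linarith [mul_nonneg (c0 x₁ y₁) w₂]
    linarith
  have k1 := key x₁ y₁ x₂ y₂ h₁ h₂
  have k2 := key x₂ y₂ x₁ y₁ h₂ h₁
  have w₁ := mul_nonneg (c0 x₂ y₂) (zero_le_one.trans (H.one x₁ y₁))
  have w₂ := mul_nonneg (c0 x₁ y₁) (zero_le_one.trans (H.one x₂ y₂))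
  have e : (|y₁| * |y₂| ^ (N + 1 + 1) + |y₂| * |y₁| ^ (N + 1 + 1)) * (|x₁| + |x₂|) =
    (|y₁| * |y₂| ^ (N + 2) * |x₁| + |y₁| * |y₂| ^ (N + 2) * |x₂|) +
    (|y₂| * |y₁| ^ (N + 2) * |x₂| + |y₂| * |y₁| ^ (N + 2) * |x₁|) := by ring
  linarith

theorem abs_add_pow_sub_pow_le (a b : ℝ) (N : ℕ) :
    |(a + b) ^ (N + 1) - a ^ (N + 1)| ≤ (N + 1) * 2 ^ N * (|b| * (|a| ^ N + |b| ^ N)) := by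
  have h := abs_pow_sub_pow_le (a + b) a (N + 1)
  have e : a + b - a = b := by ring
  rw [e] at h
  refine h.trans ?_
  have h1 : max |a + b| |a| ≤ |a| + |b| :=
    max_le (abs_add_le a b) (le_add_of_nonneg_right (abs_nonneg b))
  have h2 : (|a| + |b|) ^ N ≤ 2 ^ N * (|a| ^ N + |b| ^ N) := by
    refine (add_pow_le (abs_nonneg a) (abs_nonneg b) N).trans ?_
    gcongr
    · norm_num
    · omega
  calc |b| * ((N + 1 : ℕ) : ℝ) * max |a + b| |a| ^ (N + 1 - 1)
      ≤ |b| * ((N + 1 : ℕ) : ℝ) * (|a| + |b|) ^ N := by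
        rw [Nat.add_sub_cancel]; gcongr
    _ ≤ |b| * ((N + 1 : ℕ) : ℝ) * (2 ^ N * (|a| ^ N + |b| ^ N)) := by gcongr
    _ = _ := by push_cast; ring

/-- The defect of `x³ y^(N+1)` splits by a product rule into the defect of `x³` times `(y₁ +
y₂)^(N+1)`, and two terms `xᵢ³` times a difference of powers of `y`. The monomial `|x₁|⁴
|y₂|^(N+1)`, in which all `y` derivatives fall on one factor and all `x` derivatives on the other,
is what forces the term `|y|^(N+1)` in `coefY`. -/
theorem pair_xy_bound_Y {N : ℕ} {W : ℝ → ℝ → ℝ} (H : YLowerBounds N W)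
    (x₁ y₁ x₂ y₂ : ℝ) (h₁ : x₁ ≠ 0) (h₂ : x₂ ≠ 0) :
    |(x₁ + x₂) ^ 3 * (y₁ + y₂) ^ (N + 1) - x₁ ^ 3 * y₁ ^ (N + 1) - x₂ ^ 3 * y₂ ^ (N + 1)|
      * (|x₁| + |x₂|) ≤ ((N + 1) * 2 ^ N * 48) *
        (coefY N x₁ y₁ * W x₂ y₂ + coefY N x₂ y₂ * W x₁ y₁) := by
  have c0 : ∀ x y : ℝ, 0 ≤ coefY N x y := fun x y => (abs_nonneg x).trans (abs_le_coefY N x y)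
  have cy : ∀ x y : ℝ, |y| ≤ coefY N x y := by
    intro x y; unfold coefY
    have : 0 ≤ |x| + |y| ^ (N + 1) := by positivity
    linarith
  have cyn : ∀ x y : ℝ, |y| ^ (N + 1) ≤ coefY N x y := by
    intro x y; unfold coefY
    have : 0 ≤ |x| + |y| := by positivity
    linarith
  have w0 : ∀ x y : ℝ, 0 ≤ W x y := fun x y => zero_le_one.trans (H.one x y)
  have W4 : ∀ x y : ℝ, x ≠ 0 → |x| ^ 4 ≤ 2 * W x y := by
    intro x y h
    have := pow_le_one_add_pow (abs_nonneg x) (show 4 ≤ N + 4 by omega)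
    linarith [H.one x y, H.x x y h]
  have W4N : ∀ x y : ℝ, x ≠ 0 → |x| ^ 4 * |y| ^ N ≤ 2 * W x y := by
    intro x y h
    calc |x| ^ 4 * |y| ^ N = |x| ^ 3 * (|x| ^ 1 * |y| ^ N) := by ring
      _ ≤ |x| ^ 3 * (|x| ^ (1 + N) + |y| ^ (1 + N)) := by
        gcongr; exact pow_mul_pow_le_add (abs_nonneg _) (abs_nonneg _) _ _
      _ = |x| ^ (N + 4) + |x| ^ 3 * |y| ^ (N + 1) := by ring
      _ ≤ _ := by linarith [H.x x y h, H.xy x y h]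
  set U := coefY N x₁ y₁ * W x₂ y₂ + coefY N x₂ y₂ * W x₁ y₁ with hU
  -- the elementary monomials
  have mono : ∀ x₁ y₁ x₂ y₂ : ℝ, x₁ ≠ 0 → x₂ ≠ 0 →
      |x₁| ^ 4 * |y₂| * |y₁| ^ N ≤ 2 * (coefY N x₂ y₂ * W x₁ y₁) ∧
      |x₁| ^ 4 * |y₂| ^ (N + 1) ≤ 2 * (coefY N x₂ y₂ * W x₁ y₁) ∧
      |x₁| ^ 3 * |x₂| * |y₁| ^ (N + 1) ≤ coefY N x₂ y₂ * W x₁ y₁ ∧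
      |x₁| ^ 3 * |x₂| * |y₂| ^ (N + 1) ≤
        2 * (coefY N x₂ y₂ * W x₁ y₁) + coefY N x₁ y₁ * W x₂ y₂ := by
    intro x₁ y₁ x₂ y₂ h₁ h₂
    have a1 : |x₁| ^ 4 * |y₂| ^ (N + 1) ≤ 2 * (coefY N x₂ y₂ * W x₁ y₁) := by
      have := mul_le_mul (cyn x₂ y₂) (W4 x₁ y₁ h₁) (by positivity) (c0 _ _)
      linarith
    refine ⟨?_, a1, ?_, ?_⟩
    · have := mul_le_mul (cy x₂ y₂) (W4N x₁ y₁ h₁) (by positivity) (c0 _ _)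
      linarith
    · have := mul_le_mul (abs_le_coefY N x₂ y₂) (H.xy x₁ y₁ h₁) (by positivity) (c0 _ _)
      linarith
    · rcases le_total |x₁| |x₂| with h | h
      · have k : |x₁| ^ 3 * |x₂| * |y₂| ^ (N + 1) ≤ coefY N x₁ y₁ * W x₂ y₂ := by
          calc _ = |x₁| * |x₁| ^ 2 * |x₂| * |y₂| ^ (N + 1) := by ring
            _ ≤ |x₁| * |x₂| ^ 2 * |x₂| * |y₂| ^ (N + 1) := by gcongr
            _ = |x₁| * (|x₂| ^ 3 * |y₂| ^ (N + 1)) := by ring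
            _ ≤ _ := mul_le_mul (abs_le_coefY _ _ _) (H.xy _ _ h₂) (by positivity) (c0 _ _)
        linarith [mul_nonneg (c0 x₂ y₂) (w0 x₁ y₁)]
      · have k : |x₁| ^ 3 * |x₂| * |y₂| ^ (N + 1) ≤ |x₁| ^ 4 * |y₂| ^ (N + 1) := by
          calc _ ≤ |x₁| ^ 3 * |x₁| * |y₂| ^ (N + 1) := by gcongr
            _ = _ := by ring
        linarith [mul_nonneg (c0 x₁ y₁) (w0 x₂ y₂)]
  obtain ⟨m1, m2, m3, m4⟩ := mono x₁ y₁ x₂ y₂ h₁ h₂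
  obtain ⟨n1, n2, n3, n4⟩ := mono x₂ y₂ x₁ y₁ h₂ h₁
  have u₁ := mul_nonneg (c0 x₂ y₂) (w0 x₁ y₁)
  have u₂ := mul_nonneg (c0 x₁ y₁) (w0 x₂ y₂)
  have e1 := abs_add_pow_sub_pow_le y₁ y₂ N
  have e2 := abs_add_pow_sub_pow_le y₂ y₁ N
  have e3 : |(y₁ + y₂) ^ (N + 1)| ≤ 2 ^ N * (|y₁| ^ (N + 1) + |y₂| ^ (N + 1)) := by
    rw [abs_pow]
    exact (pow_le_pow_left₀ (abs_nonneg _) (abs_add_le _ _) _).trans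
      (add_pow_le (abs_nonneg _) (abs_nonneg _) _)
  have e4 : |(x₁ + x₂) ^ 3 - x₁ ^ 3 - x₂ ^ 3| ≤ 3 * (|x₁| * |x₂| * (|x₁| + |x₂|)) := by
    have : (x₁ + x₂) ^ 3 - x₁ ^ 3 - x₂ ^ 3 = 3 * (x₁ * x₂ * (x₁ + x₂)) := by ring
    rw [this, abs_mul, abs_mul, abs_mul, Nat.abs_ofNat]
    gcongr
    exact abs_add_le _ _
  have split : (x₁ + x₂) ^ 3 * (y₁ + y₂) ^ (N + 1) - x₁ ^ 3 * y₁ ^ (N + 1) - x₂ ^ 3 * y₂ ^ (N + 1)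
      = ((x₁ + x₂) ^ 3 - x₁ ^ 3 - x₂ ^ 3) * (y₁ + y₂) ^ (N + 1)
        + x₁ ^ 3 * ((y₁ + y₂) ^ (N + 1) - y₁ ^ (N + 1))
        + x₂ ^ 3 * ((y₂ + y₁) ^ (N + 1) - y₂ ^ (N + 1)) := by
    rw [add_comm y₂ y₁]; ring
  have f1 := abs_mul_mul_le e4 e3
  have f2 : |x₁ ^ 3 * ((y₁ + y₂) ^ (N + 1) - y₁ ^ (N + 1))| ≤ _ :=
    abs_mul_mul_le (abs_pow x₁ 3).le e1
  have f3 : |x₂ ^ 3 * ((y₂ + y₁) ^ (N + 1) - y₂ ^ (N + 1))| ≤ _ :=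
    abs_mul_mul_le (abs_pow x₂ 3).le e2
  have hN : (1 : ℝ) ≤ N + 1 := by linarith [Nat.cast_nonneg (α := ℝ) N]
  set a := |x₁|
  set b := |x₂|
  set p := |y₁|
  set q := |y₂|
  have ha : 0 ≤ a := abs_nonneg _
  have hb : 0 ≤ b := abs_nonneg _
  have hp : 0 ≤ p := abs_nonneg _
  have hq : 0 ≤ q := abs_nonneg _
  have yy1 : q * p ^ N ≤ p ^ (N + 1) + q ^ (N + 1) := by
    have := pow_mul_pow_le_add hq hp 1 N
    rw [pow_one, add_comm 1 N] at this
    linarith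
  have yy2 : p * q ^ N ≤ p ^ (N + 1) + q ^ (N + 1) := by
    have := pow_mul_pow_le_add hp hq 1 N
    rw [pow_one, add_comm 1 N] at this
    linarith
  have g1 : a * b * (a + b) * (p ^ (N + 1) + q ^ (N + 1)) * (a + b) ≤ 2 * (4 * U) := by
    have : a * b * (a + b) * (p ^ (N + 1) + q ^ (N + 1)) * (a + b) =
      a * b * (p ^ (N + 1) + q ^ (N + 1)) * (a + b) ^ 2 := by ring
    rw [this]
    calc _ ≤ a * b * (p ^ (N + 1) + q ^ (N + 1)) * (2 * (a ^ 2 + b ^ 2)) := by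
          gcongr; nlinarith [sq_nonneg (a - b)]
      _ = 2 * (a ^ 3 * b * p ^ (N + 1) + a ^ 3 * b * q ^ (N + 1)
          + (b ^ 3 * a * q ^ (N + 1) + b ^ 3 * a * p ^ (N + 1))) := by ring
      _ ≤ _ := by linarith
  have g2 : a ^ 3 * (q * (p ^ N + q ^ N)) * (a + b) ≤ 12 * U := by
    calc _ = a ^ 4 * q * p ^ N + a ^ 4 * q ^ (N + 1) + a ^ 3 * b * (q * p ^ N)
          + a ^ 3 * b * q ^ (N + 1) := by ring
      _ ≤ a ^ 4 * q * p ^ N + a ^ 4 * q ^ (N + 1) + a ^ 3 * b * (p ^ (N + 1) + q ^ (N + 1))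
          + a ^ 3 * b * q ^ (N + 1) := by gcongr
      _ = a ^ 4 * q * p ^ N + a ^ 4 * q ^ (N + 1) + a ^ 3 * b * p ^ (N + 1)
          + 2 * (a ^ 3 * b * q ^ (N + 1)) := by ring
      _ ≤ _ := by linarith
  have g3 : b ^ 3 * (p * (q ^ N + p ^ N)) * (a + b) ≤ 12 * U := by
    calc _ = b ^ 4 * p * q ^ N + b ^ 4 * p ^ (N + 1) + b ^ 3 * a * (p * q ^ N)
          + b ^ 3 * a * p ^ (N + 1) := by ring
      _ ≤ b ^ 4 * p * q ^ N + b ^ 4 * p ^ (N + 1) + b ^ 3 * a * (p ^ (N + 1) + q ^ (N + 1))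
          + b ^ 3 * a * p ^ (N + 1) := by gcongr
      _ = b ^ 4 * p * q ^ N + b ^ 4 * p ^ (N + 1) + b ^ 3 * a * q ^ (N + 1)
          + 2 * (b ^ 3 * a * p ^ (N + 1)) := by ring
      _ ≤ _ := by linarith
  rw [split]
  have hU0 : 0 ≤ U := add_nonneg u₂ u₁
  have h2N : (0 : ℝ) ≤ 2 ^ N := by positivity
  calc _ ≤ (3 * (a * b * (a + b)) * (2 ^ N * (p ^ (N + 1) + q ^ (N + 1)))
        + a ^ 3 * ((N + 1) * 2 ^ N * (q * (p ^ N + q ^ N)))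
        + b ^ 3 * ((N + 1) * 2 ^ N * (p * (q ^ N + p ^ N)))) * (a + b) := by
        refine mul_le_mul_of_nonneg_right ?_ (add_nonneg ha hb)
        exact (abs_add_le _ _).trans (add_le_add ((abs_add_le _ _).trans (add_le_add f1 f2)) f3)
    _ = 3 * 2 ^ N * (a * b * (a + b) * (p ^ (N + 1) + q ^ (N + 1)) * (a + b))
        + (N + 1) * 2 ^ N * (a ^ 3 * (q * (p ^ N + q ^ N)) * (a + b))
        + (N + 1) * 2 ^ N * (b ^ 3 * (p * (q ^ N + p ^ N)) * (a + b)) := by ring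
    _ ≤ 3 * 2 ^ N * (2 * (4 * U)) + (N + 1) * 2 ^ N * (12 * U) + (N + 1) * 2 ^ N * (12 * U) := by
        gcongr
    _ = 2 ^ N * U * (24 + (N + 1) * 24) := by ring
    _ ≤ 2 ^ N * U * ((N + 1) * 48) := by
        have : 0 ≤ 2 ^ N * U := by positivity
        gcongr; linarith
    _ = _ := by ring


theorem weightX_pos (x y : ℝ) : 1 ≤ weightX x y := by
  unfold weightX
  have : 0 ≤ x ^ 6 + y ^ 4 / x ^ 2 := by positivity
  linarith

theorem weightX_le_weightY (N : ℕ) (x y : ℝ) : weightX x y ≤ weightY N x y := by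
  unfold weightY
  have : 0 ≤ x ^ (2 * N + 6) + x ^ 6 * y ^ (2 * N) + y ^ (2 * N + 4)
      + y ^ (2 * N + 4) / x ^ 2 := by
    have e1 : x ^ (2 * N + 6) = (x ^ (N + 3)) ^ 2 := by ring
    have e2 : x ^ 6 * y ^ (2 * N) = (x ^ 3 * y ^ N) ^ 2 := by ring
    have e3 : y ^ (2 * N + 4) = (y ^ (N + 2)) ^ 2 := by ring
    rw [e1, e2, e3]
    positivity
  linarith

theorem weightY_pos (N : ℕ) (x y : ℝ) : 1 ≤ weightY N x y :=
  (weightX_pos x y).trans (weightX_le_weightY N x y)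

theorem weightY_terms (N : ℕ) (x y : ℝ) :
    0 ≤ x ^ (2 * N + 6) ∧ 0 ≤ x ^ 6 * y ^ (2 * N) ∧ 0 ≤ y ^ (2 * N + 4) ∧
      0 ≤ y ^ (2 * N + 4) / x ^ 2 := by
  have e1 : x ^ (2 * N + 6) = (x ^ (N + 3)) ^ 2 := by ring
  have e2 : x ^ 6 * y ^ (2 * N) = (x ^ 3 * y ^ N) ^ 2 := by ring
  have e3 : y ^ (2 * N + 4) = (y ^ (N + 2)) ^ 2 := by ring
  rw [e1, e2, e3]
  refine ⟨?_, ?_, ?_, ?_⟩ <;> positivity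

theorem pow_y_le_weightY (N : ℕ) (x y : ℝ) : y ^ (2 * N + 4) ≤ weightY N x y := by
  obtain ⟨t1, t2, t3, t4⟩ := weightY_terms N x y
  have := weightX_pos x y
  unfold weightY
  linarith

theorem sqrt_lower_bounds {W : ℝ → ℝ → ℝ} (hW : ∀ x y, weightX x y ≤ W x y) :
    (∀ x y, 1 ≤ √(W x y)) ∧ (∀ x y, x ≠ 0 → |x| ^ 3 ≤ √(W x y)) ∧
      ∀ x y, x ≠ 0 → |y| ^ 2 / |x| ≤ √(W x y) := by
  refine ⟨fun x y => ?_, fun x y _ => ?_, fun x y h => ?_⟩ <;>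
    refine Real.le_sqrt_of_sq_le (le_trans ?_ (hW x y)) <;> unfold weightX
  · have : 0 ≤ x ^ 6 + y ^ 4 / x ^ 2 := by positivity
    linarith
  · have : 0 ≤ 1 + y ^ 4 / x ^ 2 := by positivity
    have e : (|x| ^ 3) ^ 2 = x ^ 6 := by
      rw [← abs_pow, sq_abs]; ring
    linarith
  · have : 0 ≤ 1 + x ^ 6 := by positivity
    have e : (|y| ^ 2 / |x|) ^ 2 = y ^ 4 / x ^ 2 := by
      rw [div_pow, sq_abs, sq_abs]; ring
    linarith

/-- The cubic bound is allowed to spend a larger weight `W` than the one being differentiated, so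
that it can serve as a summand in the estimates for `weightY`. -/
theorem triBound_weightX {W : ℝ → ℝ → ℝ} (hW : ∀ x y, weightX x y ≤ W x y)
    {c : ℝ → ℝ → ℝ} (hc : ∀ x y, |x| ≤ c x y)
    {D : ℝ} (hd : ∀ x₁ y₁ x₂ y₂, x₁ ≠ 0 → x₂ ≠ 0 →
      |y₁| * |y₂| ^ (0 + 1) + |y₂| * |y₁| ^ (0 + 1) ≤
        D * (c x₁ y₁ * √(W x₂ y₂) + c x₂ y₂ * √(W x₁ y₁))) :
    ∃ C, TriBound weightX (fun x y => √(W x y)) c C := by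
  obtain ⟨h1, hx, hy⟩ := sqrt_lower_bounds hW
  exact ⟨_, (TriBound.one.add (TriBound.x_pow 1 hc hx)).add (TriBound.y_pow_div 0 hc hy hd)⟩

theorem exists_triBound_weightX :
    ∃ C, TriBound weightX (fun x y => √(weightX x y)) coefX C := by
  obtain ⟨h1, hx, hy⟩ := sqrt_lower_bounds (W := weightX) (fun _ _ => le_rfl)
  exact triBound_weightX (fun _ _ => le_rfl) abs_le_coefX (pair_div_bound_X h1 hx hy)

/-- The coefficient is still `coefX`, hence of `X⁰` strength: the extra term `y⁴` in the weight
supplies `|y|² ≤ √W`, which the pure `y` monomial needs. This is what makes the `Y⁰` estimate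
linear. -/
theorem exists_triBound_weightY_zero :
    ∃ C, TriBound (weightY 0) (fun x y => √(weightY 0 x y)) coefX C := by
  obtain ⟨h1, hx, hy⟩ := sqrt_lower_bounds (weightX_le_weightY 0)
  have hyy : ∀ x y, x ≠ 0 → |y| ^ 2 ≤ √(weightY 0 x y) := by
    intro x y _
    refine Real.le_sqrt_of_sq_le ?_
    have e : (|y| ^ 2) ^ 2 = y ^ (2 * 0 + 4) := by rw [sq_abs]; ring
    exact e.trans_le (pow_y_le_weightY 0 x y)
  obtain ⟨C, hC⟩ := triBound_weightX (weightX_le_weightY 0) abs_le_coefX (pair_div_bound_X h1 hx hy)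
  have h0 : ∃ C, TriBound (fun x y => x ^ 6 * y ^ (2 * 0)) (fun x y => √(weightY 0 x y))
      coefX C := by
    simpa using ⟨_, TriBound.x_pow 1 abs_le_coefX hx⟩
  obtain ⟨C', h0⟩ := h0
  exact ⟨_, (((hC.add (TriBound.x_pow 1 abs_le_coefX hx)).add h0).add
    (TriBound.y_pow 0 abs_le_coefX hyy (pair_y_bound_X hx hyy))).add
    (TriBound.y_pow_div 0 abs_le_coefX hy (pair_div_bound_X h1 hx hy))⟩

theorem yLowerBounds_sqrt_weightY (N : ℕ) :
    YLowerBounds N (fun x y => √(weightY (N + 1) x y)) := by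
  refine ⟨fun x y => ?_, fun x y _ => ?_, fun x y _ => ?_, fun x y _ => ?_⟩ <;>
    refine Real.le_sqrt_of_sq_le ?_ <;>
    obtain ⟨t1, t2, t3, t4⟩ := weightY_terms (N + 1) x y <;>
    have := weightX_pos x y
  · simpa using weightY_pos (N + 1) x y
  · have e : (|x| ^ (N + 4)) ^ 2 = x ^ (2 * (N + 1) + 6) := by
      rw [← abs_pow, sq_abs]; ring
    unfold weightY; linarith
  · have e : (|y| ^ (N + 3)) ^ 2 = y ^ (2 * (N + 1) + 4) := by
      rw [← abs_pow, sq_abs]; ring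
    unfold weightY; linarith
  · have e : (|x| ^ 3 * |y| ^ (N + 1)) ^ 2 = x ^ 6 * y ^ (2 * (N + 1)) := by
      rw [← abs_pow, ← abs_pow, mul_pow, sq_abs, sq_abs]; ring
    unfold weightY; linarith

/-- The coefficient `coefY N` is one level below the weight; `dominates_coefY` bounds it by the
`Y^N` energy, which drives the induction on `N`. -/
theorem exists_triBound_weightY_succ (N : ℕ) :
    ∃ C, TriBound (weightY (N + 1)) (fun x y => √(weightY (N + 1) x y)) (coefY N) C := by
  have H := yLowerBounds_sqrt_weightY N
  have hc := abs_le_coefY N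
  have hdiv : ∀ x y, x ≠ 0 → |y| ^ (N + 1 + 2) / |x| ≤ √(weightY (N + 1) x y) := by
    intro x y _
    refine Real.le_sqrt_of_sq_le ?_
    obtain ⟨t1, t2, t3, t4⟩ := weightY_terms (N + 1) x y
    have := weightX_pos x y
    have e : (|y| ^ (N + 1 + 2) / |x|) ^ 2 = y ^ (2 * (N + 1) + 4) / x ^ 2 := by
      rw [div_pow, sq_abs, ← abs_pow, sq_abs]; ring
    unfold weightY; linarith
  obtain ⟨C, hC⟩ := triBound_weightX (weightX_le_weightY (N + 1)) hc (D := 2) <| by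
    intro x₁ y₁ x₂ y₂ h₁ h₂
    have hy : ∀ x y : ℝ, |y| ^ (0 + 1) ≤ coefY N x y := by
      intro x y; unfold coefY
      have : 0 ≤ |x| + |y| ^ (N + 1) := by positivity
      simp only [zero_add, pow_one]; linarith
    have hw : ∀ x y : ℝ, x ≠ 0 → |y| ^ (0 + 1) ≤ 2 * √(weightY (N + 1) x y) := by
      intro x y h
      have h1 := pow_le_one_add_pow (abs_nonneg y) (show 0 + 1 ≤ N + 3 by omega)
      have h2 := H.one x y
      have h3 := H.y x y h
      linarith
    have k1 := mul_le_mul (hy x₁ y₁) (hw x₂ y₂ h₂) (by positivity)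
      ((abs_nonneg _).trans (hc x₁ y₁))
    have k2 := mul_le_mul (hy x₂ y₂) (hw x₁ y₁ h₁) (by positivity)
      ((abs_nonneg _).trans (hc x₂ y₂))
    simp only [zero_add, pow_one] at k1 k2 ⊢
    linarith
  have hxy : ∃ C, TriBound (fun x y => x ^ 6 * y ^ (2 * (N + 1)))
      (fun x y => √(weightY (N + 1) x y)) (coefY N) C := by
    refine ⟨1 + 2 * ((N + 1) * 2 ^ N * 48), ?_⟩
    have := TriBound.of_monomial (m := fun x y => x ^ 3 * y ^ (N + 1)) 3 (N + 1) (fun _ _ => rfl)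
      (fun x y h => by simpa [abs_mul, abs_pow] using H.xy x y h) hc (pair_xy_bound_Y H)
    convert this using 3
    ring
  obtain ⟨C', hxy⟩ := hxy
  have hx := TriBound.x_pow (N + 2) hc H.x
  exact ⟨_, (((hC.add hx).add hxy).add
    (TriBound.y_pow (N + 1) hc H.y (pair_y_bound_Y H))).add
    (TriBound.y_pow_div (N + 1) hc hdiv (pair_div_bound_Y H))⟩

end KPI
-- Sobolev-type embeddings: weighted `L¹` norms on the Fourier side bounded by energies
namespace KPI

/-- The coordinates as a measure preserving map to `ℝ × ℝ`. -/
theorem measurePreserving_coords :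
    MeasurePreserving (fun ζ : Plane => (ζ 0, ζ 1)) volume (volume : Measure (ℝ × ℝ)) :=
  (volume_preserving_finTwoArrow ℝ).comp (PiLp.volume_preserving_ofLp (Fin 2))

theorem lintegral_coords_mul {f g : ℝ → ℝ≥0∞} (hf : Measurable f) (hg : Measurable g) :
    ∫⁻ ζ : Plane, f (ζ 0) * g (ζ 1) = (∫⁻ x, f x) * ∫⁻ y, g y := by
  have h := measurePreserving_coords.lintegral_comp (f := fun p : ℝ × ℝ => f p.1 * g p.2)
    (by fun_prop)
  rw [h, Measure.volume_eq_prod]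
  exact lintegral_prod_mul hf.aemeasurable hg.aemeasurable

theorem ae_coord_ne_zero : ∀ᵐ ζ : Plane, ζ 0 ≠ 0 := by
  have h : ∀ᵐ p : ℝ × ℝ, p.1 ≠ 0 :=
    Measure.quasiMeasurePreserving_fst.ae (Measure.ae_ne volume (0 : ℝ))
  exact measurePreserving_coords.quasiMeasurePreserving.ae h

/-- The Cauchy–Schwarz inequality for lower integrals. -/
theorem sq_lintegral_mul_le {α : Type*} [MeasurableSpace α] (μ : Measure α) {f g : α → ℝ≥0∞}
    (hf : AEMeasurable f μ) (hg : AEMeasurable g μ) :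
    (∫⁻ a, f a * g a ∂μ) ^ 2 ≤ (∫⁻ a, f a ^ 2 ∂μ) * ∫⁻ a, g a ^ 2 ∂μ := by
  have h := ENNReal.lintegral_mul_le_Lp_mul_Lq μ Real.HolderConjugate.two_two hf hg
  have h2 := pow_le_pow_left₀ (zero_le) h 2
  refine h2.trans_eq ?_
  rw [mul_pow]
  simp only [← ENNReal.rpow_natCast, ← ENNReal.rpow_mul]
  norm_num

/-- The weighted `L²` norm on the Fourier side. -/
noncomputable def energy (M : ℝ → ℝ → ℝ) (a : Plane → ℂ) : ℝ≥0∞ :=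
  ∫⁻ ζ, ENNReal.ofReal (M (ζ 0) (ζ 1)) * ‖a ζ‖ₑ ^ 2

/-- The weighted `L¹` norm on the Fourier side. -/
noncomputable def wiener (k : ℝ → ℝ → ℝ) (a : Plane → ℂ) : ℝ≥0∞ :=
  ∫⁻ ζ, ENNReal.ofReal (k (ζ 0) (ζ 1)) * ‖a ζ‖ₑ

theorem measurable_weight {M : ℝ → ℝ → ℝ} (hM : Measurable (Function.uncurry M)) :
    Measurable (fun ζ : Plane => M (ζ 0) (ζ 1)) :=
  hM.comp measurePreserving_coords.measurable

theorem measurable_weightX : Measurable (Function.uncurry weightX) := by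
  unfold weightX Function.uncurry; fun_prop

theorem measurable_weightY (N : ℕ) : Measurable (Function.uncurry (weightY N)) := by
  unfold weightY weightX Function.uncurry; fun_prop

theorem measurable_coefX : Measurable (Function.uncurry coefX) := by
  unfold coefX Function.uncurry; fun_prop

theorem measurable_coefY (N : ℕ) : Measurable (Function.uncurry (coefY N)) := by
  unfold coefY Function.uncurry; fun_prop

/-- The weight `k` is dominated by `M` in the sense of a Sobolev embedding. -/
def Dominates (M k : ℝ → ℝ → ℝ) : Prop :=
  ∃ C : ℝ≥0, ∀ a : Plane → ℂ, Measurable a → wiener k a ^ 2 ≤ C * energy M a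

theorem lintegral_one_add_abs_rpow_lt_top {s : ℝ} (hs : 1 < s) :
    ∫⁻ x : ℝ, ENNReal.ofReal ((1 + |x|) ^ (-s)) < ∞ := by
  have h := (integrable_one_add_norm (E := ℝ) (μ := volume) (r := s) (by simpa using hs))
  simpa [Real.norm_eq_abs] using (hasFiniteIntegral_iff_ofReal
    (Filter.Eventually.of_forall (fun x => by positivity))).1 h.2

/-- Cauchy–Schwarz applied to `k |a| = (k / √M) (√M |a|)`. The hypothesis bounds `k² / M` by a
product of one-dimensional integrable functions, and is only needed off the null set `x = 0` where
the weights are singular. -/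
theorem dominates_of_le {M k : ℝ → ℝ → ℝ} (hM : Measurable (Function.uncurry M))
    (hM0 : ∀ x y, 0 < M x y)
    {s s' : ℝ} (hs : 1 < s) (hs' : 1 < s') (C : ℝ≥0)
    (h : ∀ x y, x ≠ 0 → k x y ^ 2 ≤ C * ((1 + |x|) ^ (-s) * (1 + |y|) ^ (-s')) * M x y) :
    Dominates M k := by
  have hI1 := lintegral_one_add_abs_rpow_lt_top hs
  have hI2 := lintegral_one_add_abs_rpow_lt_top hs'
  set I₁ := ∫⁻ x : ℝ, ENNReal.ofReal ((1 + |x|) ^ (-s)) with hI₁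
  set I₂ := ∫⁻ x : ℝ, ENNReal.ofReal ((1 + |x|) ^ (-s')) with hI₂
  refine ⟨C * (I₁ * I₂).toNNReal, fun a ha => ?_⟩
  have hlt : I₁ * I₂ ≠ ∞ := (ENNReal.mul_lt_top hI1 hI2).ne
  set p : Plane → ℝ := fun ζ => C * ((1 + |ζ 0|) ^ (-s) * (1 + |ζ 1|) ^ (-s')) with hp
  have hp0 : ∀ ζ, 0 ≤ p ζ := fun ζ => by positivity
  have hpm : Measurable p := by
    have : Measurable (Function.uncurry fun x y : ℝ =>
        (C : ℝ) * ((1 + |x|) ^ (-s) * (1 + |y|) ^ (-s'))) := by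
      unfold Function.uncurry; fun_prop
    exact measurable_weight this
  have hpI : ∫⁻ ζ, ENNReal.ofReal (p ζ) = C * (I₁ * I₂) := by
    have : ∀ ζ : Plane, ENNReal.ofReal (p ζ) = C * (ENNReal.ofReal ((1 + |ζ 0|) ^ (-s)) *
        ENNReal.ofReal ((1 + |ζ 1|) ^ (-s'))) := by
      intro ζ
      rw [hp, ENNReal.ofReal_mul (by positivity), ENNReal.ofReal_mul (by positivity),
        ENNReal.ofReal_coe_nnreal]
    simp_rw [this]
    rw [lintegral_const_mul', lintegral_coords_mul (f := fun x => ENNReal.ofReal ((1 + |x|) ^ (-s)))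
      (g := fun x => ENNReal.ofReal ((1 + |x|) ^ (-s'))) (by fun_prop) (by fun_prop)]
    exact ENNReal.coe_ne_top
  have hMm := measurable_weight hM
  calc wiener k a ^ 2
      ≤ (∫⁻ ζ, ENNReal.ofReal (√(p ζ)) *
          (ENNReal.ofReal (√(M (ζ 0) (ζ 1))) * ‖a ζ‖ₑ)) ^ 2 := by
        gcongr
        refine lintegral_mono_ae ?_
        filter_upwards [ae_coord_ne_zero] with ζ hζ
        rw [← mul_assoc, ← ENNReal.ofReal_mul (Real.sqrt_nonneg _), ← Real.sqrt_mul (hp0 ζ)]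
        gcongr
        exact Real.le_sqrt_of_sq_le (h _ _ hζ)
    _ ≤ (∫⁻ ζ, ENNReal.ofReal (√(p ζ)) ^ 2) *
          ∫⁻ ζ, (ENNReal.ofReal (√(M (ζ 0) (ζ 1))) * ‖a ζ‖ₑ) ^ 2 := by
        apply sq_lintegral_mul_le
        · fun_prop
        · exact (by fun_prop : Measurable fun ζ : Plane =>
            ENNReal.ofReal (√(M (ζ 0) (ζ 1)))).aemeasurable.mul ha.enorm.aemeasurable
    _ = (∫⁻ ζ, ENNReal.ofReal (p ζ)) * energy M a := by
        unfold energy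
        congr 1
        · refine lintegral_congr fun ζ => ?_
          rw [← ENNReal.ofReal_pow (Real.sqrt_nonneg _), Real.sq_sqrt (hp0 ζ)]
        · refine lintegral_congr fun ζ => ?_
          rw [mul_pow, ← ENNReal.ofReal_pow (Real.sqrt_nonneg _), Real.sq_sqrt (hM0 _ _).le]
    _ = _ := by
        rw [hpI, ENNReal.coe_mul, ENNReal.coe_toNNReal hlt]

theorem ennreal_add_sq_le (a b : ℝ≥0∞) : (a + b) ^ 2 ≤ 4 * (a ^ 2 + b ^ 2) := by
  rcases le_total a b with h | h
  · calc (a + b) ^ 2 ≤ (b + b) ^ 2 := by gcongr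
      _ = 4 * b ^ 2 := by rw [← two_mul, mul_pow]; norm_num
      _ ≤ _ := by gcongr; exact le_add_self
  · calc (a + b) ^ 2 ≤ (a + a) ^ 2 := by gcongr
      _ = 4 * a ^ 2 := by rw [← two_mul, mul_pow]; norm_num
      _ ≤ _ := by gcongr; exact le_self_add

theorem Dominates.add {M k l : ℝ → ℝ → ℝ}
    (hk : Measurable (Function.uncurry k)) (h : Dominates M k) (h' : Dominates M l) :
    Dominates M (fun x y => k x y + l x y) := by
  obtain ⟨C, hC⟩ := h
  obtain ⟨D, hD⟩ := h'
  refine ⟨4 * C + 4 * D, fun a ha => ?_⟩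
  have e : wiener (fun x y => k x y + l x y) a ≤ wiener k a + wiener l a := by
    unfold wiener
    rw [← lintegral_add_left']
    · refine lintegral_mono fun ζ => ?_
      rw [← add_mul]
      gcongr
      exact ENNReal.ofReal_add_le
    · exact (measurable_weight hk).ennreal_ofReal.aemeasurable.mul ha.enorm.aemeasurable
  calc _ ≤ (wiener k a + wiener l a) ^ 2 := by gcongr
    _ ≤ 4 * (wiener k a ^ 2 + wiener l a ^ 2) := ennreal_add_sq_le _ _
    _ ≤ 4 * (C * energy M a + D * energy M a) := by
        gcongr
        · exact hC a ha
        · exact hD a ha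
    _ = _ := by push_cast; ring

theorem wiener_mono {k l : ℝ → ℝ → ℝ} (h : ∀ x y, k x y ≤ l x y) (a : Plane → ℂ) :
    wiener k a ≤ wiener l a := by
  unfold wiener
  gcongr
  exact h _ _

theorem energy_mono {M L : ℝ → ℝ → ℝ} (h : ∀ x y, M x y ≤ L x y) (a : Plane → ℂ) :
    energy M a ≤ energy L a := by
  unfold energy
  gcongr
  exact h _ _

theorem Dominates.mono {M L k l : ℝ → ℝ → ℝ} (h : Dominates M k) (hM : ∀ x y, M x y ≤ L x y)
    (hk : ∀ x y, l x y ≤ k x y) : Dominates L l := by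
  obtain ⟨C, hC⟩ := h
  refine ⟨C, fun a ha => ?_⟩
  calc _ ≤ wiener k a ^ 2 := by gcongr; exact wiener_mono hk a
    _ ≤ _ := hC a ha
    _ ≤ _ := by gcongr; exact energy_mono hM a

theorem rpow_geom_le {A B M : ℝ} (hA : 0 ≤ A) (hB : 0 ≤ B) (hM : 0 < M) (hAM : A ≤ M)
    (hBM : B ≤ M) {θ : ℝ} (h0 : 0 ≤ θ) (h1 : θ ≤ 1) : A ^ (1 - θ) * B ^ θ ≤ M := by
  calc _ ≤ M ^ (1 - θ) * M ^ θ := by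
        gcongr
    _ = M := by rw [← Real.rpow_add hM]; simp

/-- The weight dominates both `(1+|x|)⁶` and `(1+|y|)⁴ / (1+|x|)²`, hence also their geometric mean
with exponents `1 - θ` and `θ`. The constant is `2⁵`, from convexity of the sixth power. -/
theorem rpow_le_weightX {x : ℝ} (y : ℝ) (hx : x ≠ 0) {θ : ℝ} (h0 : 0 ≤ θ) (h1 : θ ≤ 1) :
    (1 + |x|) ^ (6 - 8 * θ) * (1 + |y|) ^ (4 * θ) ≤ 32 * weightX x y := by
  have hq : 0 < 1 + |x| := by positivity
  have hr : 0 < 1 + |y| := by positivity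
  have hx2 : 0 < x ^ 2 := by positivity
  have hA : (1 + |x|) ^ 6 ≤ 32 * weightX x y := by
    have h := add_pow_le zero_le_one (abs_nonneg x) 6
    have e : |x| ^ 6 = x ^ 6 := by rw [← abs_pow]; exact abs_of_nonneg (by positivity)
    rw [e] at h
    unfold weightX
    have : 0 ≤ y ^ 4 / x ^ 2 := by positivity
    norm_num at h
    linarith
  have hB : (1 + |y|) ^ 4 / (1 + |x|) ^ 2 ≤ 32 * weightX x y := by
    have h := add_pow_le zero_le_one (abs_nonneg y) 4
    have e : |y| ^ 4 = y ^ 4 := by rw [← abs_pow]; exact abs_of_nonneg (by positivity)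
    rw [e] at h
    norm_num at h
    have h1 : 1 / (1 + |x|) ^ 2 ≤ 1 := by
      rw [div_le_one (by positivity)]
      exact one_le_pow₀ (by linarith [abs_nonneg x])
    have h2 : y ^ 4 / (1 + |x|) ^ 2 ≤ y ^ 4 / x ^ 2 := by
      have : x ^ 2 ≤ (1 + |x|) ^ 2 := by
        rw [← sq_abs x]
        gcongr
        linarith
      gcongr
    have : 0 ≤ x ^ 6 := by positivity
    calc _ ≤ 8 * (1 + y ^ 4) / (1 + |x|) ^ 2 := by gcongr
      _ = 8 * (1 / (1 + |x|) ^ 2) + 8 * (y ^ 4 / (1 + |x|) ^ 2) := by ring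
      _ ≤ 8 * 1 + 8 * (y ^ 4 / x ^ 2) := by gcongr
      _ ≤ _ := by
        have : 0 ≤ y ^ 4 / x ^ 2 := by positivity
        unfold weightX; linarith
  have := rpow_geom_le (by positivity) (by positivity)
    (by linarith [weightX_pos x y] : 0 < 32 * weightX x y) hA hB h0 h1
  refine le_of_eq_of_le ?_ this
  rw [Real.div_rpow (by positivity) (by positivity)]
  simp only [← Real.rpow_natCast, ← Real.rpow_mul hq.le, ← Real.rpow_mul hr.le]
  rw [mul_div_assoc', mul_div_right_comm, ← Real.rpow_sub hq]
  congr 2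
  push_cast; ring

theorem rpow_le_weightY (N : ℕ) (x y : ℝ) {θ : ℝ} (h0 : 0 ≤ θ) (h1 : θ ≤ 1) :
    (1 + |x|) ^ (6 * (1 - θ)) * (1 + |y|) ^ (2 * N + 4 * θ) ≤
      2 ^ (2 * N + 7) * weightY N x y := by
  have hq : 0 < 1 + |x| := by positivity
  have hr : 0 < 1 + |y| := by positivity
  obtain ⟨t1, t2, t3, t4⟩ := weightY_terms N x y
  have hp : ∀ k : ℕ, |y| ^ (2 * k) = y ^ (2 * k) := by
    intro k; rw [pow_mul, pow_mul, sq_abs]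
  have hA : (1 + |x|) ^ 6 * (1 + |y|) ^ (2 * N) ≤ 2 ^ (2 * N + 7) * weightY N x y := by
    have h := add_pow_le zero_le_one (abs_nonneg x) 6
    have h' := add_pow_le zero_le_one (abs_nonneg y) (2 * N)
    have h'' : |y| ^ (2 * N) ≤ 1 + |y| ^ (2 * (N + 2)) :=
      pow_le_one_add_pow (abs_nonneg y) (by omega)
    have e : |x| ^ 6 = x ^ 6 := by rw [← abs_pow]; exact abs_of_nonneg (by positivity)
    rw [hp] at h' h''
    rw [hp, show 2 * (N + 2) = 2 * N + 4 by ring] at h''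
    rw [e] at h
    have h3 : (2 : ℝ) ^ (2 * N - 1) ≤ 2 ^ (2 * N) :=
      pow_le_pow_right₀ (by norm_num) (by omega)
    have hy0 : 0 ≤ y ^ (2 * N) := by rw [pow_mul]; positivity
    calc _ ≤ (2 ^ 5 * (1 ^ 6 + x ^ 6)) * (2 ^ (2 * N) * (1 ^ (2 * N) + y ^ (2 * N))) := by
          gcongr
          refine h'.trans ?_
          gcongr
      _ = 2 ^ (2 * N + 5) * (1 + x ^ 6 + y ^ (2 * N) + x ^ 6 * y ^ (2 * N)) := by
          rw [pow_add]; simp only [one_pow]; ring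
      _ ≤ 2 ^ (2 * N + 5) * (4 * weightY N x y) := by
          gcongr
          unfold weightY weightX
          have : 0 ≤ x ^ 6 := by positivity
          have : 0 ≤ y ^ 4 / x ^ 2 := by positivity
          linarith
      _ = _ := by ring
  have hB : (1 + |y|) ^ (2 * N + 4) ≤ 2 ^ (2 * N + 7) * weightY N x y := by
    have h' := add_pow_le zero_le_one (abs_nonneg y) (2 * (N + 2))
    rw [hp, show 2 * (N + 2) = 2 * N + 4 by ring] at h'
    refine h'.trans ?_
    gcongr
    · norm_num
    · omega
    · unfold weightY weightX
      have : 0 ≤ x ^ 6 := by positivity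
      have : 0 ≤ y ^ 4 / x ^ 2 := by positivity
      simp only [one_pow]
      linarith
  have := rpow_geom_le (by positivity) (by positivity)
    (mul_pos (by positivity) (by linarith [weightY_pos N x y]) : 0 < 2 ^ (2 * N + 7) * weightY N x y)
    hA hB h0 h1
  refine le_of_eq_of_le ?_ this
  rw [Real.mul_rpow (by positivity) (by positivity)]
  simp only [← Real.rpow_natCast, ← Real.rpow_mul hq.le, ← Real.rpow_mul hr.le]
  rw [mul_assoc, ← Real.rpow_add hr]
  push_cast
  congr 2
  ring

theorem dominates_one_add_abs : Dominates weightX (fun x _ => 1 + |x|) := by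
  refine dominates_of_le measurable_weightX
    (fun x y => by linarith [weightX_pos x y])
    (s := 4 / 3) (s' := 4 / 3) (by norm_num) (by norm_num) 32 (fun x y hx => ?_)
  have hq : 0 < 1 + |x| := by positivity
  have hr : 0 < 1 + |y| := by positivity
  -- Integrability requires `6 - 8θ - 2 > 1` in `x` and `4θ > 1` in `y`, that is `1/4 < θ < 3/8`.
  have h := rpow_le_weightX y hx (θ := 1 / 3) (by norm_num) (by norm_num)
  have e : (1 + |x|) ^ 2 = ((1 + |x|) ^ (-(4 / 3 : ℝ)) * (1 + |y|) ^ (-(4 / 3 : ℝ))) *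
      ((1 + |x|) ^ (6 - 8 * (1 / 3) : ℝ) * (1 + |y|) ^ (4 * (1 / 3) : ℝ)) := by
    rw [mul_mul_mul_comm, ← Real.rpow_add hq, ← Real.rpow_add hr, ← Real.rpow_natCast]
    norm_num
  rw [e]
  calc _ ≤ ((1 + |x|) ^ (-(4 / 3 : ℝ)) * (1 + |y|) ^ (-(4 / 3 : ℝ))) * (32 * weightX x y) := by
        gcongr
    _ = _ := by push_cast; ring

theorem dominates_rpow : Dominates weightX (fun _ y => (1 + |y|) ^ (2 / 3 : ℝ)) := by
  refine dominates_of_le measurable_weightX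
    (fun x y => by linarith [weightX_pos x y])
    (s := 6 / 5) (s' := 16 / 15) (by norm_num) (by norm_num) 32 (fun x y hx => ?_)
  have hq : 0 < 1 + |x| := by positivity
  have hr : 0 < 1 + |y| := by positivity
  -- The window is narrow: `6 - 8θ > 1` and `4θ - 4/3 > 1` mean `7/12 < θ < 5/8`. The exponent `2/3`
  -- of `coefX` just fits.
  have h := rpow_le_weightX y hx (θ := 3 / 5) (by norm_num) (by norm_num)
  have e : ((1 + |y|) ^ (2 / 3 : ℝ)) ^ 2 =
      ((1 + |x|) ^ (-(6 / 5 : ℝ)) * (1 + |y|) ^ (-(16 / 15 : ℝ))) *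
      ((1 + |x|) ^ (6 - 8 * (3 / 5) : ℝ) * (1 + |y|) ^ (4 * (3 / 5) : ℝ)) := by
    rw [mul_mul_mul_comm, ← Real.rpow_add hq, ← Real.rpow_add hr, ← Real.rpow_natCast,
      ← Real.rpow_mul hr.le]
    norm_num
  rw [e]
  calc _ ≤ ((1 + |x|) ^ (-(6 / 5 : ℝ)) * (1 + |y|) ^ (-(16 / 15 : ℝ))) * (32 * weightX x y) := by
        gcongr
    _ = _ := by push_cast; ring

theorem dominates_pow_succ (N : ℕ) : Dominates (weightY N) (fun _ y => (1 + |y|) ^ (N + 1)) := by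
  refine dominates_of_le (measurable_weightY N)
    (fun x y => by linarith [weightY_pos N x y])
    (s := 6 / 5) (s' := 6 / 5) (by norm_num) (by norm_num) (2 ^ (2 * N + 7)) (fun x y hx => ?_)
  have hq : 0 < 1 + |x| := by positivity
  have hr : 0 < 1 + |y| := by positivity
  -- The conditions `6 (1 - θ) > 1` and `2N + 4θ - 2(N + 1) > 1` mean `3/4 < θ < 5/6`.
  have h := rpow_le_weightY N x y (θ := 4 / 5) (by norm_num) (by norm_num)
  have e : ((1 + |y|) ^ (N + 1)) ^ 2 =
      ((1 + |x|) ^ (-(6 / 5 : ℝ)) * (1 + |y|) ^ (-(6 / 5 : ℝ))) *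
      ((1 + |x|) ^ (6 * (1 - 4 / 5) : ℝ) * (1 + |y|) ^ (2 * N + 4 * (4 / 5) : ℝ)) := by
    rw [mul_mul_mul_comm, ← Real.rpow_add hq, ← Real.rpow_add hr, ← pow_mul, ← Real.rpow_natCast]
    have : -(6 / 5 : ℝ) + 6 * (1 - 4 / 5) = 0 := by norm_num
    rw [this, Real.rpow_zero, one_mul]
    congr 1
    push_cast; ring
  rw [e]
  calc _ ≤ ((1 + |x|) ^ (-(6 / 5 : ℝ)) * (1 + |y|) ^ (-(6 / 5 : ℝ))) *
        (2 ^ (2 * N + 7) * weightY N x y) := by gcongr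
    _ = _ := by push_cast; ring

theorem dominates_coefX : Dominates weightX coefX := by
  refine (dominates_one_add_abs.add
    (by unfold Function.uncurry; fun_prop) dominates_rpow).mono (fun _ _ => le_rfl) fun x y => ?_
  unfold coefX
  gcongr <;> linarith

theorem dominates_coefY (N : ℕ) : Dominates (weightY N) (coefY N) := by
  have h := (dominates_one_add_abs.mono (weightX_le_weightY N) (fun _ _ => le_rfl)).add
    (by unfold Function.uncurry; fun_prop)
    ((dominates_pow_succ N).add
      (by unfold Function.uncurry; fun_prop) (dominates_pow_succ N))
  refine h.mono (fun _ _ => le_rfl) fun x y => ?_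
  have h1 : |y| ≤ (1 + |y|) ^ (N + 1) := by
    calc |y| ≤ (1 + |y|) ^ 1 := by rw [pow_one]; linarith
      _ ≤ _ := pow_le_pow_right₀ (by linarith [abs_nonneg y]) (by omega)
  have h2 : |y| ^ (N + 1) ≤ (1 + |y|) ^ (N + 1) := by
    gcongr; linarith
  unfold coefY
  linarith

end KPI
-- Convolutions, trilinear integrals and the cubic flux
namespace KPI

/-- The convolution of two functions on the plane. -/
noncomputable def conv (f g : Plane → ℂ) (ζ : Plane) : ℂ := ∫ w, f w * g (ζ - w)

/-- The convolution of the absolute values. -/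
noncomputable def convAbs (f g : Plane → ℂ) (ζ : Plane) : ℝ≥0∞ := ∫⁻ w, ‖f w‖ₑ * ‖g (ζ - w)‖ₑ

theorem measurable_conv {f g : Plane → ℂ} (hf : Measurable f) (hg : Measurable g) :
    Measurable (conv f g) := by
  have : StronglyMeasurable (Function.uncurry fun ζ w : Plane => f w * g (ζ - w)) := by
    apply Measurable.stronglyMeasurable
    unfold Function.uncurry
    fun_prop
  exact this.integral_prod_right.measurable

theorem measurable_convAbs {f g : Plane → ℂ} (hf : Measurable f) (hg : Measurable g) :
    Measurable (convAbs f g) := by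
  unfold convAbs
  apply Measurable.lintegral_prod_right' (f := fun p : Plane × Plane => ‖f p.2‖ₑ * ‖g (p.1 - p.2)‖ₑ)
  fun_prop

theorem enorm_conv_le (f g : Plane → ℂ) (ζ : Plane) : ‖conv f g ζ‖ₑ ≤ convAbs f g ζ := by
  refine (enorm_integral_le_lintegral_enorm _).trans_eq ?_
  simp [convAbs, enorm_mul]

theorem convAbs_sq_le {f g : Plane → ℂ} (hf : Measurable f) (hg : Measurable g) (ζ : Plane) :
    convAbs f g ζ ^ 2 ≤ (∫⁻ w, ‖f w‖ₑ ^ 2) * ∫⁻ w, ‖g w‖ₑ ^ 2 := by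
  refine (sq_lintegral_mul_le volume (by fun_prop) (by fun_prop)).trans_eq ?_
  rw [lintegral_sub_left_eq_self (fun w => ‖g w‖ₑ ^ 2)]

/-- Young's inequality `L¹ * L² ⊆ L²`. -/
theorem lintegral_convAbs_sq_le {f g : Plane → ℂ} (hf : Measurable f) (hg : Measurable g) :
    ∫⁻ ζ, convAbs f g ζ ^ 2 ≤ (∫⁻ w, ‖f w‖ₑ) ^ 2 * ∫⁻ w, ‖g w‖ₑ ^ 2 := by
  have h1 : ∀ ζ, convAbs f g ζ ^ 2 ≤ (∫⁻ w, ‖f w‖ₑ) * ∫⁻ w, ‖f w‖ₑ * ‖g (ζ - w)‖ₑ ^ 2 := by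
    intro ζ
    have hs : ∀ x : ℝ≥0∞, (x ^ (1 / 2 : ℝ)) ^ 2 = x := by
      intro x; rw [← ENNReal.rpow_natCast, ← ENNReal.rpow_mul]; norm_num
    have h := sq_lintegral_mul_le volume (f := fun w => ‖f w‖ₑ ^ (1 / 2 : ℝ))
      (g := fun w => ‖f w‖ₑ ^ (1 / 2 : ℝ) * ‖g (ζ - w)‖ₑ) (by fun_prop) (by fun_prop)
    simp only [mul_pow, hs, ← mul_assoc] at h
    refine le_of_eq_of_le ?_ h
    unfold convAbs
    congr 1
    refine lintegral_congr fun w => ?_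
    rw [← sq, hs]
  calc _ ≤ ∫⁻ ζ, (∫⁻ w, ‖f w‖ₑ) * ∫⁻ w, ‖f w‖ₑ * ‖g (ζ - w)‖ₑ ^ 2 := lintegral_mono h1
    _ = (∫⁻ w, ‖f w‖ₑ) * ∫⁻ w, ∫⁻ ζ, ‖f w‖ₑ * ‖g (ζ - w)‖ₑ ^ 2 := by
        rw [lintegral_const_mul]
        · rw [lintegral_lintegral_swap]
          unfold Function.uncurry
          fun_prop
        · apply Measurable.lintegral_prod_right'
            (f := fun p : Plane × Plane => ‖f p.2‖ₑ * ‖g (p.1 - p.2)‖ₑ ^ 2)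
          fun_prop
    _ = (∫⁻ w, ‖f w‖ₑ) * ∫⁻ w, ‖f w‖ₑ * ∫⁻ z, ‖g z‖ₑ ^ 2 := by
        congr 1
        refine lintegral_congr fun w => ?_
        rw [lintegral_const_mul _ (by fun_prop), lintegral_sub_right_eq_self (fun z => ‖g z‖ₑ ^ 2)]
    _ = _ := by rw [lintegral_mul_const _ (by fun_prop)]; ring

theorem conv_comm (f g : Plane → ℂ) : conv f g = conv g f := by
  ext ζ
  unfold conv
  rw [← integral_sub_left_eq_self _ volume ζ]
  simp [mul_comm]

theorem convAbs_comm (f g : Plane → ℂ) : convAbs f g = convAbs g f := by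
  ext ζ
  unfold convAbs
  rw [← lintegral_sub_left_eq_self _ ζ]
  simp [mul_comm]

/-- For a fixed first frequency, Cauchy–Schwarz and invariance of the measure bound the integral in
the second frequency by the two `L²` norms; integrating `f` over the first frequency gives its `L¹`
norm. -/
theorem sq_lintegral_trilinear_le {f g h : Plane → ℝ≥0∞} (hf : Measurable f) (hg : Measurable g)
    (hh : Measurable h) :
    (∫⁻ p : Plane × Plane, f p.1 * g p.2 * h (-p.1 - p.2)) ^ 2 ≤
      (∫⁻ w, f w) ^ 2 * ((∫⁻ w, g w ^ 2) * ∫⁻ w, h w ^ 2) := by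
  set B := (∫⁻ w, g w ^ 2) * ∫⁻ w, h w ^ 2 with hB
  have hs : ∀ x : ℝ≥0∞, (x ^ (2⁻¹ : ℝ)) ^ 2 = x := by
    intro x; rw [← ENNReal.rpow_natCast, ← ENNReal.rpow_mul]; norm_num
  have key : ∫⁻ p : Plane × Plane, f p.1 * g p.2 * h (-p.1 - p.2) ≤
      (∫⁻ w, f w) * B ^ (2⁻¹ : ℝ) := by
    rw [Measure.volume_eq_prod, lintegral_prod _ (by fun_prop), ← lintegral_mul_const _ hf]
    refine lintegral_mono fun z => ?_
    simp only [mul_assoc]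
    rw [lintegral_const_mul _ (by fun_prop)]
    gcongr
    rw [ENNReal.le_rpow_inv_iff (by norm_num)]
    have h2 := sq_lintegral_mul_le volume (f := g) (g := fun w => h (-z - w)) (by fun_prop)
      (by fun_prop)
    rw [lintegral_sub_left_eq_self (fun w => h w ^ 2)] at h2
    simpa using h2
  calc _ ≤ ((∫⁻ w, f w) * B ^ (2⁻¹ : ℝ)) ^ 2 := by gcongr
    _ = _ := by rw [mul_pow, hs]

theorem lintegral_trilinear_le {f g : Plane → ℝ≥0∞} (hf : Measurable f) (hg : Measurable g) :
    ∫⁻ p : Plane × Plane, f p.1 * g p.2 * g (-p.1 - p.2) ≤ (∫⁻ w, f w) * ∫⁻ w, g w ^ 2 := by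
  have h := sq_lintegral_trilinear_le hf hg hg
  rw [← sq, ← mul_pow] at h
  exact (ENNReal.pow_le_pow_left_iff two_ne_zero).1 h

/-- The change of variables exchanging the second and third frequency. -/
theorem measurePreserving_exchange :
    MeasurePreserving (fun p : Plane × Plane => (p.1, -p.1 - p.2)) volume volume := by
  refine MeasurePreserving.skew_product (g := fun z w : Plane => -z - w)
    (MeasurePreserving.id volume) (by unfold Function.uncurry; fun_prop) ?_
  refine Filter.Eventually.of_forall fun z => ?_
  exact (Measure.measurePreserving_sub_left volume (-z)).map_eq

/-- The exchange of the second and third frequency as an equivalence. -/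
def exchange : (Plane × Plane) ≃ᵐ (Plane × Plane) where
  toFun p := (p.1, -p.1 - p.2)
  invFun p := (p.1, -p.1 - p.2)
  left_inv p := by simp
  right_inv p := by simp
  measurable_toFun := by dsimp; fun_prop
  measurable_invFun := by dsimp [Equiv.symm]; fun_prop

/-- Together with `integral_swap` this gives two transpositions that generate all permutations of
three frequencies with zero sum, which is what the symmetrisation of the flux needs. -/
theorem integral_exchange (F : Plane → Plane → Plane → ℂ) :
    ∫ p : Plane × Plane, F p.1 p.2 (-p.1 - p.2) = ∫ p : Plane × Plane, F p.1 (-p.1 - p.2) p.2 := by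
  have h := MeasurePreserving.integral_comp' (f := exchange) measurePreserving_exchange
    (fun p : Plane × Plane => F p.1 p.2 (-p.1 - p.2))
  rw [← h]
  simp [exchange]

theorem integral_swap (F : Plane → Plane → Plane → ℂ) :
    ∫ p : Plane × Plane, F p.1 p.2 (-p.1 - p.2) = ∫ p : Plane × Plane, F p.2 p.1 (-p.1 - p.2) := by
  have h := integral_prod_swap (μ := (volume : Measure Plane)) (ν := (volume : Measure Plane))
    (fun p : Plane × Plane => F p.1 p.2 (-p.1 - p.2))
  rw [Measure.volume_eq_prod, ← h]
  congr 1
  ext p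
  simp only [Prod.fst_swap, Prod.snd_swap]
  congr 1
  abel

theorem lintegral_exchange (F : Plane → Plane → Plane → ℝ≥0∞) :
    ∫⁻ p : Plane × Plane, F p.1 p.2 (-p.1 - p.2) =
      ∫⁻ p : Plane × Plane, F p.1 (-p.1 - p.2) p.2 := by
  have h := MeasurePreserving.lintegral_comp_emb (measurePreserving_exchange)
    exchange.measurableEmbedding (fun p : Plane × Plane => F p.1 p.2 (-p.1 - p.2))
  rw [← h]
  simp

theorem lintegral_swap (F : Plane → Plane → Plane → ℝ≥0∞) :
    ∫⁻ p : Plane × Plane, F p.1 p.2 (-p.1 - p.2) =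
      ∫⁻ p : Plane × Plane, F p.2 p.1 (-p.1 - p.2) := by
  have h := lintegral_prod_swap (μ := (volume : Measure Plane)) (ν := (volume : Measure Plane))
    (fun p : Plane × Plane => F p.1 p.2 (-p.1 - p.2))
  rw [Measure.volume_eq_prod, ← h]
  congr 1
  ext p
  simp only [Prod.fst_swap, Prod.snd_swap]
  congr 1
  abel

theorem integrable_exchange (F : Plane → Plane → Plane → ℂ) :
    Integrable (fun p : Plane × Plane => F p.1 (-p.1 - p.2) p.2) ↔
      Integrable (fun p : Plane × Plane => F p.1 p.2 (-p.1 - p.2)) := by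
  have h := MeasurePreserving.integrable_comp_emb (measurePreserving_exchange)
    exchange.measurableEmbedding (g := fun p : Plane × Plane => F p.1 p.2 (-p.1 - p.2))
  rw [← h]
  simp [Function.comp_def]

theorem integrable_swap (F : Plane → Plane → Plane → ℂ) :
    Integrable (fun p : Plane × Plane => F p.2 p.1 (-p.1 - p.2)) ↔
      Integrable (fun p : Plane × Plane => F p.1 p.2 (-p.1 - p.2)) := by
  have h := integrable_swap_iff (μ := (volume : Measure Plane)) (ν := (volume : Measure Plane))
    (f := fun p : Plane × Plane => F p.1 p.2 (-p.1 - p.2))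
  rw [Measure.volume_eq_prod, ← h]
  have : (fun p : Plane × Plane => F p.1 p.2 (-p.1 - p.2)) ∘ Prod.swap =
    fun p : Plane × Plane => F p.2 p.1 (-p.1 - p.2) := by
    ext p
    simp only [Function.comp, Prod.fst_swap, Prod.snd_swap]
    congr 1
    abel
  rw [this]


/-- The cubic flux of the energy with weight `M`, after symmetrisation. -/
theorem enorm_energy_flux_le {M c : ℝ → ℝ → ℝ} {C : ℝ} (hM : Measurable (Function.uncurry M))
    (hM0 : ∀ x y, 0 ≤ M x y)
    (hc : Measurable (Function.uncurry c)) (hc0 : ∀ x y, 0 ≤ c x y)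
    (hT : TriBound M (fun x y => √(M x y)) c C) {a : Plane → ℂ} (ha : Measurable a)
    (hint : Integrable (fun p : Plane × Plane =>
      ((p.1 0 * M (p.1 0) (p.1 1) : ℝ) : ℂ) * (a p.1 * a p.2 * a (-p.1 - p.2)))) :
    ‖∫ p : Plane × Plane, ((p.1 0 * M (p.1 0) (p.1 1) : ℝ) : ℂ) *
      (a p.1 * a p.2 * a (-p.1 - p.2))‖ₑ ≤ 3 * ENNReal.ofReal C * (wiener c a * energy M a) := by
  set m : Plane → ℂ := fun ζ => ((ζ 0 * M (ζ 0) (ζ 1) : ℝ) : ℂ) with hm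
  set I := ∫ p : Plane × Plane, m p.1 * (a p.1 * a p.2 * a (-p.1 - p.2)) with hI
  have hint1 : Integrable (fun p : Plane × Plane => m p.2 * (a p.1 * a p.2 * a (-p.1 - p.2))) := by
    have := (integrable_swap (fun z₀ z₁ z₂ => m z₀ * (a z₀ * a z₁ * a z₂))).2 hint
    refine this.congr (Filter.Eventually.of_forall fun p => ?_)
    simp only; ring
  have hint2 : Integrable (fun p : Plane × Plane =>
      m (-p.1 - p.2) * (a p.1 * a p.2 * a (-p.1 - p.2))) := by
    have := (integrable_exchange (fun z₀ z₁ z₂ => m z₁ * (a z₀ * a z₁ * a z₂))).2 hint1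
    refine this.congr (Filter.Eventually.of_forall fun p => ?_)
    simp only; ring
  have hI1 : ∫ p : Plane × Plane, m p.2 * (a p.1 * a p.2 * a (-p.1 - p.2)) = I := by
    rw [hI, integral_swap (fun z₀ z₁ z₂ => m z₀ * (a z₀ * a z₁ * a z₂))]
    refine integral_congr_ae (Filter.Eventually.of_forall fun p => ?_)
    simp only; ring
  have hI2 : ∫ p : Plane × Plane, m (-p.1 - p.2) * (a p.1 * a p.2 * a (-p.1 - p.2)) = I := by
    rw [← hI1, integral_exchange (fun z₀ z₁ z₂ => m z₁ * (a z₀ * a z₁ * a z₂))]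
    refine integral_congr_ae (Filter.Eventually.of_forall fun p => ?_)
    simp only; ring
  -- The product of the three values of `a` is symmetric, so the multiplier may sit on any of the
  -- three frequencies; adding the three versions produces the sum that `TriBound` controls.
  have h3 : 3 * I = ∫ p : Plane × Plane, (m p.1 + m p.2 + m (-p.1 - p.2)) *
      (a p.1 * a p.2 * a (-p.1 - p.2)) := by
    have h : 3 * I = I + (∫ p : Plane × Plane, m p.2 * (a p.1 * a p.2 * a (-p.1 - p.2)))
        + ∫ p : Plane × Plane, m (-p.1 - p.2) * (a p.1 * a p.2 * a (-p.1 - p.2)) := by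
      rw [hI1, hI2]; ring
    rw [h, hI, ← integral_add hint hint1, ← integral_add _ hint2]
    · refine integral_congr_ae (Filter.Eventually.of_forall fun p => ?_)
      simp only; ring
    · exact hint.add hint1
  set f : Plane → ℝ≥0∞ := fun ζ => ENNReal.ofReal (c (ζ 0) (ζ 1)) * ‖a ζ‖ₑ with hf
  set g : Plane → ℝ≥0∞ := fun ζ => ENNReal.ofReal (√(M (ζ 0) (ζ 1))) * ‖a ζ‖ₑ with hg
  have hfm : Measurable f := (measurable_weight hc).ennreal_ofReal.mul ha.enorm
  have hgm : Measurable g := by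
    have := measurable_weight hM
    fun_prop
  have hg2 : ∫⁻ ζ, g ζ ^ 2 = energy M a := by
    refine lintegral_congr fun ζ => ?_
    rw [hg, mul_pow, ← ENNReal.ofReal_pow (Real.sqrt_nonneg _), Real.sq_sqrt (hM0 _ _)]
  have hL := lintegral_trilinear_le hfm hgm
  rw [hg2] at hL
  have hL' : ∫⁻ p : Plane × Plane, g p.1 * f p.2 * g (-p.1 - p.2) ≤ wiener c a * energy M a := by
    rw [lintegral_swap (fun z₀ z₁ z₂ => g z₀ * f z₁ * g z₂)]
    refine le_of_eq_of_le (lintegral_congr fun p => ?_) hL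
    ring
  have hL'' : ∫⁻ p : Plane × Plane, g p.1 * g p.2 * f (-p.1 - p.2) ≤ wiener c a * energy M a := by
    rw [lintegral_exchange (fun z₀ z₁ z₂ => g z₀ * g z₁ * f z₂)]
    refine le_of_eq_of_le (lintegral_congr fun p => ?_) hL'
    ring
  -- `TriBound` says nothing where some `xᵢ` vanishes, but such frequencies form a null set.
  have hne : ∀ᵐ p : Plane × Plane, p.1 0 ≠ 0 ∧ p.2 0 ≠ 0 ∧ (-p.1 - p.2) 0 ≠ 0 := by
    have h1 : ∀ᵐ p : Plane × Plane, p.1 0 ≠ 0 :=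
      Measure.quasiMeasurePreserving_fst.ae ae_coord_ne_zero
    have h2 : ∀ᵐ p : Plane × Plane, p.2 0 ≠ 0 :=
      Measure.quasiMeasurePreserving_snd.ae ae_coord_ne_zero
    have h3 : ∀ᵐ p : Plane × Plane, (-p.1 - p.2) 0 ≠ 0 :=
      measurePreserving_exchange.quasiMeasurePreserving.ae h2
    filter_upwards [h1, h2, h3] with p h1 h2 h3 using ⟨h1, h2, h3⟩
  calc ‖I‖ₑ ≤ ‖3 * I‖ₑ := by
        rw [enorm_mul]
        refine le_mul_of_one_le_left (zero_le) ?_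
        rw [← ofReal_norm]
        norm_num
    _ ≤ ∫⁻ p : Plane × Plane, ‖(m p.1 + m p.2 + m (-p.1 - p.2)) *
      (a p.1 * a p.2 * a (-p.1 - p.2))‖ₑ := by
        rw [h3]; exact enorm_integral_le_lintegral_enorm _
    _ ≤ ∫⁻ p : Plane × Plane, ENNReal.ofReal C * (f p.1 * g p.2 * g (-p.1 - p.2)
        + g p.1 * f p.2 * g (-p.1 - p.2) + g p.1 * g p.2 * f (-p.1 - p.2)) := by
        refine lintegral_mono_ae ?_
        filter_upwards [hne] with p ⟨h0, h1, h2⟩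
        have hb := hT (p.1 0) (p.2 0) ((-p.1 - p.2) 0) (p.1 1) (p.2 1) ((-p.1 - p.2) 1)
          (by simp) (by simp) h0 h1 h2
        rw [enorm_mul, enorm_mul, enorm_mul]
        have e : ‖m p.1 + m p.2 + m (-p.1 - p.2)‖ₑ = ENNReal.ofReal
            |p.1 0 * M (p.1 0) (p.1 1) + p.2 0 * M (p.2 0) (p.2 1)
              + (-p.1 - p.2) 0 * M ((-p.1 - p.2) 0) ((-p.1 - p.2) 1)| := by
          rw [hm, ← ofReal_norm]
          simp only [← Complex.ofReal_add]
          rw [Complex.norm_real, Real.norm_eq_abs]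
        have hS := ENNReal.ofReal_le_ofReal hb
        set z := -p.1 - p.2
        have k0 := hc0 (p.1 0) (p.1 1)
        have k1 := hc0 (p.2 0) (p.2 1)
        have k2 := hc0 (z 0) (z 1)
        rw [ENNReal.ofReal_mul' (by positivity), ENNReal.ofReal_add (by positivity) (by positivity),
          ENNReal.ofReal_add (by positivity) (by positivity), ENNReal.ofReal_mul k0,
          ENNReal.ofReal_mul k1, ENNReal.ofReal_mul k2, ENNReal.ofReal_mul (by positivity),
          ENNReal.ofReal_mul (by positivity), ENNReal.ofReal_mul (by positivity), ← e] at hS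
        calc _ ≤ _ := mul_le_mul_left hS (‖a p.1‖ₑ * ‖a p.2‖ₑ * ‖a z‖ₑ)
          _ = _ := by simp only [hf, hg]; ring
    _ ≤ ENNReal.ofReal C * (wiener c a * energy M a + wiener c a * energy M a
          + wiener c a * energy M a) := by
        rw [lintegral_const_mul _ (by fun_prop), lintegral_add_left (by fun_prop),
          lintegral_add_left (by fun_prop)]
        gcongr
        exact hL
    _ = _ := by ring

/-- The flux in the equation for the difference of two solutions. -/
theorem enorm_difference_flux_le {d s : Plane → ℂ} (hd : Measurable d) (hs : Measurable s)
    (hint : Integrable (fun p : Plane × Plane =>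
      ((p.1 0 : ℝ) : ℂ) * (d p.1 * s p.2 * d (-p.1 - p.2)))) :
    ‖∫ p : Plane × Plane, ((p.1 0 : ℝ) : ℂ) * (d p.1 * s p.2 * d (-p.1 - p.2))‖ₑ ≤
      wiener (fun x _ => |x|) s * ∫⁻ ζ, ‖d ζ‖ₑ ^ 2 := by
  set m : Plane → ℂ := fun ζ => ((ζ 0 : ℝ) : ℂ) with hm
  set I := ∫ p : Plane × Plane, m p.1 * (d p.1 * s p.2 * d (-p.1 - p.2)) with hI
  -- exchange the first and third frequency
  have hint1 : Integrable (fun p : Plane × Plane => m p.2 * (d p.2 * s p.1 * d (-p.1 - p.2))) :=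
    (integrable_swap (fun z₀ z₁ z₂ => m z₀ * (d z₀ * s z₁ * d z₂))).2 hint
  have hint2 : Integrable (fun p : Plane × Plane =>
      m (-p.1 - p.2) * (d p.2 * s p.1 * d (-p.1 - p.2))) := by
    have := (integrable_exchange (fun z₀ z₁ z₂ => m z₁ * (d z₁ * s z₀ * d z₂))).2 hint1
    refine this.congr (Filter.Eventually.of_forall fun p => ?_)
    simp only; ring
  have hI1 : ∫ p : Plane × Plane, m p.2 * (d p.2 * s p.1 * d (-p.1 - p.2)) = I := by
    rw [hI, integral_swap (fun z₀ z₁ z₂ => m z₀ * (d z₀ * s z₁ * d z₂))]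
  have hI2 : ∫ p : Plane × Plane, m (-p.1 - p.2) * (d p.2 * s p.1 * d (-p.1 - p.2)) = I := by
    rw [← hI1, integral_exchange (fun z₀ z₁ z₂ => m z₁ * (d z₁ * s z₀ * d z₂))]
    refine integral_congr_ae (Filter.Eventually.of_forall fun p => ?_)
    simp only; ring
  -- This is integration by parts: symmetrising over the two frequencies carried by `d` leaves the
  -- sum of their first coordinates, which is minus that of `s`. The derivative thus falls on `s`.
  have h3 : 2 * I = ∫ p : Plane × Plane, (m p.2 + m (-p.1 - p.2)) *
      (d p.2 * s p.1 * d (-p.1 - p.2)) := by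
    have h : 2 * I = (∫ p : Plane × Plane, m p.2 * (d p.2 * s p.1 * d (-p.1 - p.2)))
        + ∫ p : Plane × Plane, m (-p.1 - p.2) * (d p.2 * s p.1 * d (-p.1 - p.2)) := by
      rw [hI1, hI2]; ring
    rw [h, ← integral_add hint1 hint2]
    refine integral_congr_ae (Filter.Eventually.of_forall fun p => ?_)
    simp only; ring
  calc ‖I‖ₑ ≤ ‖2 * I‖ₑ := by
        rw [enorm_mul]
        refine le_mul_of_one_le_left (zero_le) ?_
        rw [← ofReal_norm]
        norm_num
    _ ≤ ∫⁻ p : Plane × Plane, ‖(m p.2 + m (-p.1 - p.2)) * (d p.2 * s p.1 * d (-p.1 - p.2))‖ₑ := by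
        rw [h3]; exact enorm_integral_le_lintegral_enorm _
    _ = ∫⁻ p : Plane × Plane, (ENNReal.ofReal |p.1 0| * ‖s p.1‖ₑ) * ‖d p.2‖ₑ * ‖d (-p.1 - p.2)‖ₑ := by
        refine lintegral_congr fun p => ?_
        have e : m p.2 + m (-p.1 - p.2) = ((-(p.1 0) : ℝ) : ℂ) := by
          rw [hm]; push_cast; simp
        rw [e, enorm_mul, enorm_mul, enorm_mul, ← ofReal_norm, Complex.norm_real, norm_neg,
          Real.norm_eq_abs]
        ring
    _ ≤ _ := lintegral_trilinear_le (f := fun ζ : Plane => ENNReal.ofReal |ζ 0| * ‖s ζ‖ₑ)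
        (g := fun ζ => ‖d ζ‖ₑ) (by fun_prop) (by fun_prop)

end KPI
-- The `L²` Fourier transform: integral formula, Hermitian symmetry, products
namespace KPI

theorem integral_smul_fourier (f : L2C) (g : SchwartzMap Plane ℂ) :
    ∫ x, g x • (𝓕 f : L2C) x = ∫ x, (𝓕 g) x • f x := by
  have h := congrArg (fun T => T g) (Lp.fourier_toTemperedDistribution_eq f)
  simp only [TemperedDistribution.fourier_apply, Lp.toTemperedDistribution_apply] at h
  exact h.symm

theorem integral_smul_fourierInv (f : L2C) (g : SchwartzMap Plane ℂ) :
    ∫ x, g x • (𝓕⁻ f : L2C) x = ∫ x, (𝓕⁻ g) x • f x := by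
  have h := congrArg (fun T => T g) (Lp.fourierInv_toTemperedDistribution_eq f)
  simp only [TemperedDistribution.fourierInv_apply, Lp.toTemperedDistribution_apply] at h
  exact h.symm

theorem locallyIntegrable_L2C (f : L2C) : LocallyIntegrable f :=
  (Lp.memLp f).locallyIntegrable (by norm_num)

/-- The `L²` Fourier transform is given by the integral on `L¹ ∩ L²`. -/
theorem coeFn_fourier_of_integrable {f : L2C} (hf : Integrable f) :
    ((𝓕 f : L2C) : Plane → ℂ) =ᵐ[volume] 𝓕 (f : Plane → ℂ) := by
  have hc : Continuous (𝓕 (f : Plane → ℂ)) :=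
    VectorFourier.fourierIntegral_continuous Real.continuous_fourierChar continuous_inner hf
  refine ae_eq_of_integral_contDiff_smul_eq (locallyIntegrable_L2C _) hc.locallyIntegrable ?_
  intro g hg hgc
  have hgc' : HasCompactSupport (fun x => (g x : ℂ)) := hgc.comp_left (g := fun x : ℝ => (x : ℂ)) rfl
  set G : SchwartzMap Plane ℂ := hgc'.toSchwartzMap (Complex.ofRealCLM.contDiff.comp hg) with hG
  have h := integral_smul_fourier f G
  have e : ∀ x, G x = (g x : ℂ) := fun x => rfl
  have h2 := VectorFourier.integral_fourierIntegral_smul_eq_flip (L := innerₗ Plane)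
    (μ := volume) (ν := volume) Real.continuous_fourierChar continuous_inner G.integrable hf
  simp only [flip_innerₗ] at h2
  change ∫ x, (𝓕 G) x • f x = ∫ x, G x • 𝓕 (f : Plane → ℂ) x at h2
  rw [h2] at h
  simpa [e] using h


/-- The inverse `L²` Fourier transform is given by the integral on `L¹ ∩ L²`. -/
theorem coeFn_fourierInv_of_integrable {f : L2C} (hf : Integrable f) :
    ((𝓕⁻ f : L2C) : Plane → ℂ) =ᵐ[volume] 𝓕⁻ (f : Plane → ℂ) := by
  have hL : Continuous fun p : Plane × Plane => (-innerₗ Plane) p.1 p.2 := by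
    simp only [LinearMap.neg_apply, innerₗ_apply_apply]
    exact continuous_inner.neg
  have hc : Continuous (𝓕⁻ (f : Plane → ℂ)) :=
    VectorFourier.fourierIntegral_continuous Real.continuous_fourierChar hL hf
  refine ae_eq_of_integral_contDiff_smul_eq (locallyIntegrable_L2C _) hc.locallyIntegrable ?_
  intro g hg hgc
  have hgc' : HasCompactSupport (fun x => (g x : ℂ)) := hgc.comp_left (g := fun x : ℝ => (x : ℂ)) rfl
  set G : SchwartzMap Plane ℂ := hgc'.toSchwartzMap (Complex.ofRealCLM.contDiff.comp hg) with hG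
  have h := integral_smul_fourierInv f G
  have e : ∀ x, G x = (g x : ℂ) := fun x => rfl
  have h2 := VectorFourier.integral_fourierIntegral_smul_eq_flip (L := -innerₗ Plane)
    (μ := volume) (ν := volume) Real.continuous_fourierChar hL G.integrable hf
  have hflip : (-innerₗ Plane).flip = -innerₗ Plane := by
    ext x y; simp [real_inner_comm]
  rw [hflip] at h2
  have e1 : ∀ x, (𝓕⁻ G) x = VectorFourier.fourierIntegral Real.fourierChar volume
      (-innerₗ Plane) G x := by
    intro x
    rw [SchwartzMap.fourierInv_coe]
    rfl
  have e2 : ∀ x, 𝓕⁻ (f : Plane → ℂ) x = VectorFourier.fourierIntegral Real.fourierChar volume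
      (-innerₗ Plane) f x := fun x => rfl
  simp only [← e1, ← e2] at h2
  rw [h2] at h
  simpa [e] using h

/-- Complex conjugation on `L²`. -/
noncomputable def conjL : L2C →L[ℝ] L2C := (Complex.conjCLE : ℂ →L[ℝ] ℂ).compLpL 2 volume

theorem coeFn_conjL (f : L2C) : conjL f =ᵐ[volume] fun x => (starRingEnd ℂ) (f x) := by
  filter_upwards [ContinuousLinearMap.coeFn_compLpL (p := 2) (μ := (volume : Measure Plane))
    (Complex.conjCLE : ℂ →L[ℝ] ℂ) f] with x hx
  unfold conjL
  rw [hx]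
  rfl

theorem measurePreserving_neg_plane : MeasurePreserving (fun x : Plane => -x) volume volume :=
  Measure.measurePreserving_neg volume

/-- Reflection on `L²`. -/
noncomputable def reflL : L2C → L2C :=
  Lp.compMeasurePreserving (fun x : Plane => -x) measurePreserving_neg_plane

theorem coeFn_reflL (f : L2C) : reflL f =ᵐ[volume] fun x => f (-x) :=
  Lp.coeFn_compMeasurePreserving f measurePreserving_neg_plane

/-- Both sides are continuous in `f`, so density reduces the identity to Schwartz functions, where
the transform is an integral and conjugation reverses the sign in the exponential. -/
theorem fourier_conjL (f : L2C) : 𝓕 (conjL f) = conjL (reflL (𝓕 f)) := by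
  refine DenseRange.induction_on (p := fun f : L2C => 𝓕 (conjL f) = conjL (reflL (𝓕 f)))
    (SchwartzMap.denseRange_toLpCLM (E := Plane) (F := ℂ) (μ := volume) (p := 2)
      ENNReal.ofNat_ne_top) f ?_ ?_
  · refine isClosed_eq ?_ ?_
    · exact (Lp.fourierTransformₗᵢ Plane ℂ).continuous.comp conjL.continuous
    · exact conjL.continuous.comp ((Lp.isometry_compMeasurePreserving
        measurePreserving_neg_plane).continuous.comp (Lp.fourierTransformₗᵢ Plane ℂ).continuous)
  · intro g
    rw [SchwartzMap.toLpCLM_apply]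
    set f : L2C := g.toLp 2 volume with hf
    have hfi : Integrable f := g.integrable.congr (g.coeFn_toLp 2 volume).symm
    have hci : Integrable (conjL f) := by
      refine Integrable.congr ?_ (coeFn_conjL f).symm
      exact (Complex.conjCLE : ℂ →L[ℝ] ℂ).integrable_comp hfi
    apply Lp.ext
    have h1 := coeFn_fourier_of_integrable hfi
    have h1' := measurePreserving_neg_plane.quasiMeasurePreserving.ae h1
    filter_upwards [coeFn_fourier_of_integrable hci, coeFn_conjL (reflL (𝓕 f)),
      coeFn_reflL (𝓕 f), h1'] with x h2 h3 h4 h5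
    rw [h2, h3, h4, h5, Real.fourier_eq, Real.fourier_eq, ← integral_conj]
    refine integral_congr_ae ?_
    filter_upwards [coeFn_conjL f] with v hv
    rw [hv, Circle.smul_def, Circle.smul_def, smul_eq_mul, smul_eq_mul, map_mul]
    congr 1
    rw [← Circle.coe_inv_eq_conj, ← AddChar.map_neg_eq_inv]
    simp

/-- The Fourier transforms of real functions are the functions with this symmetry. -/
def Herm (a : Plane → ℂ) : Prop := ∀ᵐ ζ : Plane, a (-ζ) = (starRingEnd ℂ) (a ζ)

theorem herm_iff (a : L2C) : Herm a ↔ conjL (reflL a) = a := by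
  have h0 : conjL (reflL a) =ᵐ[volume] fun x => (starRingEnd ℂ) (a (-x)) := by
    filter_upwards [coeFn_conjL (reflL a), coeFn_reflL a] with x h1 h2
    rw [h1, h2]
  constructor
  · intro h
    apply Lp.ext
    filter_upwards [h0, h] with x h1 h2
    rw [h1, h2, Complex.conj_conj]
  · intro h
    rw [h] at h0
    filter_upwards [h0] with x hx
    conv_rhs => rw [hx]
    rw [Complex.conj_conj]

/-- The Fourier transform of a real function. -/
noncomputable def four (u : L2R) : L2C := 𝓕 (toC u)

/-- The real part of the inverse Fourier transform. -/
noncomputable def fourInv : L2C →L[ℝ] L2R :=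
  (Complex.reCLM.compLpL 2 volume).comp
    ((Lp.fourierTransformₗᵢ Plane ℂ).symm.toContinuousLinearEquiv.toContinuousLinearMap.restrictScalars
      ℝ)

theorem coeFn_toC (u : L2R) : toC u =ᵐ[volume] fun x => (u x : ℂ) :=
  ContinuousLinearMap.coeFn_compLp Complex.ofRealCLM u

theorem norm_toC (u : L2R) : ‖toC u‖ = ‖u‖ := by
  rw [Lp.norm_def, Lp.norm_def]
  congr 1
  refine eLpNorm_congr_norm_ae ?_
  filter_upwards [coeFn_toC u] with x hx
  rw [hx, Complex.norm_real]

theorem norm_four (u : L2R) : ‖four u‖ = ‖u‖ := by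
  unfold four
  rw [Lp.norm_fourier_eq, norm_toC]

/-- `four` as a linear isometry. -/
noncomputable def fourL : L2R →ₗᵢ[ℝ] L2C where
  toFun := four
  map_add' u v := by
    have h : toC (u + v) = toC u + toC v := (Complex.ofRealCLM.compLpₗ 2 volume).map_add u v
    unfold four
    rw [h, FourierTransform.fourier_add]
  map_smul' c u := by
    have h : toC (c • u) = c • toC u := (Complex.ofRealCLM.compLpₗ 2 volume).map_smul c u
    unfold four
    rw [h]
    exact ((Lp.fourierTransformₗᵢ Plane ℂ).toContinuousLinearEquiv.toContinuousLinearMap.restrictScalars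
      ℝ).map_smul c (toC u)
  norm_map' := norm_four

theorem fourL_apply (u : L2R) : fourL u = four u := rfl

theorem herm_four (u : L2R) : Herm (four u) := by
  rw [herm_iff]
  unfold four
  rw [← fourier_conjL]
  congr 1
  apply Lp.ext
  filter_upwards [coeFn_conjL (toC u), coeFn_toC u] with x h1 h2
  rw [h1, h2, Complex.conj_ofReal]

theorem fourInv_apply (a : L2C) : fourInv a = Complex.reCLM.compLp (𝓕⁻ a) := rfl

theorem fourInv_four (u : L2R) : fourInv (four u) = u := by
  rw [fourInv_apply, four, FourierTransform.fourierInv_fourier_eq]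
  apply Lp.ext
  filter_upwards [ContinuousLinearMap.coeFn_compLp Complex.reCLM (toC u), coeFn_toC u] with x h1 h2
  rw [h1, h2]
  simp

/-- Hermitian symmetry makes the inverse transform invariant under conjugation, so the real part
taken in `fourInv` discards nothing. -/
theorem toC_fourInv {a : L2C} (ha : Herm a) : toC (fourInv a) = 𝓕⁻ a := by
  have h := fourier_conjL (𝓕⁻ a)
  rw [FourierTransform.fourier_fourierInv_eq, (herm_iff a).1 ha] at h
  have h' : conjL (𝓕⁻ a) = 𝓕⁻ a :=
    (FourierTransform.fourierInv_fourier_eq (E := L2C) (F := L2C) (conjL (𝓕⁻ a))).symm.trans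
      (congrArg (fun f : L2C => (𝓕⁻ f : L2C)) h)
  have h0 := coeFn_conjL (𝓕⁻ a)
  rw [h'] at h0
  apply Lp.ext
  filter_upwards [coeFn_toC (fourInv a), ContinuousLinearMap.coeFn_compLp Complex.reCLM (𝓕⁻ a),
    h0] with x h1 h2 h3
  rw [h1, fourInv_apply, h2]
  exact Complex.conj_eq_iff_re.1 h3.symm

theorem four_fourInv {a : L2C} (ha : Herm a) : four (fourInv a) = a := by
  rw [four, toC_fourInv ha, FourierTransform.fourier_fourierInv_eq]

theorem norm_fourInv_le (a : L2C) : ‖fourInv a‖ ≤ ‖a‖ := by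
  rw [fourInv_apply]
  have h1 : ‖(𝓕⁻ a : L2C)‖ = ‖a‖ := (Lp.fourierTransformₗᵢ Plane ℂ).symm.norm_map a
  rw [← h1]
  refine Lp.norm_le_norm_of_ae_le ?_
  filter_upwards [ContinuousLinearMap.coeFn_compLp Complex.reCLM (𝓕⁻ a)] with x hx
  rw [hx]
  exact Complex.abs_re_le_norm _

/-- The product of two functions with integrable Fourier transforms. -/
theorem fourierInv_conv {a b c : L2C} (ha : Integrable a) (hb : Integrable b)
    (hc : c =ᵐ[volume] conv a b) :
    (𝓕⁻ c : L2C) =ᵐ[volume] fun x => (𝓕⁻ a : L2C) x * (𝓕⁻ b : L2C) x := by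
  have hconv : conv a b = convolution (a : Plane → ℂ) b (ContinuousLinearMap.mul ℂ ℂ) volume := rfl
  have hi : Integrable (conv a b) := by
    rw [hconv]
    exact ha.integrable_convolution _ hb
  have hci : Integrable c := hi.congr hc.symm
  filter_upwards [coeFn_fourierInv_of_integrable hci, coeFn_fourierInv_of_integrable ha,
    coeFn_fourierInv_of_integrable hb] with x h1 h2 h3
  rw [h1, h2, h3, Real.fourierInv_eq_fourier_neg, Real.fourierInv_eq_fourier_neg,
    Real.fourierInv_eq_fourier_neg, ← Real.fourier_mul_convolution_eq ha hb, ← hconv,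
    Real.fourier_eq, Real.fourier_eq]
  refine integral_congr_ae ?_
  filter_upwards [hc] with v hv
  rw [hv]

end KPI
-- Frequency truncation of the equation
namespace KPI

/-- A measurable and bounded multiplier. -/
def BddMul (m : Plane → ℂ) : Prop := Measurable m ∧ ∃ C : ℝ, ∀ ζ, ‖m ζ‖ ≤ C

theorem BddMul.memLp {m : Plane → ℂ} (hm : BddMul m) (f : L2C) :
    MemLp (fun ζ => m ζ * f ζ) 2 volume := by
  obtain ⟨hm, C, hC⟩ := hm
  exact (Lp.memLp f).of_le_mul (c := C) (hm.aestronglyMeasurable.mul (Lp.aestronglyMeasurable f))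
    (Filter.Eventually.of_forall fun ζ => by
      rw [norm_mul]
      exact mul_le_mul_of_nonneg_right (hC ζ) (norm_nonneg _))

open Classical in
/-- Multiplication by a bounded function, as an operator on `L²` (zero for other functions). -/
noncomputable def mulOp (m : Plane → ℂ) : L2C →L[ℂ] L2C :=
  if hm : BddMul m then
    LinearMap.mkContinuous
      { toFun := fun f => (hm.memLp f).toLp _
        map_add' := fun f g => by
          apply Lp.ext
          filter_upwards [(hm.memLp (f + g)).coeFn_toLp, (hm.memLp f).coeFn_toLp,
            (hm.memLp g).coeFn_toLp, Lp.coeFn_add f g,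
            Lp.coeFn_add ((hm.memLp f).toLp _) ((hm.memLp g).toLp _)] with ζ h1 h2 h3 h4 h5
          rw [h1, h5, Pi.add_apply, h2, h3, h4, Pi.add_apply, mul_add]
        map_smul' := fun c f => by
          apply Lp.ext
          filter_upwards [(hm.memLp (c • f)).coeFn_toLp, (hm.memLp f).coeFn_toLp,
            Lp.coeFn_smul c f, Lp.coeFn_smul c ((hm.memLp f).toLp _)] with ζ h1 h2 h3 h4
          rw [h1, RingHom.id_apply, h4, Pi.smul_apply, h2, h3, Pi.smul_apply, smul_eq_mul,
            smul_eq_mul]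
          ring }
      hm.2.choose
      (fun f => by
        refine Lp.norm_le_mul_norm_of_ae_le_mul ?_
        filter_upwards [(hm.memLp f).coeFn_toLp] with ζ h1
        change ‖(hm.memLp f).toLp _ ζ‖ ≤ _
        rw [h1, norm_mul]
        exact mul_le_mul_of_nonneg_right (hm.2.choose_spec ζ) (norm_nonneg _))
  else 0

theorem coeFn_mulOp {m : Plane → ℂ} (hm : BddMul m) (f : L2C) :
    mulOp m f =ᵐ[volume] fun ζ => m ζ * f ζ := by
  unfold mulOp
  rw [dif_pos hm]
  exact (hm.memLp f).coeFn_toLp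

/-- The symbol of the linear part `∂ₓ³ + ∂ₓ - ∂ₓ⁻¹∂_y²`. -/
noncomputable def disp (ζ : Plane) : ℂ := derivSym 3 0 ζ + derivSym 1 0 ζ - invSym 0 0 ζ

/-- The symbol of `½ ∂ₓ`. -/
noncomputable def nlSym (ζ : Plane) : ℂ := Real.pi * Complex.I * (ζ 0 : ℂ)

/-- The linear symbol is purely imaginary, which removes it from every weighted `L²` identity. On `ξ
= 0` the formula holds as well, since both quotients by zero are zero. -/
theorem disp_eq (ζ : Plane) : disp ζ =
    ((-(2 * Real.pi * ζ 0) ^ 3 + 2 * Real.pi * ζ 0 - 2 * Real.pi * (ζ 1 ^ 2 / ζ 0) : ℝ) : ℂ)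
      * Complex.I := by
  have hI : Complex.I ^ 2 = -1 := Complex.I_sq
  have hpi : (Real.pi : ℂ) ≠ 0 := Complex.ofReal_ne_zero.2 Real.pi_ne_zero
  have hI0 : Complex.I ≠ 0 := Complex.I_ne_zero
  unfold disp invSym derivSym
  push_cast
  rcases eq_or_ne (ζ 0) 0 with h | h
  · simp [h]
  · have h' : (ζ 0 : ℂ) ≠ 0 := Complex.ofReal_ne_zero.2 h
    have e3 : (2 * Real.pi * Complex.I * (ζ 1 : ℂ)) ^ (0 + 2) / (2 * Real.pi * Complex.I * (ζ 0 : ℂ))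
        = 2 * Real.pi * ((ζ 1 : ℂ) ^ 2 / ζ 0) * Complex.I := by
      field_simp
      ring
    rw [pow_zero, pow_zero, mul_one, mul_one, one_mul, pow_one, e3]
    have e1 : (2 * Real.pi * Complex.I * (ζ 0 : ℂ)) ^ 3
        = -(2 * Real.pi * (ζ 0 : ℂ)) ^ 3 * Complex.I := by
      linear_combination (2 * Real.pi * (ζ 0 : ℂ)) ^ 3 * Complex.I * hI
    rw [e1]
    ring

theorem disp_re (ζ : Plane) : (disp ζ).re = 0 := by
  rw [disp_eq, Complex.re_ofReal_mul, Complex.I_re, mul_zero]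

theorem measurable_disp : Measurable disp := by
  have : disp = fun ζ => ((-(2 * Real.pi * ζ 0) ^ 3 + 2 * Real.pi * ζ 0
      - 2 * Real.pi * (ζ 1 ^ 2 / ζ 0) : ℝ) : ℂ) * Complex.I := funext disp_eq
  rw [this]
  fun_prop

theorem measurable_nlSym : Measurable nlSym := by
  unfold nlSym
  fun_prop

theorem disp_neg (ζ : Plane) : disp (-ζ) = (starRingEnd ℂ) (disp ζ) := by
  rw [disp_eq, disp_eq, map_mul, Complex.conj_ofReal, Complex.conj_I]
  simp only [PiLp.neg_apply]
  push_cast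
  ring

theorem nlSym_neg (ζ : Plane) : nlSym (-ζ) = (starRingEnd ℂ) (nlSym ζ) := by
  unfold nlSym
  rw [map_mul, map_mul, Complex.conj_ofReal, Complex.conj_ofReal, Complex.conj_I]
  simp only [PiLp.neg_apply]
  push_cast
  ring

theorem norm_nlSym (ζ : Plane) : ‖nlSym ζ‖ = Real.pi * |ζ 0| := by
  unfold nlSym
  rw [norm_mul, norm_mul, Complex.norm_I, Complex.norm_real, Complex.norm_real,
    Real.norm_of_nonneg Real.pi_pos.le, Real.norm_eq_abs, mul_one]

theorem norm_disp (ζ : Plane) : ‖disp ζ‖ =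
    |-(2 * Real.pi * ζ 0) ^ 3 + 2 * Real.pi * ζ 0 - 2 * Real.pi * (ζ 1 ^ 2 / ζ 0)| := by
  rw [disp_eq, norm_mul, Complex.norm_I, mul_one, Complex.norm_real, Real.norm_eq_abs]

/-- The frequencies kept by the truncated equation. -/
def band (n : ℕ) : Set Plane :=
  {ζ | ((n : ℝ) + 1)⁻¹ ≤ |ζ 0| ∧ |ζ 0| ≤ n + 1 ∧ |ζ 1| ≤ n + 1}

theorem measurableSet_band (n : ℕ) : MeasurableSet (band n) := by
  unfold band
  refine (measurableSet_le (f := fun _ => ((n : ℝ) + 1)⁻¹) (g := fun ζ : Plane => |ζ 0|)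
    (by fun_prop) (by fun_prop)).inter ((measurableSet_le (f := fun ζ : Plane => |ζ 0|)
    (g := fun _ => (n : ℝ) + 1) (by fun_prop) (by fun_prop)).inter (measurableSet_le
    (f := fun ζ : Plane => |ζ 1|) (g := fun _ => (n : ℝ) + 1) (by fun_prop) (by fun_prop)))

theorem neg_mem_band {n : ℕ} {ζ : Plane} : -ζ ∈ band n ↔ ζ ∈ band n := by
  simp [band]

theorem band_mono {m n : ℕ} (h : m ≤ n) : band m ⊆ band n := by
  intro ζ ⟨h1, h2, h3⟩
  have h' : (m : ℝ) + 1 ≤ n + 1 := by exact_mod_cast Nat.add_le_add_right h 1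
  have h0 : (0 : ℝ) < m + 1 := by positivity
  exact ⟨(inv_anti₀ h0 h').trans h1, h2.trans h', h3.trans h'⟩

theorem volume_band_lt_top (n : ℕ) : volume (band n) < ∞ := by
  refine (measure_mono (t := Metric.closedBall 0 (2 * (n + 1))) ?_).trans_lt
    measure_closedBall_lt_top
  intro ζ ⟨_, h2, h3⟩
  rw [mem_closedBall_zero_iff, EuclideanSpace.norm_eq]
  apply Real.sqrt_le_iff.2
  refine ⟨by positivity, ?_⟩
  simp only [Fin.sum_univ_two, Real.norm_eq_abs]
  nlinarith [abs_nonneg (ζ 0), abs_nonneg (ζ 1)]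

theorem ae_eventually_mem_band : ∀ᵐ ζ : Plane, ∀ᶠ n in Filter.atTop, ζ ∈ band n := by
  filter_upwards [ae_coord_ne_zero] with ζ h
  obtain ⟨k, hk⟩ := exists_nat_gt (max (|ζ 0|⁻¹) (max |ζ 0| |ζ 1|))
  rw [max_lt_iff, max_lt_iff] at hk
  filter_upwards [Filter.eventually_ge_atTop k] with n hn
  refine band_mono hn ⟨?_, by linarith [hk.2.1], by linarith [hk.2.2]⟩
  exact (inv_le_comm₀ (by positivity) (abs_pos.2 h)).2 (by linarith [hk.1])

/-- The indicator function of `band n`. -/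
noncomputable def bandFn (n : ℕ) : Plane → ℂ := (band n).indicator 1

theorem measurable_bandFn (n : ℕ) : Measurable (bandFn n) :=
  measurable_const.indicator (measurableSet_band n)

theorem bandFn_mem {n : ℕ} {ζ : Plane} (h : ζ ∈ band n) : bandFn n ζ = 1 := by
  simp [bandFn, h]

theorem bandFn_notMem {n : ℕ} {ζ : Plane} (h : ζ ∉ band n) : bandFn n ζ = 0 := by
  simp [bandFn, h]

theorem norm_bandFn_le (n : ℕ) (ζ : Plane) : ‖bandFn n ζ‖ ≤ 1 := by
  by_cases h : ζ ∈ band n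
  · simp [bandFn_mem h]
  · simp [bandFn_notMem h]

theorem bddMul_bandFn (n : ℕ) : BddMul (bandFn n) :=
  ⟨measurable_bandFn n, 1, norm_bandFn_le n⟩

theorem bddMul_band_mul {n : ℕ} {m : Plane → ℂ} (hm : Measurable m) {C : ℝ}
    (hC : ∀ ζ ∈ band n, ‖m ζ‖ ≤ C) : BddMul (fun ζ => bandFn n ζ * m ζ) := by
  refine ⟨(measurable_bandFn n).mul hm, max C 0, fun ζ => ?_⟩
  by_cases h : ζ ∈ band n
  · simp only [bandFn_mem h, one_mul]; exact (hC ζ h).trans (le_max_left _ _)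
  · simp only [bandFn_notMem h, zero_mul, norm_zero]; exact le_max_right _ _

theorem sq_div_le_of_mem_band {n : ℕ} {ζ : Plane} (h : ζ ∈ band n) :
    |ζ 1| ^ 2 / |ζ 0| ≤ (n + 1 : ℝ) ^ 3 := by
  obtain ⟨h1, h2, h3⟩ := h
  have h0 : (0 : ℝ) < ((n : ℝ) + 1)⁻¹ := by positivity
  rw [div_eq_mul_inv, pow_succ ((n : ℝ) + 1) 2]
  have h4 : |ζ 0|⁻¹ ≤ n + 1 := by
    rw [← inv_inv ((n : ℝ) + 1)]
    exact inv_anti₀ h0 h1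
  have h5 : 0 ≤ |ζ 0|⁻¹ := by positivity
  gcongr

theorem bddMul_disp (n : ℕ) : BddMul (fun ζ => bandFn n ζ * disp ζ) := by
  refine bddMul_band_mul measurable_disp (C := (2 * Real.pi * (n + 1)) ^ 3 + 2 * Real.pi * (n + 1)
    + 2 * Real.pi * (n + 1) ^ 3) fun ζ h => ?_
  rw [norm_disp]
  have h1 := sq_div_le_of_mem_band h
  have h2 := h.2.1
  have hp := Real.pi_pos
  refine (abs_sub _ _).trans (add_le_add ((abs_add_le _ _).trans (add_le_add ?_ ?_)) ?_)
  · rw [abs_neg, abs_pow, abs_mul, abs_of_pos (by positivity : 0 < 2 * Real.pi)]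
    gcongr
  · rw [abs_mul, abs_of_pos (by positivity : 0 < 2 * Real.pi)]
    gcongr
  · rw [abs_mul, abs_of_pos (by positivity : 0 < 2 * Real.pi), abs_div, abs_pow]
    gcongr

/-- The restriction to `band n`. -/
noncomputable def cut (n : ℕ) : L2C →L[ℂ] L2C := mulOp (bandFn n)

theorem coeFn_cut (n : ℕ) (f : L2C) : cut n f =ᵐ[volume] fun ζ => bandFn n ζ * f ζ :=
  coeFn_mulOp (bddMul_bandFn n) f

theorem norm_cut_le (n : ℕ) (f : L2C) : ‖cut n f‖ ≤ ‖f‖ := by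
  refine Lp.norm_le_norm_of_ae_le ?_
  filter_upwards [coeFn_cut n f] with ζ h
  rw [h, norm_mul]
  exact mul_le_of_le_one_left (norm_nonneg _) (norm_bandFn_le n ζ)

theorem enorm_sq_eq (f : L2C) : ‖f‖ₑ ^ 2 = ∫⁻ ζ, ‖f ζ‖ₑ ^ 2 := by
  have h := eLpNorm_nnreal_pow_eq_lintegral (μ := (volume : Measure Plane)) (f := (f : Plane → ℂ))
    (p := 2) two_ne_zero
  rw [Lp.enorm_def, ← ENNReal.rpow_natCast]
  exact h.trans (lintegral_congr fun ζ => ENNReal.rpow_natCast _ 2)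

theorem norm_sq_eq (f : L2C) : ‖f‖ ^ 2 = (∫⁻ ζ, ‖f ζ‖ₑ ^ 2).toReal := by
  rw [← enorm_sq_eq, ENNReal.toReal_pow, toReal_enorm]

theorem lintegral_sq_lt_top (f : L2C) : ∫⁻ ζ, ‖f ζ‖ₑ ^ 2 < ∞ := by
  rw [← enorm_sq_eq]
  exact ENNReal.pow_lt_top enorm_lt_top

theorem tendsto_cut (f : L2C) : Filter.Tendsto (fun n => cut n f) Filter.atTop (nhds f) := by
  rw [tendsto_iff_norm_sub_tendsto_zero]
  have h1 : Filter.Tendsto (fun n => ∫⁻ ζ, ‖bandFn n ζ * f ζ - f ζ‖ₑ ^ 2) Filter.atTop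
      (nhds (∫⁻ _ : Plane, 0)) := by
    refine tendsto_lintegral_of_dominated_convergence' (fun ζ => ‖f ζ‖ₑ ^ 2) ?_ ?_
      (lintegral_sq_lt_top f).ne ?_
    · intro n
      have := (Lp.stronglyMeasurable f).measurable
      have := measurable_bandFn n
      fun_prop
    · refine fun n => Filter.Eventually.of_forall fun ζ => ?_
      by_cases h : ζ ∈ band n
      · simp [bandFn_mem h]
      · simp [bandFn_notMem h]
    · filter_upwards [ae_eventually_mem_band] with ζ h
      refine tendsto_const_nhds.congr' ?_
      filter_upwards [h] with n hn
      simp [bandFn_mem hn]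
  rw [lintegral_zero] at h1
  have h2 : ∀ n, ‖cut n f - f‖ ^ 2 = (∫⁻ ζ, ‖bandFn n ζ * f ζ - f ζ‖ₑ ^ 2).toReal := by
    intro n
    rw [norm_sq_eq]
    congr 1
    refine lintegral_congr_ae ?_
    filter_upwards [Lp.coeFn_sub (cut n f) f, coeFn_cut n f] with ζ h3 h4
    rw [h3, Pi.sub_apply, h4]
  have h3 := (ENNReal.tendsto_toReal ENNReal.zero_ne_top).comp h1
  have h4 : Filter.Tendsto (fun n => √(‖cut n f - f‖ ^ 2)) Filter.atTop (nhds (√0)) := by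
    refine (Real.continuous_sqrt.tendsto 0).comp ?_
    simpa only [h2, Function.comp_def, ENNReal.toReal_zero] using h3
  simpa only [Real.sqrt_sq (norm_nonneg _), Real.sqrt_zero] using h4

theorem integrable_mul_sub (a b : L2C) (ζ : Plane) : Integrable (fun w => a w * b (ζ - w)) := by
  have h : MemLp (fun w => b (ζ - w)) 2 volume :=
    (Lp.memLp b).comp_measurePreserving (Measure.measurePreserving_sub_left volume ζ)
  exact (Lp.memLp a).integrable_mul h

theorem conv_congr {a a' b b' : Plane → ℂ} (h : a =ᵐ[volume] a') (h' : b =ᵐ[volume] b')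
    (ζ : Plane) : conv a b ζ = conv a' b' ζ := by
  refine integral_congr_ae ?_
  filter_upwards [h, (Measure.measurePreserving_sub_left volume ζ).quasiMeasurePreserving.ae_eq_comp h']
    with w h1 h2
  simp only [Function.comp_apply] at h2
  simp only [h1, h2]

theorem conv_add_left (a a' b : L2C) (ζ : Plane) :
    conv (a + a' : L2C) b ζ = conv a b ζ + conv a' b ζ := by
  rw [conv_congr (Lp.coeFn_add a a') (Filter.EventuallyEq.refl _ _)]
  unfold conv
  rw [← integral_add (integrable_mul_sub a b ζ) (integrable_mul_sub a' b ζ)]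
  simp only [Pi.add_apply, add_mul]

theorem conv_smul_left (c : ℂ) (a b : L2C) (ζ : Plane) :
    conv (c • a : L2C) b ζ = c * conv a b ζ := by
  rw [conv_congr (Lp.coeFn_smul c a) (Filter.EventuallyEq.refl _ _)]
  unfold conv
  rw [← integral_const_mul]
  simp only [Pi.smul_apply, smul_eq_mul, mul_assoc]

theorem enorm_conv_le_mul (a b : L2C) (ζ : Plane) : ‖conv a b ζ‖ₑ ≤ ‖a‖ₑ * ‖b‖ₑ := by
  refine (enorm_conv_le a b ζ).trans ?_
  have h := convAbs_sq_le (Lp.stronglyMeasurable a).measurable (Lp.stronglyMeasurable b).measurable ζ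
  rw [← enorm_sq_eq, ← enorm_sq_eq, ← mul_pow] at h
  exact (ENNReal.pow_le_pow_left_iff two_ne_zero).1 h

theorem norm_conv_le (a b : L2C) (ζ : Plane) : ‖conv a b ζ‖ ≤ ‖a‖ * ‖b‖ := by
  have h := enorm_conv_le_mul a b ζ
  rw [← ofReal_norm, ← ofReal_norm, ← ofReal_norm, ← ENNReal.ofReal_mul (norm_nonneg _),
    ENNReal.ofReal_le_ofReal_iff (by positivity)] at h
  exact h

theorem memLp_band_mul {n : ℕ} {m : Plane → ℂ} (hm : Measurable m) {C : ℝ}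
    (hC : ∀ ζ ∈ band n, ‖m ζ‖ ≤ C) : MemLp (fun ζ => bandFn n ζ * m ζ) 2 volume := by
  have h : MemLp ((band n).indicator fun _ => C) 2 volume :=
    memLp_indicator_const 2 (measurableSet_band n) _ (Or.inr (volume_band_lt_top n).ne)
  refine h.of_le ((measurable_bandFn n).mul hm).aestronglyMeasurable
    (Filter.Eventually.of_forall fun ζ => ?_)
  by_cases hζ : ζ ∈ band n
  · rw [bandFn_mem hζ, one_mul, Set.indicator_of_mem hζ]
    exact (hC ζ hζ).trans (le_abs_self C)
  · simp [bandFn_notMem hζ, hζ]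

theorem memLp_band_nlSym (n : ℕ) : MemLp (fun ζ => bandFn n ζ * nlSym ζ) 2 volume := by
  refine memLp_band_mul measurable_nlSym (C := Real.pi * (n + 1)) fun ζ hζ => ?_
  rw [norm_nlSym]
  have := hζ.2.1
  have := Real.pi_pos
  gcongr

theorem measurable_coeFn (a : L2C) : Measurable a := (Lp.stronglyMeasurable a).measurable

/-- The convolution of two `L²` functions is merely bounded; the finite measure of `band n` and the
boundedness of `nlSym` there restore square integrability. -/
theorem memLp_band_conv (n : ℕ) (a b : L2C) :
    MemLp (fun ζ => bandFn n ζ * nlSym ζ * conv a b ζ) 2 volume := by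
  refine (memLp_band_nlSym n).of_le_mul (c := ‖a‖ * ‖b‖) (((measurable_bandFn n).mul
    measurable_nlSym).mul (measurable_conv (measurable_coeFn a)
    (measurable_coeFn b))).aestronglyMeasurable (Filter.Eventually.of_forall fun ζ => ?_)
  rw [norm_mul, mul_comm]
  exact mul_le_mul_of_nonneg_right (norm_conv_le a b ζ) (norm_nonneg _)

/-- The truncated nonlinearity. -/
noncomputable def nlFun (n : ℕ) (a b : L2C) : L2C := (memLp_band_conv n a b).toLp _

theorem coeFn_nlFun (n : ℕ) (a b : L2C) :
    nlFun n a b =ᵐ[volume] fun ζ => bandFn n ζ * nlSym ζ * conv a b ζ :=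
  (memLp_band_conv n a b).coeFn_toLp

theorem nlFun_comm (n : ℕ) (a b : L2C) : nlFun n a b = nlFun n b a := by
  apply Lp.ext
  filter_upwards [coeFn_nlFun n a b, coeFn_nlFun n b a] with ζ h1 h2
  rw [h1, h2, conv_comm]

theorem nlFun_add_left (n : ℕ) (a a' b : L2C) :
    nlFun n (a + a') b = nlFun n a b + nlFun n a' b := by
  apply Lp.ext
  filter_upwards [coeFn_nlFun n (a + a') b, coeFn_nlFun n a b, coeFn_nlFun n a' b,
    Lp.coeFn_add (nlFun n a b) (nlFun n a' b)] with ζ h1 h2 h3 h4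
  rw [h1, h4, Pi.add_apply, h2, h3, conv_add_left]
  ring

theorem nlFun_smul_left (n : ℕ) (c : ℂ) (a b : L2C) :
    nlFun n (c • a) b = c • nlFun n a b := by
  apply Lp.ext
  filter_upwards [coeFn_nlFun n (c • a) b, coeFn_nlFun n a b,
    Lp.coeFn_smul c (nlFun n a b)] with ζ h1 h2 h3
  rw [h1, h3, Pi.smul_apply, h2, conv_smul_left, smul_eq_mul]
  ring

theorem norm_nlFun_le (n : ℕ) (a b : L2C) :
    ‖nlFun n a b‖ ≤ ‖(memLp_band_nlSym n).toLp _‖ * ‖a‖ * ‖b‖ := by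
  rw [mul_assoc, mul_comm]
  refine Lp.norm_le_mul_norm_of_ae_le_mul ?_
  filter_upwards [coeFn_nlFun n a b, (memLp_band_nlSym n).coeFn_toLp] with ζ h1 h2
  rw [h1, h2, norm_mul, mul_comm]
  exact mul_le_mul_of_nonneg_right (norm_conv_le a b ζ) (norm_nonneg _)

/-- The truncated nonlinearity, as a bounded bilinear operator. -/
noncomputable def nlTrunc (n : ℕ) : L2C →L[ℂ] L2C →L[ℂ] L2C :=
  LinearMap.mkContinuous₂
    (LinearMap.mk₂ ℂ (nlFun n) (nlFun_add_left n) (nlFun_smul_left n)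
      (fun b a a' => by
        rw [nlFun_comm, nlFun_add_left, nlFun_comm n a, nlFun_comm n a'])
      (fun c b a => by
        rw [nlFun_comm, nlFun_smul_left, nlFun_comm n a]))
    ‖(memLp_band_nlSym n).toLp _‖ (norm_nlFun_le n)

theorem coeFn_nlTrunc (n : ℕ) (a b : L2C) :
    nlTrunc n a b =ᵐ[volume] fun ζ => bandFn n ζ * nlSym ζ * conv a b ζ :=
  coeFn_nlFun n a b

/-- The right hand side of the equation on the Fourier side. -/
noncomputable def rhs (a : Plane → ℂ) (ζ : Plane) : ℂ := -(disp ζ * a ζ) - nlSym ζ * conv a a ζ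

/-- The truncated right hand side. -/
noncomputable def field (n : ℕ) (a : L2C) : L2C :=
  -mulOp (fun ζ => bandFn n ζ * disp ζ) a - nlTrunc n a a

theorem coeFn_field (n : ℕ) (a : L2C) : field n a =ᵐ[volume] fun ζ => bandFn n ζ * rhs a ζ := by
  unfold field
  filter_upwards [Lp.coeFn_sub (-mulOp (fun ζ => bandFn n ζ * disp ζ) a) (nlTrunc n a a),
    Lp.coeFn_neg (mulOp (fun ζ => bandFn n ζ * disp ζ) a), coeFn_mulOp (bddMul_disp n) a,
    coeFn_nlTrunc n a a] with ζ h1 h2 h3 h4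
  rw [h1, Pi.sub_apply, h2, Pi.neg_apply, h3, h4, rhs]
  ring

theorem continuous_field (n : ℕ) : Continuous (field n) := by
  unfold field
  fun_prop

/-- Apart from the final truncation the field does not depend on `n`, so cutting to a smaller band
forgets `n` altogether. This allows `n → ∞` with the outer cut held fixed. -/
theorem cut_field {m n : ℕ} (h : m ≤ n) (a : L2C) : cut m (field n a) = field m a := by
  apply Lp.ext
  filter_upwards [coeFn_cut m (field n a), coeFn_field n a, coeFn_field m a] with ζ h1 h2 h3
  rw [h1, h2, h3]
  by_cases hζ : ζ ∈ band m
  · rw [bandFn_mem hζ, bandFn_mem (band_mono h hζ), one_mul]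
  · rw [bandFn_notMem hζ, zero_mul, zero_mul]

theorem lipschitzOnWith_quadratic {E : Type*} [NormedAddCommGroup E] [NormedSpace ℂ E]
    (A : E →L[ℂ] E) (B : E →L[ℂ] E →L[ℂ] E) (R : ℝ≥0) :
    LipschitzOnWith (‖A‖₊ + 2 * ‖B‖₊ * R) (fun x => -A x - B x x) (Metric.closedBall 0 R) := by
  refine LipschitzOnWith.of_dist_le_mul fun x hx y hy => ?_
  rw [mem_closedBall_zero_iff] at hx hy
  rw [dist_eq_norm, dist_eq_norm]
  have e : -A x - B x x - (-A y - B y y) = -A (x - y) - B (x - y) x - B y (x - y) := by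
    simp only [map_sub, sub_apply]
    abel
  have h1 := A.le_opNorm (x - y)
  have h2 := B.le_opNorm₂ (x - y) x
  have h3 := B.le_opNorm₂ y (x - y)
  have hB := norm_nonneg B
  have hd := norm_nonneg (x - y)
  have h4 : ‖B‖ * ‖x - y‖ * ‖x‖ ≤ ‖B‖ * ‖x - y‖ * R := by gcongr
  have h5 : ‖B‖ * ‖y‖ * ‖x - y‖ ≤ ‖B‖ * R * ‖x - y‖ := by gcongr
  rw [e]
  refine (norm_sub_le _ _).trans ?_
  have h6 := norm_sub_le (-A (x - y)) (B (x - y) x)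
  rw [norm_neg] at h6
  push_cast
  linarith

theorem exists_lipschitzOnWith_field (n : ℕ) (R : ℝ≥0) :
    ∃ K : ℝ≥0, LipschitzOnWith K (field n) (Metric.closedBall 0 R) :=
  ⟨_, lipschitzOnWith_quadratic (mulOp fun ζ => bandFn n ζ * disp ζ) (nlTrunc n) R⟩

end KPI
-- Ordinary differential equations and differential inequalities
namespace KPI

/-- A locally Lipschitz field tangent to the spheres of a Hilbert space has global flows. -/
theorem exists_global_solution {E : Type*} [NormedAddCommGroup E] [InnerProductSpace ℝ E]
    [CompleteSpace E] {G : E → E}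
    (hL : ∀ R : ℝ≥0, ∃ K : ℝ≥0, LipschitzOnWith K G (Metric.closedBall 0 R))
    (hG : ∀ x, inner ℝ x (G x) = 0) (x₀ : E) {T : ℝ} (hT : 0 < T) :
    ∃ u : ℝ → E, u 0 = x₀ ∧ ∀ t ∈ Set.Icc 0 T, HasDerivWithinAt u (G (u t)) (Set.Icc 0 T) t := by
  set R : ℝ≥0 := ‖x₀‖₊ + 1 with hR
  obtain ⟨K, hK⟩ := hL (2 * R)
  -- a cutoff of the field
  set χ : E → ℝ := fun x => max 0 (min 1 (2 * R - ‖x‖)) with hχ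
  have hχ0 : ∀ x, 0 ≤ χ x := fun x => le_max_left _ _
  have hχ1 : ∀ x, χ x ≤ 1 := fun x => max_le zero_le_one (min_le_left _ _)
  have hχL : ∀ x y, |χ x - χ y| ≤ ‖x - y‖ := by
    intro x y
    have h1 := abs_max_sub_max_le_max 0 (min 1 (2 * (R : ℝ) - ‖x‖)) 0 (min 1 (2 * R - ‖y‖))
    have h2 := abs_min_sub_min_le_max 1 (2 * (R : ℝ) - ‖x‖) 1 (2 * R - ‖y‖)
    have h3 := abs_norm_sub_norm_le y x
    rw [norm_sub_rev] at h3
    refine (h1.trans (max_le (by simp) le_rfl)).trans ((h2.trans (max_le (by simp) le_rfl)).trans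
      (le_trans (le_of_eq ?_) h3))
    congr 1
    ring
  have hχz : ∀ x, 2 * (R : ℝ) ≤ ‖x‖ → χ x = 0 := by
    intro x hx
    exact max_eq_left ((min_le_right _ _).trans (by linarith))
  set F : E → E := fun x => χ x • G x with hF
  set B : ℝ≥0 := ‖G 0‖₊ + K * (2 * R) with hB
  have hGB : ∀ x, ‖x‖ ≤ 2 * R → ‖G x‖ ≤ B := by
    intro x hx
    have h := hK.dist_le_mul x (by simpa using hx) 0 (by simp)
    rw [dist_eq_norm, dist_zero_right] at h
    have h2 : ‖G x‖ ≤ ‖G 0‖ + ‖G x - G 0‖ := by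
      have := norm_add_le (G 0) (G x - G 0)
      simpa using this
    have h3 : (K : ℝ) * ‖x‖ ≤ K * (2 * R) := by gcongr
    rw [hB]; push_cast; linarith
  have hFB : ∀ x, ‖F x‖ ≤ B := by
    intro x
    rcases le_total ‖x‖ (2 * R) with h | h
    · rw [hF]; simp only
      rw [norm_smul, Real.norm_of_nonneg (hχ0 x)]
      exact (mul_le_of_le_one_left (norm_nonneg _) (hχ1 x)).trans (hGB x h)
    · rw [hF]; simp only
      rw [hχz x h, zero_smul, norm_zero]; exact B.2
  have hin : ∀ x y, ‖x‖ ≤ 2 * R → ‖F x - F y‖ ≤ (B + K) * ‖x - y‖ := by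
    intro x y hx
    rcases le_total ‖y‖ (2 * R) with h | h
    · have e : F x - F y = χ y • (G x - G y) + (χ x - χ y) • G x := by
        simp only [hF, smul_sub, sub_smul]; abel
      rw [e]
      refine (norm_add_le _ _).trans ?_
      rw [norm_smul, norm_smul, Real.norm_eq_abs, Real.norm_eq_abs, abs_of_nonneg (hχ0 y)]
      have h1 := hK.dist_le_mul x (by simpa using hx) y (by simpa using h)
      rw [dist_eq_norm, dist_eq_norm] at h1
      have h2 : χ y * ‖G x - G y‖ ≤ ‖G x - G y‖ := mul_le_of_le_one_left (norm_nonneg _) (hχ1 y)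
      have h3 : |χ x - χ y| * ‖G x‖ ≤ ‖x - y‖ * B :=
        mul_le_mul (hχL x y) (hGB x hx) (norm_nonneg _) (norm_nonneg _)
      linarith
    · have e : F x - F y = (χ x - χ y) • G x := by
        simp only [hF, hχz y h, zero_smul, sub_zero]
      rw [e, norm_smul, Real.norm_eq_abs]
      have h3 : |χ x - χ y| * ‖G x‖ ≤ ‖x - y‖ * B :=
        mul_le_mul (hχL x y) (hGB x hx) (norm_nonneg _) (norm_nonneg _)
      have : 0 ≤ (K : ℝ) * ‖x - y‖ := by positivity
      linarith
  have hFL : ∀ x y, ‖F x - F y‖ ≤ (B + K : ℝ≥0) * ‖x - y‖ := by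
    intro x y
    push_cast
    rcases le_total ‖x‖ (2 * R) with h | h
    · exact hin x y h
    · rcases le_total ‖y‖ (2 * R) with h' | h'
      · rw [norm_sub_rev, norm_sub_rev x]; exact hin y x h'
      · simp only [hF, hχz x h, hχz y h', zero_smul, sub_self, norm_zero]
        positivity
  -- The cut-off field is globally bounded by `B` and globally Lipschitz, so a ball of radius `B T`
  -- confines the solution and Picard–Lindelöf covers all of `[0, T]` at once.
  have hPL : IsPicardLindelof (fun _ => F) (⟨0, Set.left_mem_Icc.2 hT.le⟩ : Set.Icc 0 T) x₀
      (B * ⟨T, hT.le⟩) 0 B (B + K) := by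
    refine IsPicardLindelof.of_time_independent (fun x _ => hFB x)
      (LipschitzOnWith.of_dist_le_mul fun x _ y _ => ?_) ?_
    · rw [dist_eq_norm, dist_eq_norm]; exact hFL x y
    · simp only [sub_zero, NNReal.coe_zero]
      rw [max_eq_left (by linarith)]
      exact le_rfl
  obtain ⟨u, hu0, hu⟩ := hPL.exists_eq_forall_mem_Icc_hasDerivWithinAt₀
  refine ⟨u, hu0, fun t ht => ?_⟩
  -- A scalar multiple of a tangent field is still tangent, so the norm is conserved. The curve
  -- therefore stays where the cutoff equals 1 and solves the original equation.
  have hcons : ∀ t ∈ Set.Icc 0 T, ‖u t‖ ^ 2 = ‖u 0‖ ^ 2 := by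
    refine constant_of_derivWithin_zero ?_ ?_
    · intro s hs
      exact ((hu s hs).norm_sq).differentiableWithinAt
    · intro s hs
      have hs' := Set.Ico_subset_Icc_self hs
      have := ((hu s hs').norm_sq).derivWithin (uniqueDiffOn_Icc hT s hs')
      rw [this, hF]
      simp only
      rw [inner_smul_right, hG, mul_zero, mul_zero]
  have hn : ‖u t‖ = ‖x₀‖ := by
    have := hcons t ht
    rw [hu0] at this
    exact (pow_left_inj₀ (norm_nonneg _) (norm_nonneg _) two_ne_zero).1 this
  have hc : χ (u t) = 1 := by
    simp only [hχ]
    rw [hn, hR]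
    push_cast
    rw [min_eq_left (by linarith [norm_nonneg x₀]), max_eq_right zero_le_one]
  have := hu t ht
  rw [hF] at this
  simp only [hc, one_smul] at this
  exact this

/-- The Riccati inequality says that `-(1 + y)⁻¹ - A t` is nonincreasing. The smallness of `T` keeps
`(1 + y)⁻¹` above half its initial value. -/
theorem one_add_le_of_deriv_le {y y' : ℝ → ℝ} {T A : ℝ} (hA : 0 ≤ A)
    (hy0 : ∀ t ∈ Set.Icc 0 T, 0 ≤ y t)
    (hy : ∀ t ∈ Set.Icc 0 T, HasDerivWithinAt y (y' t) (Set.Icc 0 T) t)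
    (hle : ∀ t ∈ Set.Icc 0 T, y' t ≤ A * (1 + y t) ^ 2) {t : ℝ} (ht : t ∈ Set.Icc 0 T)
    (hT : 2 * A * T * (1 + y 0) ≤ 1) : y t ≤ 2 * (1 + y 0) := by
  have hT0 : 0 ≤ T := ht.1.trans ht.2
  have h0 : (0 : ℝ) ∈ Set.Icc 0 T := ⟨le_rfl, hT0⟩
  have hd : ∀ s ∈ Set.Icc 0 T, HasDerivWithinAt (fun s => -(1 + y s)⁻¹ - A * s)
      (y' s / (1 + y s) ^ 2 - A) (Set.Icc 0 T) s := by
    intro s hs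
    have h1 : (1 + y s) ≠ 0 := by linarith [hy0 s hs]
    have := ((((hy s hs).const_add 1).inv h1).neg).sub ((hasDerivWithinAt_id s _).const_mul A)
    refine this.congr_deriv ?_
    ring
  have hanti : AntitoneOn (fun s => -(1 + y s)⁻¹ - A * s) (Set.Icc 0 T) := by
    refine antitoneOn_of_hasDerivWithinAt_nonpos (convex_Icc 0 T)
      (fun s hs => (hd s hs).continuousWithinAt)
      (fun s hs => (hd s (interior_subset hs)).mono interior_subset) fun s hs => ?_
    have h := hle s (interior_subset hs)
    have h1 : 0 < 1 + y s := by linarith [hy0 s (interior_subset hs)]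
    rw [sub_nonpos, div_le_iff₀ (by positivity)]
    exact h
  have h := hanti h0 ht ht.1
  simp only [mul_zero, sub_zero] at h
  have p0 : 0 < 1 + y 0 := by linarith [hy0 0 h0]
  have pt : 0 < 1 + y t := by linarith [hy0 t ht]
  have h2 : A * t ≤ (1 + y 0)⁻¹ / 2 := by
    have h3 : A * t ≤ A * T := by gcongr; exact ht.2
    have h4 : A * T ≤ (1 + y 0)⁻¹ / 2 := by
      rw [inv_eq_one_div, div_div, le_div_iff₀ (by positivity)]
      linarith
    linarith
  have h5 : (1 + y 0)⁻¹ / 2 ≤ (1 + y t)⁻¹ := by linarith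
  have h6 : (2 * (1 + y 0))⁻¹ ≤ (1 + y t)⁻¹ := by
    rw [mul_inv]; linarith
  have h7 := (inv_le_inv₀ (by positivity) pt).1 h6
  linarith

theorem le_exp_of_deriv_le {y y' : ℝ → ℝ} {T B : ℝ}
    (hy : ∀ t ∈ Set.Icc 0 T, HasDerivWithinAt y (y' t) (Set.Icc 0 T) t)
    (hle : ∀ t ∈ Set.Icc 0 T, y' t ≤ B * y t) {t : ℝ} (ht : t ∈ Set.Icc 0 T) :
    y t ≤ y 0 * Real.exp (B * t) := by
  have h0 : (0 : ℝ) ∈ Set.Icc 0 T := ⟨le_rfl, ht.1.trans ht.2⟩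
  have hd : ∀ s ∈ Set.Icc 0 T, HasDerivWithinAt (fun s => y s * Real.exp (-(B * s)))
      ((y' s - B * y s) * Real.exp (-(B * s))) (Set.Icc 0 T) s := by
    intro s hs
    have h1 : HasDerivWithinAt (fun s : ℝ => Real.exp (-(B * s))) (Real.exp (-(B * s)) * -(B * 1))
        (Set.Icc 0 T) s := (((hasDerivWithinAt_id s _).const_mul B).neg).exp
    exact ((hy s hs).mul h1).congr_deriv (by ring)
  have hanti : AntitoneOn (fun s => y s * Real.exp (-(B * s))) (Set.Icc 0 T) := by
    refine antitoneOn_of_hasDerivWithinAt_nonpos (convex_Icc 0 T)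
      (fun s hs => (hd s hs).continuousWithinAt)
      (fun s hs => (hd s (interior_subset hs)).mono interior_subset) fun s hs => ?_
    have h := hle s (interior_subset hs)
    exact mul_nonpos_of_nonpos_of_nonneg (by linarith) (Real.exp_pos _).le
  have h := hanti h0 ht ht.1
  simp only [mul_zero, neg_zero, Real.exp_zero, mul_one] at h
  rw [Real.exp_neg, ← div_eq_mul_inv, div_le_iff₀ (Real.exp_pos _)] at h
  exact h

end KPI
-- The weighted energy identity for band-limited Hermitian functions
namespace KPI

theorem inner_L2C (f g : L2C) : inner ℝ f g = ∫ ζ, ((starRingEnd ℂ) (f ζ) * g ζ).re := by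
  have h : inner ℝ f g = ∫ ζ, inner ℝ (f ζ) (g ζ) := L2.inner_def f g
  rw [h]
  refine integral_congr_ae (Filter.Eventually.of_forall fun ζ => ?_)
  simp only [Complex.inner, mul_comm]

theorem herm_of_ae_eq {a b : Plane → ℂ} (h : a =ᵐ[volume] b) (hb : Herm b) : Herm a := by
  filter_upwards [h, hb, measurePreserving_neg_plane.quasiMeasurePreserving.ae_eq_comp h]
    with ζ h1 h2 h3
  simp only [Function.comp_apply] at h3
  rw [h3, h2, h1]

theorem Herm.conv {a : Plane → ℂ} (ha : Herm a) (ζ : Plane) :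
    conv a a (-ζ) = (starRingEnd ℂ) (conv a a ζ) := by
  have h1 : KPI.conv a a (-ζ) = ∫ w, a (-w) * a (-(ζ - w)) := by
    unfold KPI.conv
    rw [← integral_neg_eq_self]
    refine integral_congr_ae (Filter.Eventually.of_forall fun w => ?_)
    simp only
    congr 2
    abel
  rw [h1]
  unfold KPI.conv
  rw [← integral_conj]
  refine integral_congr_ae ?_
  filter_upwards [ha, (Measure.measurePreserving_sub_left volume ζ).quasiMeasurePreserving.ae ha]
    with w h2 h3
  rw [h2, h3, map_mul]

theorem Herm.rhs {a : Plane → ℂ} (ha : Herm a) : Herm (rhs a) := by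
  filter_upwards [ha] with ζ h
  unfold KPI.rhs
  rw [ha.conv, disp_neg, nlSym_neg, h]
  simp only [map_sub, map_neg, map_mul]

theorem Herm.band_mul {a : Plane → ℂ} (ha : Herm a) (n : ℕ) : Herm (fun ζ => bandFn n ζ * a ζ) := by
  filter_upwards [ha] with ζ h
  by_cases hζ : ζ ∈ band n
  · simp only [bandFn_mem hζ, bandFn_mem (neg_mem_band.2 hζ), one_mul, h]
  · have hζ' : -ζ ∉ band n := fun h => hζ (neg_mem_band.1 h)
    simp only [bandFn_notMem hζ, bandFn_notMem hζ', zero_mul, map_zero]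

theorem Herm.cut {a : L2C} (ha : Herm a) (n : ℕ) : Herm (cut n a) :=
  herm_of_ae_eq (coeFn_cut n a) (ha.band_mul n)

theorem Herm.field {a : L2C} (ha : Herm a) (n : ℕ) : Herm (field n a) :=
  herm_of_ae_eq (coeFn_field n a) (ha.rhs.band_mul n)

theorem Herm.sub {a b : L2C} (ha : Herm a) (hb : Herm b) : Herm (a - b : L2C) := by
  refine herm_of_ae_eq (Lp.coeFn_sub a b) ?_
  filter_upwards [ha, hb] with ζ h1 h2
  simp only [Pi.sub_apply, h1, h2, map_sub]

/-- The pairing of `d` with an odd multiple of a convolution as an integral over triples of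
frequencies with zero sum. -/
theorem integral_conj_mul_conv {m : Plane → ℝ} (hm : ∀ ζ, m (-ζ) = -m ζ) {d s e : Plane → ℂ}
    (hd : Herm d)
    (hint : Integrable (fun p : Plane × Plane =>
      (m p.1 : ℂ) * (d p.1 * s p.2 * e (-p.1 - p.2)))) :
    Integrable (fun ζ => (starRingEnd ℂ) (d ζ) * ((m ζ : ℂ) * conv s e ζ)) ∧
    ∫ ζ, (starRingEnd ℂ) (d ζ) * ((m ζ : ℂ) * conv s e ζ) =
      -∫ p : Plane × Plane, (m p.1 : ℂ) * (d p.1 * s p.2 * e (-p.1 - p.2)) := by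
  have hi : ∀ ζ, ∫ w, (m ζ : ℂ) * (d ζ * s w * e (-ζ - w)) = m ζ * d ζ * conv s e (-ζ) := by
    intro ζ
    unfold conv
    rw [← integral_const_mul]
    refine integral_congr_ae (Filter.Eventually.of_forall fun w => ?_)
    simp only
    ring
  have h1 : Integrable (fun ζ => m ζ * d ζ * conv s e (-ζ)) := by
    have := hint.integral_prod_left
    simpa only [hi] using this
  have h2 : ∫ p : Plane × Plane, (m p.1 : ℂ) * (d p.1 * s p.2 * e (-p.1 - p.2)) =
      ∫ ζ, m ζ * d ζ * conv s e (-ζ) := by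
    rw [Measure.volume_eq_prod] at hint ⊢
    rw [integral_prod _ hint]
    simp only [hi]
  have h3 : (fun ζ => (starRingEnd ℂ) (d ζ) * ((m ζ : ℂ) * conv s e ζ)) =ᵐ[volume]
      fun ζ => -(m (-ζ) * d (-ζ) * conv s e (- -ζ)) := by
    filter_upwards [hd] with ζ h
    rw [hm, h, neg_neg]
    push_cast
    ring
  refine ⟨h1.comp_neg.neg.congr h3.symm, ?_⟩
  rw [integral_congr_ae h3, integral_neg,
    integral_neg_eq_self (fun ζ => (m ζ : ℂ) * d ζ * conv s e (-ζ)), h2]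

/-- A frequency-localised function has integrable transform, with any locally bounded weight. -/
theorem lintegral_mul_lt_top_of_cut {n : ℕ} {m : Plane → ℂ} (hm : Measurable m) {C : ℝ}
    (hC : ∀ ζ ∈ band n, ‖m ζ‖ ≤ C) {a : L2C} (ha : cut n a = a) :
    ∫⁻ ζ, ‖m ζ * a ζ‖ₑ < ∞ := by
  have h := ((memLp_band_mul hm hC).integrable_mul (Lp.memLp a)).hasFiniteIntegral
  refine lt_of_eq_of_lt (lintegral_congr_ae ?_) h
  have h2 := coeFn_cut n a
  rw [ha] at h2
  filter_upwards [h2] with ζ hζ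
  rw [Pi.mul_apply]
  conv_lhs => rw [hζ]
  congr 1
  ring

/-- Even nonnegative weights. -/
structure EvenWeight (M : ℝ → ℝ → ℝ) : Prop where
  meas : Measurable (Function.uncurry M)
  nonneg : ∀ x y, 0 ≤ M x y
  even : ∀ x y, M (-x) (-y) = M x y
  bdd : ∀ n, ∃ B : ℝ, ∀ ζ ∈ band n, M (ζ 0) (ζ 1) ≤ B

theorem integrable_trilinear {f g h : Plane → ℂ} (hf : Measurable f) (hg : Measurable g)
    (hh : Measurable h) {m : Plane → ℝ} (hm : Measurable m)
    (h1 : ∫⁻ ζ, ‖(m ζ : ℂ) * f ζ‖ₑ < ∞) (h2 : ∫⁻ ζ, ‖g ζ‖ₑ ^ 2 < ∞) (h3 : ∫⁻ ζ, ‖h ζ‖ₑ ^ 2 < ∞) :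
    Integrable (fun p : Plane × Plane => (m p.1 : ℂ) * (f p.1 * g p.2 * h (-p.1 - p.2))) := by
  refine ⟨Measurable.aestronglyMeasurable (by fun_prop), ?_⟩
  have hsq := sq_lintegral_trilinear_le (f := fun ζ => ‖(m ζ : ℂ) * f ζ‖ₑ) (g := fun ζ => ‖g ζ‖ₑ)
    (h := fun ζ => ‖h ζ‖ₑ) (by fun_prop) (by fun_prop) (by fun_prop)
  have h' := hsq.trans_lt (ENNReal.mul_lt_top (ENNReal.pow_lt_top h1) (ENNReal.mul_lt_top h2 h3))
  have h'' : ∫⁻ p : Plane × Plane, ‖(m p.1 : ℂ) * f p.1‖ₑ * ‖g p.2‖ₑ * ‖h (-p.1 - p.2)‖ₑ < ∞ := by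
    by_contra hc
    rw [not_lt_top_iff] at hc
    rw [hc, ENNReal.top_pow two_ne_zero] at h'
    exact lt_irrefl _ h'
  refine lt_of_eq_of_lt (lintegral_congr fun p => ?_) h''
  simp only [enorm_mul]
  ring

/-- The dispersive part contributes the real part of `M |a|² disp`, which vanishes. What remains is
`-πi` times the pairing of `a` with `ξ M (a * a)`, turned into the symmetric trilinear integral by
Hermitian symmetry and oddness of `ξ M`. Localisation to a band supplies integrability. -/
theorem enorm_integral_weight_rhs_le {M c : ℝ → ℝ → ℝ} (hM : EvenWeight M) {C : ℝ}
    (hc : Measurable (Function.uncurry c)) (hc0 : ∀ x y, 0 ≤ c x y)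
    (hT : TriBound M (fun x y => √(M x y)) c C) {n : ℕ} {a : L2C} (ha : cut n a = a)
    (hH : Herm a) :
    ‖∫ ζ, ((starRingEnd ℂ) (a ζ) * ((M (ζ 0) (ζ 1) : ℂ) * rhs a ζ)).re‖ₑ ≤
      ENNReal.ofReal Real.pi * (3 * ENNReal.ofReal C * (wiener c a * energy M a)) := by
  obtain ⟨B, hB⟩ := hM.bdd n
  have hMm : Measurable fun ζ : Plane => M (ζ 0) (ζ 1) := measurable_weight hM.meas
  set m : Plane → ℝ := fun ζ => ζ 0 * M (ζ 0) (ζ 1) with hm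
  have hmm : Measurable m := by
    rw [hm]
    exact Measurable.mul (by fun_prop) hMm
  have hodd : ∀ ζ, m (-ζ) = -m ζ := by
    intro ζ
    simp only [hm, PiLp.neg_apply, hM.even]
    ring
  have hL1 : ∫⁻ ζ, ‖(m ζ : ℂ) * a ζ‖ₑ < ∞ := by
    refine lintegral_mul_lt_top_of_cut (n := n) (m := fun ζ => (m ζ : ℂ)) (by fun_prop) (C := (n + 1) * B) (fun ζ hζ => ?_) ha
    rw [Complex.norm_real, hm, norm_mul, Real.norm_eq_abs, Real.norm_of_nonneg (hM.nonneg _ _)]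
    exact mul_le_mul hζ.2.1 (hB ζ hζ) (hM.nonneg _ _) (by positivity)
  have hint := integrable_trilinear (measurable_coeFn a) (measurable_coeFn a) (measurable_coeFn a)
    hmm hL1 (lintegral_sq_lt_top a) (lintegral_sq_lt_top a)
  obtain ⟨hi, he⟩ := integral_conj_mul_conv hodd hH hint
  have hflux := enorm_energy_flux_le hM.meas hM.nonneg hc hc0 hT (measurable_coeFn a) hint
  have h1 : ∀ ζ, ((starRingEnd ℂ) (a ζ) * ((M (ζ 0) (ζ 1) : ℂ) * rhs a ζ)).re =
      ((-(Real.pi * Complex.I)) * ((starRingEnd ℂ) (a ζ) * ((m ζ : ℂ) * conv a a ζ))).re := by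
    intro ζ
    have h2 : (starRingEnd ℂ) (a ζ) * ((M (ζ 0) (ζ 1) : ℂ) * rhs a ζ) =
        -(((M (ζ 0) (ζ 1) * Complex.normSq (a ζ) : ℝ) : ℂ) * disp ζ) +
        (-(Real.pi * Complex.I)) * ((starRingEnd ℂ) (a ζ) * ((m ζ : ℂ) * conv a a ζ)) := by
      rw [Complex.ofReal_mul, Complex.normSq_eq_conj_mul_self, hm]
      unfold rhs nlSym
      push_cast
      ring
    rw [h2, Complex.add_re, Complex.neg_re, Complex.re_ofReal_mul, disp_re, mul_zero, neg_zero,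
      zero_add]
  have h3 : ∫ ζ, ((starRingEnd ℂ) (a ζ) * ((M (ζ 0) (ζ 1) : ℂ) * rhs a ζ)).re =
      ((-(Real.pi * Complex.I)) * ∫ ζ, (starRingEnd ℂ) (a ζ) * ((m ζ : ℂ) * conv a a ζ)).re := by
    rw [← integral_const_mul]
    simp only [h1]
    exact integral_re (hi.const_mul _)
  rw [h3, he]
  refine (enorm_le_iff_norm_le.2 (Complex.abs_re_le_norm _)).trans ?_
  rw [enorm_mul, enorm_neg, enorm_neg, enorm_mul]
  refine mul_le_mul' ?_ hflux
  rw [← ofReal_norm, ← ofReal_norm, Complex.norm_I, Complex.norm_real,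
    Real.norm_of_nonneg Real.pi_pos.le]
  simp

theorem evenWeight_one : EvenWeight (fun _ _ => 1) :=
  ⟨measurable_const, fun _ _ => zero_le_one, fun _ _ => rfl, fun _ => ⟨1, fun _ _ => le_rfl⟩⟩

theorem even_pow (x : ℝ) {k : ℕ} (hk : Even k) : (-x) ^ k = x ^ k := hk.neg_pow x

theorem pow_le_of_abs_le {x B : ℝ} (h : |x| ≤ B) {k : ℕ} (hk : Even k) : x ^ k ≤ B ^ k := by
  rw [← hk.pow_abs]
  exact pow_le_pow_left₀ (abs_nonneg _) h k

theorem sq_inv_le_of_mem_band {n : ℕ} {ζ : Plane} (h : ζ ∈ band n) :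
    (ζ 0 ^ 2)⁻¹ ≤ ((n : ℝ) + 1) ^ 2 := by
  have h0 : (0 : ℝ) < ((n : ℝ) + 1)⁻¹ := by positivity
  rw [← sq_abs, ← inv_pow]
  refine pow_le_pow_left₀ (by positivity) ?_ 2
  rw [← inv_inv ((n : ℝ) + 1)]
  exact inv_anti₀ h0 h.1

theorem evenWeight_weightX : EvenWeight weightX := by
  refine ⟨measurable_weightX, fun x y => zero_le_one.trans (weightX_pos x y), fun x y => ?_,
    fun n => ⟨1 + (n + 1) ^ 6 + (n + 1) ^ 4 * (n + 1) ^ 2, fun ζ h => ?_⟩⟩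
  · unfold weightX
    rw [even_pow x ⟨3, rfl⟩, even_pow y ⟨2, rfl⟩, even_pow x ⟨1, rfl⟩]
  · unfold weightX
    rw [div_eq_mul_inv]
    have h1 := pow_le_of_abs_le h.2.1 (k := 6) ⟨3, rfl⟩
    have h2 := pow_le_of_abs_le h.2.2 (k := 4) ⟨2, rfl⟩
    have h3 := sq_inv_le_of_mem_band h
    have h4 : 0 ≤ (ζ 0 ^ 2)⁻¹ := by positivity
    gcongr

theorem evenWeight_weightY (N : ℕ) : EvenWeight (weightY N) := by
  have e6 : Even (2 * N + 6) := ⟨N + 3, by ring⟩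
  have e4 : Even (2 * N + 4) := ⟨N + 2, by ring⟩
  have e0 : Even (2 * N) := ⟨N, by ring⟩
  refine ⟨measurable_weightY N, fun x y => zero_le_one.trans (weightY_pos N x y), fun x y => ?_,
    fun n => ?_⟩
  · unfold weightY
    rw [evenWeight_weightX.even, even_pow x ⟨1, rfl⟩, even_pow x ⟨3, rfl⟩, even_pow x e6,
      even_pow y e4, even_pow y e0]
  · obtain ⟨B, hB⟩ := evenWeight_weightX.bdd n
    refine ⟨B + ((n : ℝ) + 1) ^ (2 * N + 6) + ((n : ℝ) + 1) ^ 6 * ((n : ℝ) + 1) ^ (2 * N)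
      + ((n : ℝ) + 1) ^ (2 * N + 4) + ((n : ℝ) + 1) ^ (2 * N + 4) * ((n : ℝ) + 1) ^ 2,
      fun ζ h => ?_⟩
    unfold weightY
    rw [div_eq_mul_inv]
    have h0 := hB ζ h
    have h1 := pow_le_of_abs_le h.2.1 (k := 6) ⟨3, rfl⟩
    have h2 := pow_le_of_abs_le h.2.1 e6
    have h3 := pow_le_of_abs_le h.2.2 e4
    have h5 := pow_le_of_abs_le h.2.2 e0
    have h4 := sq_inv_le_of_mem_band h
    have h6 : 0 ≤ (ζ 0 ^ 2)⁻¹ := by positivity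
    have h7 : 0 ≤ ζ 1 ^ (2 * N) := e0.pow_nonneg _
    gcongr

end KPI
-- Galerkin solutions and their uniform energy bounds
namespace KPI

theorem cut_cut (n : ℕ) (a : L2C) : cut n (cut n a) = cut n a := by
  apply Lp.ext
  filter_upwards [coeFn_cut n (cut n a), coeFn_cut n a] with ζ h1 h2
  rw [h1, h2]
  by_cases hζ : ζ ∈ band n
  · rw [bandFn_mem hζ, one_mul]
  · rw [bandFn_notMem hζ, zero_mul, zero_mul]

/-- Conservation of the `L²` norm is the energy estimate for the weight 1, whose symmetrised
multiplier `x₀ + x₁ + x₂` is zero; so `TriBound` holds with constant 0. -/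
theorem inner_field_eq_zero (n : ℕ) {a : L2C} (hH : Herm a) :
    inner ℝ a (field n (cut n a)) = 0 := by
  have h := enorm_integral_weight_rhs_le evenWeight_one (c := fun _ _ => 0) measurable_const
    (fun _ _ => le_rfl) TriBound.one (cut_cut n a) (hH.cut n)
  rw [ENNReal.ofReal_zero, mul_zero, zero_mul, mul_zero, nonpos_iff_eq_zero, enorm_eq_zero] at h
  rw [inner_L2C, ← h]
  refine integral_congr_ae ?_
  filter_upwards [coeFn_field n (cut n a), coeFn_cut n a] with ζ h1 h2
  rw [h1, h2]
  by_cases hζ : ζ ∈ band n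
  · rw [bandFn_mem hζ]; simp
  · rw [bandFn_notMem hζ]; simp

/-- A solution of the equation truncated to `band n`. -/
structure Galerkin (n : ℕ) (T : ℝ) (a : ℝ → L2C) : Prop where
  deriv : ∀ t ∈ Set.Icc 0 T, HasDerivWithinAt a (field n (a t)) (Set.Icc 0 T) t
  supp : ∀ t ∈ Set.Icc 0 T, cut n (a t) = a t
  herm : ∀ t ∈ Set.Icc 0 T, Herm (a t)

theorem exists_galerkin (n : ℕ) (φ : L2R) {T : ℝ} (hT : 0 < T) :
    ∃ a, Galerkin n T a ∧ a 0 = cut n (four φ) := by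
  have hH : ∀ u : L2R, Herm (field n (cut n (four u))) := fun u => ((herm_four u).cut n).field n
  -- The ODE is posed for real functions, so that Hermitian symmetry is automatic. Its solution `u`
  -- need not be band-limited; the Galerkin solution is the cut of its transform.
  set G : L2R → L2R := fun u => fourInv (field n (cut n (four u))) with hG
  have hfG : ∀ u, four (G u) = field n (cut n (four u)) := fun u => four_fourInv (hH u)
  obtain ⟨u, hu0, hu⟩ := exists_global_solution (G := G) (fun R => by
      obtain ⟨K, hK⟩ := exists_lipschitzOnWith_field n R
      refine ⟨K, LipschitzOnWith.of_dist_le_mul fun x hx y hy => ?_⟩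
      rw [mem_closedBall_zero_iff] at hx hy
      have h1 := hK.dist_le_mul (cut n (four x))
        (by rw [mem_closedBall_zero_iff]; exact (norm_cut_le n _).trans ((norm_four x).trans_le hx))
        (cut n (four y))
        (by rw [mem_closedBall_zero_iff]; exact (norm_cut_le n _).trans ((norm_four y).trans_le hy))
      rw [dist_eq_norm, dist_eq_norm] at h1 ⊢
      have h2 : ‖cut n (four x) - cut n (four y)‖ ≤ ‖x - y‖ := by
        rw [← map_sub]
        refine (norm_cut_le n _).trans_eq ?_
        rw [← fourL_apply, ← fourL_apply, ← map_sub, LinearIsometry.norm_map]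
      have h3 : ‖G x - G y‖ ≤ ‖field n (cut n (four x)) - field n (cut n (four y))‖ := by
        rw [hG]
        simp only
        rw [← map_sub]
        exact norm_fourInv_le _
      calc _ ≤ _ := h3
        _ ≤ _ := h1
        _ ≤ _ := by gcongr)
    (fun x => by
      rw [← LinearIsometry.inner_map_map fourL, fourL_apply, fourL_apply, hfG]
      exact inner_field_eq_zero n (herm_four x)) φ hT
  refine ⟨fun t => cut n (four (u t)), ⟨fun t ht => ?_, fun t _ => cut_cut n _,
    fun t _ => (herm_four _).cut n⟩, by simp only [hu0]⟩
  have h1 := (fourL.toContinuousLinearMap.hasFDerivAt (x := u t)).comp_hasDerivWithinAt t (hu t ht)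
  have h2 := (((cut n).restrictScalars ℝ).hasFDerivAt
    (x := four (u t))).comp_hasDerivWithinAt t h1
  refine h2.congr_deriv ?_
  change cut n (four (G (u t))) = _
  rw [hfG, cut_field le_rfl]

theorem bddMul_sqrt {M : ℝ → ℝ → ℝ} (hM : EvenWeight M) (n : ℕ) :
    BddMul (fun ζ => bandFn n ζ * ((√(M (ζ 0) (ζ 1)) : ℝ) : ℂ)) := by
  obtain ⟨B, hB⟩ := hM.bdd n
  have := measurable_weight hM.meas
  refine bddMul_band_mul (Complex.measurable_ofReal.comp (Real.continuous_sqrt.measurable.comp this))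
    (C := √B) fun ζ h => ?_
  rw [Complex.norm_real, Real.norm_of_nonneg (Real.sqrt_nonneg _)]
  exact Real.sqrt_le_sqrt (hB ζ h)

/-- On a band the weight is bounded, so the energy is the squared norm of a bounded operator applied
to `a`. It is therefore finite and differentiable along Galerkin solutions. -/
theorem energy_eq_enorm_sq {M : ℝ → ℝ → ℝ} (hM : EvenWeight M) {n : ℕ} {a : L2C}
    (ha : cut n a = a) :
    energy M a = ‖mulOp (fun ζ => bandFn n ζ * ((√(M (ζ 0) (ζ 1)) : ℝ) : ℂ)) a‖ₑ ^ 2 := by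
  rw [enorm_sq_eq]
  refine lintegral_congr_ae ?_
  have h2 := coeFn_cut n a
  rw [ha] at h2
  filter_upwards [coeFn_mulOp (bddMul_sqrt hM n) a, h2] with ζ h1 h2
  have h3 : bandFn n ζ * ((√(M (ζ 0) (ζ 1)) : ℝ) : ℂ) * a ζ = ((√(M (ζ 0) (ζ 1)) : ℝ) : ℂ) * a ζ := by
    conv_rhs => rw [h2]
    ring
  rw [h1, h3, enorm_mul, mul_pow, ← ofReal_norm ((√(M (ζ 0) (ζ 1)) : ℝ) : ℂ),
    Complex.norm_real, Real.norm_of_nonneg (Real.sqrt_nonneg _), ← ENNReal.ofReal_pow (Real.sqrt_nonneg _),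
    Real.sq_sqrt (hM.nonneg _ _)]

theorem Galerkin.energy_deriv {n : ℕ} {T : ℝ} {a : ℝ → L2C} (ha : Galerkin n T a)
    {M c : ℝ → ℝ → ℝ} (hM : EvenWeight M) {C : ℝ}
    (hc : Measurable (Function.uncurry c)) (hc0 : ∀ x y, 0 ≤ c x y)
    (hT : TriBound M (fun x y => √(M x y)) c C) {t : ℝ} (ht : t ∈ Set.Icc 0 T) :
    ∃ D : ℝ, HasDerivWithinAt (fun t => (energy M (a t)).toReal) D (Set.Icc 0 T) t ∧
      ENNReal.ofReal D ≤ ENNReal.ofReal (6 * Real.pi * C) * (wiener c (a t) * energy M (a t)) := by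
  set S := mulOp (fun ζ => bandFn n ζ * ((√(M (ζ 0) (ζ 1)) : ℝ) : ℂ)) with hS
  have hE : ∀ s ∈ Set.Icc 0 T, (energy M (a s)).toReal = ‖S (a s)‖ ^ 2 := by
    intro s hs
    rw [energy_eq_enorm_sq hM (ha.supp s hs), ENNReal.toReal_pow, toReal_enorm]
  have h1 := ((S.restrictScalars ℝ).hasFDerivAt (x := a t)).comp_hasDerivWithinAt t (ha.deriv t ht)
  have h2 := h1.norm_sq
  refine ⟨_, h2.congr_of_mem (fun s hs => hE s hs) ht, ?_⟩
  have h3 : inner ℝ (S (a t)) (S (field n (a t))) =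
      ∫ ζ, ((starRingEnd ℂ) (a t ζ) * ((M (ζ 0) (ζ 1) : ℂ) * rhs (a t) ζ)).re := by
    rw [inner_L2C]
    refine integral_congr_ae ?_
    have h4 := coeFn_cut n (a t)
    rw [ha.supp t ht] at h4
    filter_upwards [coeFn_mulOp (bddMul_sqrt hM n) (a t), h4,
      coeFn_mulOp (bddMul_sqrt hM n) (field n (a t)), coeFn_field n (a t)] with ζ h5 h6 h7 h8
    rw [h5, h7, h8]
    by_cases hζ : ζ ∈ band n
    · have hs : ((M (ζ 0) (ζ 1) : ℝ) : ℂ) = (√(M (ζ 0) (ζ 1)) : ℝ) * (√(M (ζ 0) (ζ 1)) : ℝ) := by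
        rw [← Complex.ofReal_mul, Real.mul_self_sqrt (hM.nonneg _ _)]
      rw [bandFn_mem hζ, hs, map_mul, map_mul, Complex.conj_ofReal, map_one]
      congr 1
      ring
    · rw [bandFn_notMem hζ, zero_mul] at h6
      rw [h6]
      simp
  have h4 := enorm_integral_weight_rhs_le hM hc hc0 hT (ha.supp t ht) (ha.herm t ht)
  rw [← h3] at h4
  have h5 : ENNReal.ofReal (inner ℝ (S (a t)) (S (field n (a t)))) ≤
      ‖inner ℝ (S (a t)) (S (field n (a t)))‖ₑ := by
    rw [← ofReal_norm, Real.norm_eq_abs]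
    exact ENNReal.ofReal_le_ofReal (le_abs_self _)
  change ENNReal.ofReal (2 * inner ℝ (S (a t)) (S (field n (a t)))) ≤ _
  rw [ENNReal.ofReal_mul zero_le_two]
  -- The constant `6π` collects 2 from differentiating a square, `π` from the symbol of `½ ∂ₓ`, and
  -- 3 from the three terms in `TriBound`.
  calc _ ≤ ENNReal.ofReal 2 * (ENNReal.ofReal Real.pi * (3 * ENNReal.ofReal C *
        (wiener c (a t) * energy M (a t)))) := mul_le_mul_right (h5.trans h4) _
    _ = _ := by
      have e : (3 : ℝ≥0∞) = ENNReal.ofReal 3 := by simp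
      rw [show 6 * Real.pi * C = 2 * (Real.pi * (3 * C)) by ring, ENNReal.ofReal_mul (by norm_num),
        ENNReal.ofReal_mul Real.pi_pos.le, ENNReal.ofReal_mul (by norm_num), e]
      ring

theorem Galerkin.energy_lt_top {n : ℕ} {T : ℝ} {a : ℝ → L2C} (ha : Galerkin n T a)
    {M : ℝ → ℝ → ℝ} (hM : EvenWeight M) {t : ℝ} (ht : t ∈ Set.Icc 0 T) :
    energy M (a t) < ∞ := by
  rw [energy_eq_enorm_sq hM (ha.supp t ht)]
  exact ENNReal.pow_lt_top enorm_lt_top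

/-- The energy estimate in terms of a dominating energy. -/
theorem Galerkin.energy_deriv_le {n : ℕ} {T : ℝ} {a : ℝ → L2C} (ha : Galerkin n T a)
    {M L c : ℝ → ℝ → ℝ} (hM : EvenWeight M) {C : ℝ}
    (hc : Measurable (Function.uncurry c)) (hc0 : ∀ x y, 0 ≤ c x y)
    (hT : TriBound M (fun x y => √(M x y)) c C) {Q : ℝ≥0}
    (hQ : ∀ a, Measurable a → wiener c a ^ 2 ≤ Q * energy L a) {t : ℝ} (ht : t ∈ Set.Icc 0 T)
    {E : ℝ} (hE0 : 0 ≤ E) (hE : energy L (a t) ≤ ENNReal.ofReal E) :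
    ∃ D : ℝ, HasDerivWithinAt (fun t => (energy M (a t)).toReal) D (Set.Icc 0 T) t ∧
      D ≤ 6 * Real.pi * |C| * (√(Q * E) * (energy M (a t)).toReal) := by
  obtain ⟨D, hD, hD2⟩ := ha.energy_deriv hM hc hc0 hT ht
  refine ⟨D, hD, ?_⟩
  have h1 : wiener c (a t) ≤ ENNReal.ofReal √(Q * E) := by
    have h2 : wiener c (a t) ^ 2 ≤ ENNReal.ofReal √(Q * E) ^ 2 := by
      rw [← ENNReal.ofReal_pow (Real.sqrt_nonneg _), Real.sq_sqrt (by positivity),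
        ENNReal.ofReal_mul (NNReal.coe_nonneg Q), ENNReal.ofReal_coe_nnreal]
      exact (hQ _ (measurable_coeFn _)).trans (by gcongr)
    exact (ENNReal.pow_le_pow_left_iff two_ne_zero).1 h2
  have h3 := (ha.energy_lt_top hM ht).ne
  rw [← ENNReal.ofReal_toReal h3] at hD2
  have h4 : ENNReal.ofReal D ≤ ENNReal.ofReal
      (6 * Real.pi * |C| * (√(Q * E) * (energy M (a t)).toReal)) := by
    have hp := Real.pi_pos
    rw [ENNReal.ofReal_mul (p := 6 * Real.pi * |C|) (by positivity),
      ENNReal.ofReal_mul (p := √(Q * E)) (by positivity)]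
    refine hD2.trans ?_
    have := le_abs_self C
    gcongr
  have hp := Real.pi_pos
  exact (ENNReal.ofReal_le_ofReal_iff (by positivity)).1 h4

/-- Once the `L` energy is bounded, `∫ c |a|` is bounded as well, and the inequality for the `M`
energy becomes linear; Gronwall applies on the whole interval. The bound is chosen before `n`, hence
uniform in the truncation. -/
theorem Galerkin.energy_le_exp {M L c : ℝ → ℝ → ℝ} (hM : EvenWeight M) {C : ℝ}
    (hc : Measurable (Function.uncurry c)) (hc0 : ∀ x y, 0 ≤ c x y)
    (hT : TriBound M (fun x y => √(M x y)) c C) (hd : Dominates L c) {T E K : ℝ} (hE0 : 0 ≤ E)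
    (hK : 0 ≤ K) :
    ∃ B : ℝ, 0 ≤ B ∧ ∀ n a, Galerkin n T a →
      (∀ t ∈ Set.Icc 0 T, energy L (a t) ≤ ENNReal.ofReal E) →
      energy M (a 0) ≤ ENNReal.ofReal K →
      ∀ t ∈ Set.Icc 0 T, energy M (a t) ≤ ENNReal.ofReal B := by
  obtain ⟨Q, hQ⟩ := hd
  set R := 6 * Real.pi * |C| * √(Q * E) with hR
  have hp := Real.pi_pos
  refine ⟨K * Real.exp (R * T), by positivity, fun n a ha hE hK' t ht => ?_⟩
  have h0 : (0 : ℝ) ∈ Set.Icc 0 T := ⟨le_rfl, ht.1.trans ht.2⟩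
  choose! D hD using fun s hs => ha.energy_deriv_le hM hc hc0 hT hQ hs hE0 (hE s hs)
  have h := le_exp_of_deriv_le (B := R) (fun s hs => (hD s hs).1)
    (fun s hs => (hD s hs).2.trans_eq (by rw [hR]; ring)) ht
  rw [← ENNReal.ofReal_toReal (ha.energy_lt_top hM ht).ne]
  refine ENNReal.ofReal_le_ofReal (h.trans ?_)
  have h1 : (energy M (a 0)).toReal ≤ K := ENNReal.toReal_le_of_le_ofReal hK hK'
  have h2 : R * t ≤ R * T := by
    have := ht.2
    gcongr
  gcongr

theorem coefX_nonneg (x y : ℝ) : 0 ≤ coefX x y := (abs_nonneg x).trans (abs_le_coefX x y)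

theorem coefY_nonneg (N : ℕ) (x y : ℝ) : 0 ≤ coefY N x y :=
  (abs_nonneg x).trans (abs_le_coefY N x y)

/-- The `X⁰` energy `y` controls its own coefficient, so `y'` is at most a multiple of `√y · y`,
which is below `(1 + y)²`: a Riccati inequality whose time of validity depends on `K` alone. -/
theorem Galerkin.exists_energyX_le :
    ∃ A : ℝ, 0 < A ∧ ∀ n T a, Galerkin n T a → ∀ K : ℝ, 0 ≤ K →
      energy weightX (a 0) ≤ ENNReal.ofReal K → 2 * A * T * (1 + K) ≤ 1 →
      ∀ t ∈ Set.Icc 0 T, energy weightX (a t) ≤ ENNReal.ofReal (2 * (1 + K)) := by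
  obtain ⟨C, hC⟩ := exists_triBound_weightX
  obtain ⟨Q, hQ⟩ := dominates_coefX
  have hp := Real.pi_pos
  -- The added 1 only serves to make the constant strictly positive, as is needed when dividing by
  -- it to define the time.
  refine ⟨6 * Real.pi * |C| * √Q + 1, by positivity, fun n T a ha K hK hK' hT t ht => ?_⟩
  set A := 6 * Real.pi * |C| * √Q + 1 with hA
  have hA0 : 0 ≤ A := by positivity
  set y := fun t => (energy weightX (a t)).toReal with hy
  have h0 : (0 : ℝ) ∈ Set.Icc 0 T := ⟨le_rfl, ht.1.trans ht.2⟩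
  have hT0 : 0 ≤ T := ht.1.trans ht.2
  have hy0 : ∀ s, 0 ≤ y s := fun s => ENNReal.toReal_nonneg
  choose! D hD using fun s hs => ha.energy_deriv_le evenWeight_weightX measurable_coefX
    coefX_nonneg hC hQ hs (hy0 s)
    (ENNReal.ofReal_toReal (ha.energy_lt_top evenWeight_weightX hs).ne).ge
  have h1 : y 0 ≤ K := ENNReal.toReal_le_of_le_ofReal hK hK'
  have h := one_add_le_of_deriv_le hA0 (fun s _ => hy0 s) (fun s hs => (hD s hs).1)
    (fun s hs => (hD s hs).2.trans ?_) ht ?_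
  · rw [← ENNReal.ofReal_toReal (ha.energy_lt_top evenWeight_weightX ht).ne]
    exact ENNReal.ofReal_le_ofReal (h.trans (by linarith))
  · have h2 : √(y s) ≤ 1 + y s := by
      rw [Real.sqrt_le_left (by linarith [hy0 s])]
      nlinarith [hy0 s]
    have h3 : √(Q * y s) * y s ≤ √Q * (1 + y s) ^ 2 := by
      rw [Real.sqrt_mul (NNReal.coe_nonneg Q), sq, mul_assoc]
      have := hy0 s
      gcongr
      linarith
    change _ * (√(Q * y s) * y s) ≤ _
    calc _ ≤ 6 * Real.pi * |C| * (√Q * (1 + y s) ^ 2) := by gcongr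
      _ ≤ _ := by rw [hA]; nlinarith [sq_nonneg (1 + y s)]
  · refine le_trans ?_ hT
    gcongr

theorem weightY_le_succ (N : ℕ) (x y : ℝ) : weightY N x y ≤ 4 * weightY (N + 1) x y := by
  have e (k : ℕ) (z : ℝ) : z ^ (2 * k) ≤ 1 + z ^ (2 * (k + 1)) := by
    rw [pow_mul, pow_mul]
    have h : 0 ≤ z ^ 2 := sq_nonneg z
    rcases le_total (z ^ 2) 1 with h1 | h1
    · have := pow_le_one₀ (n := k) h h1
      have : 0 ≤ (z ^ 2) ^ (k + 1) := by positivity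
      linarith
    · have := pow_le_pow_right₀ h1 (Nat.le_add_right k 1)
      linarith
  have h1 := e (N + 3) x
  have h2 := e N y
  have h3 := e (N + 2) y
  have hx : 0 ≤ x ^ 6 := by positivity
  have hx' : 0 ≤ (x ^ 2)⁻¹ := by positivity
  have hy : 0 ≤ y ^ 4 := by positivity
  have h4 : x ^ 6 * y ^ (2 * N) ≤ x ^ 6 * (1 + y ^ (2 * (N + 1))) := by gcongr
  have h5 : y ^ 4 * y ^ (2 * N) * (x ^ 2)⁻¹ ≤ y ^ 4 * (1 + y ^ (2 * (N + 1))) * (x ^ 2)⁻¹ := by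
    gcongr
  have p1 : 0 ≤ y ^ (2 * (N + 1)) := by rw [pow_mul]; positivity
  have p2 : 0 ≤ x ^ (2 * (N + 1)) := by rw [pow_mul]; positivity
  have p3 : 0 ≤ y ^ 4 * (x ^ 2)⁻¹ := by positivity
  have p4 : 0 ≤ y ^ 4 * y ^ (2 * (N + 1)) * (x ^ 2)⁻¹ := by positivity
  have p5 : 0 ≤ x ^ 6 * y ^ (2 * (N + 1)) := by positivity
  have p6 : 0 ≤ y ^ (2 * (N + 3)) := by rw [pow_mul]; positivity
  have p7 : 0 ≤ x ^ (2 * (N + 4)) := by rw [pow_mul]; positivity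
  have d1 : y ^ 4 / x ^ 2 = y ^ 4 * (x ^ 2)⁻¹ := div_eq_mul_inv _ _
  have d2 : y ^ (2 * N + 4) / x ^ 2 = y ^ 4 * y ^ (2 * N) * (x ^ 2)⁻¹ := by
    rw [div_eq_mul_inv]; ring
  have d3 : y ^ (2 * (N + 1) + 4) / x ^ 2 = y ^ 4 * y ^ (2 * (N + 1)) * (x ^ 2)⁻¹ := by
    rw [div_eq_mul_inv]; ring
  have d4 : y ^ (2 * (N + 1) + 4) = y ^ (2 * (N + 3)) := by ring
  have d5 : x ^ (2 * (N + 1) + 6) = x ^ (2 * (N + 4)) := by ring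
  have d6 : y ^ (2 * N + 4) = y ^ (2 * (N + 2)) := by ring
  have d7 : x ^ (2 * N + 6) = x ^ (2 * (N + 3)) := by ring
  unfold weightY weightX
  rw [d1, d2, d3, d4, d5, d6, d7]
  rw [show N + 2 + 1 = N + 3 by ring] at h3
  rw [show N + 3 + 1 = N + 4 by ring] at h1
  linarith

theorem energy_weightY_le_succ (N : ℕ) (a : Plane → ℂ) :
    energy (weightY N) a ≤ 4 * energy (weightY (N + 1)) a := by
  unfold energy
  rw [← lintegral_const_mul' _ _ (by norm_num)]
  refine lintegral_mono fun ζ => ?_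
  rw [← mul_assoc]
  gcongr
  rw [show (4 : ℝ≥0∞) = ENNReal.ofReal 4 by simp, ← ENNReal.ofReal_mul (by norm_num)]
  exact ENNReal.ofReal_le_ofReal (weightY_le_succ N _ _)

/-- Induction on `N` with `T` fixed: level 0 has coefficients controlled by the `X⁰` energy, level
`N + 1` by the `Y^N` energy. Every inequality is linear, so higher regularity never shortens the
interval. -/
theorem Galerkin.exists_energyY_le (N : ℕ) {T E : ℝ} (hE0 : 0 ≤ E) :
    ∀ K : ℝ, 0 ≤ K → ∃ B : ℝ, 0 ≤ B ∧ ∀ n a, Galerkin n T a →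
      (∀ t ∈ Set.Icc 0 T, energy weightX (a t) ≤ ENNReal.ofReal E) →
      energy (weightY N) (a 0) ≤ ENNReal.ofReal K →
      ∀ t ∈ Set.Icc 0 T, energy (weightY N) (a t) ≤ ENNReal.ofReal B := by
  induction N with
  | zero =>
    intro K hK
    obtain ⟨C, hC⟩ := exists_triBound_weightY_zero
    exact Galerkin.energy_le_exp (evenWeight_weightY 0) measurable_coefX coefX_nonneg hC
      dominates_coefX hE0 hK
  | succ N ih =>
    intro K hK
    obtain ⟨E', hE', h1⟩ := ih (4 * K) (by positivity)
    obtain ⟨C, hC⟩ := exists_triBound_weightY_succ N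
    obtain ⟨B, hB, h2⟩ := Galerkin.energy_le_exp (T := T) (evenWeight_weightY (N + 1))
      (measurable_coefY N) (coefY_nonneg N) hC (dominates_coefY N) hE' hK
    refine ⟨B, hB, fun n a ha hX h0 => h2 n a ha (h1 n a ha hX ?_) h0⟩
    refine (energy_weightY_le_succ N _).trans ?_
    rw [ENNReal.ofReal_mul (by norm_num), show ENNReal.ofReal 4 = (4 : ℝ≥0∞) by simp]
    gcongr

end KPI
-- `L²` bounds for the right hand side, and a Gronwall inequality for absolutely continuous curves
namespace KPI

/-- The factor `1 + |ξ| + |η|` beyond the derivative `|ξ|` is a spare power of the frequency; it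
yields the rate `1/n` for the part of the nonlinearity lost at high frequencies. -/
theorem mul_one_add_add_le (x₁ y₁ x₂ y₂ : ℝ) (h₁ : x₁ ≠ 0) (h₂ : x₂ ≠ 0) :
    |x₁ + x₂| * (1 + |x₁ + x₂| + |y₁ + y₂|) ≤
      8 * ((1 + |x₁|) * √(weightX x₂ y₂) + (1 + |x₂|) * √(weightX x₁ y₁)) := by
  have key : ∀ x y : ℝ, x ≠ 0 → 1 ≤ √(weightX x y) ∧ |x| ^ 2 ≤ √(weightX x y) * 1 ∧
      |x| ≤ √(weightX x y) ∧
      |x| * |y| ≤ √(weightX x y) ∧ |y| ≤ √(weightX x y) := by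
    intro x y hx
    -- With `y² = q x` the weight becomes the polynomial `1 + x⁶ + q²`, and the claims become
    -- polynomial inequalities in `x` and `q`.
    set q := y ^ 2 / x with hq
    have hy : y ^ 2 = q * x := by rw [hq]; field_simp
    have hW : weightX x y = 1 + x ^ 6 + q ^ 2 := by
      unfold weightX
      rw [hq]
      field_simp
    rw [hW, mul_one, sq_abs, ← abs_mul]
    refine ⟨Real.le_sqrt_of_sq_le (by nlinarith [sq_nonneg (x ^ 3)]),
      Real.le_sqrt_of_sq_le ?_, Real.abs_le_sqrt ?_, Real.abs_le_sqrt ?_, Real.abs_le_sqrt ?_⟩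
    · nlinarith [sq_nonneg (x ^ 3), sq_nonneg (x ^ 2 - 1), sq_nonneg x, sq_nonneg q,
        mul_nonneg (sq_nonneg x) (sq_nonneg (x ^ 2 - 1))]
    · nlinarith [sq_nonneg (x ^ 2 - 1), sq_nonneg x, sq_nonneg q,
        mul_nonneg (sq_nonneg x) (sq_nonneg (x ^ 2 - 1))]
    · rw [mul_pow, hy]
      nlinarith [sq_nonneg (x ^ 3 - q), sq_nonneg (x ^ 3), sq_nonneg q]
    · rw [hy]
      nlinarith [sq_nonneg (x - q), sq_nonneg (x ^ 2 - 1), sq_nonneg x, sq_nonneg q,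
        mul_nonneg (sq_nonneg x) (sq_nonneg (x ^ 2 - 1))]
  obtain ⟨a1, a2, a3, a4, a5⟩ := key x₁ y₁ h₁
  obtain ⟨b1, b2, b3, b4, b5⟩ := key x₂ y₂ h₂
  set V₁ := √(weightX x₁ y₁)
  set V₂ := √(weightX x₂ y₂)
  have e1 := abs_add_le x₁ x₂
  have e2 := abs_add_le y₁ y₂
  have p1 := abs_nonneg x₁
  have p2 := abs_nonneg x₂
  have q1 := abs_nonneg y₁
  have q2 := abs_nonneg y₂
  calc _ ≤ (|x₁| + |x₂|) * (1 + (|x₁| + |x₂|) + (|y₁| + |y₂|)) := by gcongr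
    _ ≤ _ := by
      have c1 : |x₁| * |x₂| ≤ |x₁| * V₂ := by gcongr
      have c2 : |x₁| * |y₂| ≤ |x₁| * V₂ := by gcongr
      have c3 : |x₂| * |y₁| ≤ |x₂| * V₁ := by gcongr
      have c4 : 0 ≤ |x₂| * V₁ := by positivity
      have c5 : 0 ≤ |x₁| * V₂ := by positivity
      nlinarith

/-- An absolutely continuous curve in a Hilbert space with a differential inequality for its
squared norm. -/
theorem norm_sq_add_le_exp {E : Type*} [NormedAddCommGroup E] [InnerProductSpace ℝ E]
    [CompleteSpace E] {D β : ℝ → E} {T A B δ : ℝ} (hA : 0 ≤ A)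
    (hβ : IntervalIntegrable β volume 0 T)
    (hB : ∀ᵐ t ∂(volume.restrict (Set.Icc 0 T)), ‖β t‖ ≤ B)
    (hD : ∀ t ∈ Set.Icc 0 T, D t = D 0 + ∫ s in (0 : ℝ)..t, β s)
    (hle : ∀ᵐ t ∂(volume.restrict (Set.Icc 0 T)), 2 * inner ℝ (D t) (β t) ≤ A * (‖D t‖ ^ 2 + δ))
    {t : ℝ} (ht : t ∈ Set.Icc 0 T) : ‖D t‖ ^ 2 + δ ≤ (‖D 0‖ ^ 2 + δ) * Real.exp (A * t) := by
  have hT : 0 ≤ T := ht.1.trans ht.2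
  have h0 : (0 : ℝ) ∈ Set.Icc 0 T := ⟨le_rfl, hT⟩
  rw [ae_restrict_iff' measurableSet_Icc] at hB hle
  have hi : ∀ s ∈ Set.Icc 0 T, IntervalIntegrable β volume 0 s := fun s hs =>
    hβ.mono_set (by rw [Set.uIcc_of_le hs.1, Set.uIcc_of_le hT]; exact Set.Icc_subset_Icc_right hs.2)
  have hsub : ∀ s ∈ Set.Icc 0 T, ∀ r ∈ Set.Icc 0 T, ‖D s - D r‖ ≤ |B| * |s - r| := by
    intro s hs r hr
    have e : D s - D r = ∫ x in r..s, β x := by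
      rw [hD s hs, hD r hr, add_sub_add_left_eq_sub,
        intervalIntegral.integral_interval_sub_left (hi s hs) (hi r hr)]
    rw [e]
    refine intervalIntegral.norm_integral_le_of_norm_le_const_ae ?_
    filter_upwards [hB] with x hx hxi
    have : x ∈ Set.Icc 0 T := by
      have := Set.uIoc_subset_uIcc hxi
      exact (Set.uIcc_subset_Icc hr hs) this
    exact (hx this).trans (le_abs_self B)
  have hDn : ∀ s ∈ Set.Icc 0 T, ‖D s‖ ≤ ‖D 0‖ + |B| * T := by
    intro s hs
    have h1 := hsub s hs 0 h0
    have h2 := norm_add_le (D 0) (D s - D 0)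
    rw [add_sub_cancel, sub_zero] at *
    rw [abs_of_nonneg hs.1] at h1
    have h3 : |B| * s ≤ |B| * T := by gcongr; exact hs.2
    linarith
  set g : ℝ → ℝ := fun s => ‖D s‖ ^ 2 with hg
  set R := ‖D 0‖ + |B| * T with hR
  have hR0 : 0 ≤ R := by positivity
  -- The derivative exists only almost everywhere, so monotonicity arguments are unavailable;
  -- Lipschitz continuity gives absolute continuity and thereby the fundamental theorem of calculus
  -- for `g`.
  have hgL : LipschitzOnWith (Real.toNNReal (2 * R * |B|)) g (Set.uIcc 0 T) := by
    rw [Set.uIcc_of_le hT]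
    refine LipschitzOnWith.of_dist_le_mul fun s hs r hr => ?_
    rw [Real.coe_toNNReal _ (by positivity), Real.dist_eq, Real.dist_eq]
    have h1 : g s - g r = (‖D s‖ - ‖D r‖) * (‖D s‖ + ‖D r‖) := by simp only [hg]; ring
    rw [h1, abs_mul, abs_of_nonneg (by positivity : 0 ≤ ‖D s‖ + ‖D r‖)]
    have h2 := (abs_norm_sub_norm_le (D s) (D r)).trans (hsub s hs r hr)
    have h3 := hDn s hs
    have h4 := hDn r hr
    calc _ ≤ (|B| * |s - r|) * (R + R) := by gcongr
      _ = _ := by ring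
  have hAC : ∀ s ∈ Set.Icc 0 T, AbsolutelyContinuousOnInterval g 0 s := fun s hs =>
    (hgL.mono (by rw [Set.uIcc_of_le hs.1, Set.uIcc_of_le hT]; exact
      Set.Icc_subset_Icc_right hs.2)).absolutelyContinuousOnInterval
  have hgc : ContinuousOn g (Set.Icc 0 T) := by
    have := hgL.continuousOn
    rwa [Set.uIcc_of_le hT] at this
  -- the derivative almost everywhere
  have hder : ∀ᵐ s, s ∈ Set.Ioo 0 T → deriv g s ≤ A * (g s + δ) := by
    filter_upwards [hβ.ae_hasDerivAt_integral, hle] with s h1 h2 hs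
    have hs' := Set.Ioo_subset_Icc_self hs
    rw [Set.uIcc_of_le hT] at h1
    have h3 : HasDerivAt D (β s) s := by
      refine ((h1 hs' 0 h0).const_add (D 0)).congr_of_eventuallyEq ?_
      filter_upwards [Ioo_mem_nhds hs.1 hs.2] with r hr
      exact hD r (Set.Ioo_subset_Icc_self hr)
    have h4 : HasDerivAt g (2 * inner ℝ (D s) (β s)) s := h3.norm_sq
    rw [h4.deriv]
    exact h2 hs'
  have hcont : ContinuousOn (fun s => A * (g s + δ)) (Set.Icc 0 T) := by fun_prop
  have hii : ∀ s ∈ Set.Icc 0 T, IntervalIntegrable (fun s => A * (g s + δ)) volume 0 s := by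
    intro s hs
    refine ContinuousOn.intervalIntegrable ?_
    rw [Set.uIcc_of_le hs.1]
    exact hcont.mono (Set.Icc_subset_Icc_right hs.2)
  have hint : ∀ s ∈ Set.Icc 0 T, g s ≤ g 0 + ∫ r in (0 : ℝ)..s, A * (g r + δ) := by
    intro s hs
    have h1 := (hAC s hs).integral_deriv_eq_sub
    have h2 : ∫ r in (0 : ℝ)..s, deriv g r ≤ ∫ r in (0 : ℝ)..s, A * (g r + δ) := by
      refine intervalIntegral.integral_mono_ae_restrict hs.1 (hAC s hs).intervalIntegrable_deriv
        (hii s hs) ?_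
      rw [Filter.EventuallyLE, ae_restrict_iff' measurableSet_Icc]
      filter_upwards [hder, Measure.ae_ne volume 0, Measure.ae_ne volume T] with r hr hr0 hrT hrs
      exact hr ⟨lt_of_le_of_ne hrs.1 hr0.symm, lt_of_le_of_ne (hrs.2.trans hs.2) hrT⟩
    linarith
  -- The integrated inequality says `g + δ ≤ G`, and `G` is differentiable everywhere with `G' = A
  -- (g + δ) ≤ A G`, so the classical Gronwall lemma applies to `G`.
  set G : ℝ → ℝ := fun s => g 0 + δ + ∫ r in (0 : ℝ)..s, A * (g r + δ) with hG
  have hGd : ∀ s ∈ Set.Icc 0 T, HasDerivWithinAt G (A * (g s + δ)) (Set.Icc 0 T) s := by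
    intro s hs
    have : Fact (s ∈ Set.Icc 0 T) := ⟨hs⟩
    exact (intervalIntegral.integral_hasDerivWithinAt_right (hii s hs)
      (hcont.stronglyMeasurableAtFilter_nhdsWithin measurableSet_Icc s) (hcont s hs)).const_add _
  have h := le_exp_of_deriv_le (B := A) hGd (fun s hs => by
    have := hint s hs
    have : g s + δ ≤ G s := by simp only [hG]; linarith
    gcongr) ht
  have h1 := hint t ht
  have h2 : G 0 = g 0 + δ := by simp [hG]
  rw [h2] at h
  have h3 : g t + δ ≤ G t := by simp only [hG]; linarith
  exact h3.trans h

theorem measurable_rhs {a : Plane → ℂ} (ha : Measurable a) : Measurable (rhs a) := by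
  unfold rhs
  have := measurable_conv ha ha
  have := measurable_disp
  have := measurable_nlSym
  fun_prop

/-- A multiplier bound of product type for the quadratic term. -/
theorem lintegral_mul_conv_le {g : Plane → ℂ} {r : ℝ} (hr : 0 ≤ r)
    (hg : ∀ x₁ y₁ x₂ y₂ : ℝ, x₁ ≠ 0 → x₂ ≠ 0 → ∀ ζ : Plane, ζ 0 = x₁ + x₂ → ζ 1 = y₁ + y₂ →
      ‖g ζ‖ ≤ r * ((1 + |x₁|) * √(weightX x₂ y₂) + (1 + |x₂|) * √(weightX x₁ y₁)))
    {a : Plane → ℂ} (ha : Measurable a) :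
    ∫⁻ ζ, ‖g ζ * conv a a ζ‖ₑ ^ 2 ≤
      ENNReal.ofReal (4 * r ^ 2) * (wiener (fun x _ => 1 + |x|) a ^ 2 * energy weightX a) := by
  set c : Plane → ℂ := fun ζ => ((1 + |ζ 0| : ℝ) : ℂ) * a ζ with hc
  set V : Plane → ℂ := fun ζ => ((√(weightX (ζ 0) (ζ 1)) : ℝ) : ℂ) * a ζ with hV
  have hwm := measurable_weight measurable_weightX
  have hcm : Measurable c := by fun_prop
  have hVm : Measurable V :=
    (Complex.measurable_ofReal.comp (Real.continuous_sqrt.measurable.comp hwm)).mul ha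
  have hce : ∀ ζ, ‖c ζ‖ₑ = ENNReal.ofReal (1 + |ζ 0|) * ‖a ζ‖ₑ := by
    intro ζ
    simp only [hc]
    rw [enorm_mul, ← ofReal_norm, Complex.norm_real, Real.norm_of_nonneg (by positivity)]
  have hVe : ∀ ζ, ‖V ζ‖ₑ = ENNReal.ofReal √(weightX (ζ 0) (ζ 1)) * ‖a ζ‖ₑ := by
    intro ζ
    simp only [hV]
    rw [enorm_mul, ← ofReal_norm, Complex.norm_real, Real.norm_of_nonneg (Real.sqrt_nonneg _)]
  have h1 : ∀ ζ, ‖g ζ * conv a a ζ‖ₑ ≤ ENNReal.ofReal (2 * r) * convAbs c V ζ := by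
    intro ζ
    have h2 : ‖g ζ‖ₑ * convAbs a a ζ ≤
        ∫⁻ w, ENNReal.ofReal r * (‖c w‖ₑ * ‖V (ζ - w)‖ₑ + ‖V w‖ₑ * ‖c (ζ - w)‖ₑ) := by
      unfold convAbs
      rw [← lintegral_const_mul _ (by fun_prop)]
      refine lintegral_mono_ae ?_
      filter_upwards [ae_coord_ne_zero, (Measure.measurePreserving_sub_left volume
        ζ).quasiMeasurePreserving.ae ae_coord_ne_zero] with w hw1 hw2
      have h3 := hg (w 0) (w 1) ((ζ - w) 0) ((ζ - w) 1) hw1 hw2 ζ (by simp) (by simp)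
      rw [hce, hVe, hce, hVe]
      have h4 : ‖g ζ‖ₑ ≤ ENNReal.ofReal r * (ENNReal.ofReal (1 + |w 0|) *
          ENNReal.ofReal √(weightX ((ζ - w) 0) ((ζ - w) 1)) + ENNReal.ofReal (1 + |(ζ - w) 0|) *
          ENNReal.ofReal √(weightX (w 0) (w 1))) := by
        rw [← ENNReal.ofReal_mul (by positivity), ← ENNReal.ofReal_mul (by positivity),
          ← ENNReal.ofReal_add (by positivity) (by positivity), ← ENNReal.ofReal_mul hr,
          ← ofReal_norm]
        exact ENNReal.ofReal_le_ofReal h3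
      calc _ ≤ _ := mul_le_mul_left h4 _
        _ = _ := by ring
    have h3 : ∫⁻ w, ENNReal.ofReal r * (‖c w‖ₑ * ‖V (ζ - w)‖ₑ + ‖V w‖ₑ * ‖c (ζ - w)‖ₑ) =
        ENNReal.ofReal r * (convAbs c V ζ + convAbs V c ζ) := by
      unfold convAbs
      rw [lintegral_const_mul _ (by fun_prop), lintegral_add_left (by fun_prop)]
    rw [enorm_mul]
    refine (mul_le_mul_right (enorm_conv_le a a ζ) _).trans (h2.trans_eq ?_)
    rw [h3, convAbs_comm V c, ENNReal.ofReal_mul zero_le_two, ← two_mul]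
    simp only [ENNReal.ofReal_ofNat]
    ring
  have h4 : ∫⁻ w, ‖c w‖ₑ = wiener (fun x _ => 1 + |x|) a := lintegral_congr hce
  have h5 : ∫⁻ w, ‖V w‖ₑ ^ 2 = energy weightX a := by
    refine lintegral_congr fun w => ?_
    rw [hVe, mul_pow, ← ENNReal.ofReal_pow (Real.sqrt_nonneg _), Real.sq_sqrt
      (zero_le_one.trans (weightX_pos _ _))]
  calc _ ≤ ∫⁻ ζ, ENNReal.ofReal (4 * r ^ 2) * convAbs c V ζ ^ 2 := by
        refine lintegral_mono fun ζ => ?_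
        refine (pow_le_pow_left' (h1 ζ) 2).trans_eq ?_
        rw [mul_pow, ← ENNReal.ofReal_pow (by positivity)]
        congr 2
        ring
    _ = ENNReal.ofReal (4 * r ^ 2) * ∫⁻ ζ, convAbs c V ζ ^ 2 := by
        rw [lintegral_const_mul _ ((measurable_convAbs hcm hVm).pow_const 2)]
    _ ≤ _ := by
        rw [← h4, ← h5]
        gcongr
        exact lintegral_convAbs_sq_le hcm hVm

/-- The nonlinear term is bounded in `L²` by the energy. -/
theorem exists_lintegral_nl_le : ∃ C : ℝ≥0, ∀ a : Plane → ℂ, Measurable a →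
    ∫⁻ ζ, ‖nlSym ζ * conv a a ζ‖ₑ ^ 2 ≤ C * energy weightX a ^ 2 := by
  obtain ⟨Q, hQ⟩ := dominates_one_add_abs
  have hp := Real.pi_pos
  refine ⟨Real.toNNReal (4 * (8 * Real.pi) ^ 2) * Q, fun a ha => ?_⟩
  refine (lintegral_mul_conv_le (r := 8 * Real.pi) (by positivity) ?_ ha).trans ?_
  · intro x₁ y₁ x₂ y₂ h1 h2 ζ h3 h4
    have h5 := mul_one_add_add_le x₁ y₁ x₂ y₂ h1 h2
    have h6 : |x₁ + x₂| * 1 ≤ |x₁ + x₂| * (1 + |x₁ + x₂| + |y₁ + y₂|) := by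
      gcongr
      linarith [abs_nonneg (x₁ + x₂), abs_nonneg (y₁ + y₂)]
    rw [norm_nlSym, h3, mul_comm 8, mul_assoc]
    gcongr
    linarith
  · rw [ENNReal.coe_mul, mul_assoc, sq (energy weightX a), ← mul_assoc (Q : ℝ≥0∞)]
    gcongr
    · exact le_rfl
    · exact hQ a ha

/-- The nonlinear term is small off `band n`. -/
theorem exists_lintegral_nl_tail_le : ∃ C : ℝ≥0, ∀ a : Plane → ℂ, Measurable a → ∀ n : ℕ,
    ∫⁻ ζ, ‖(1 - bandFn n ζ) * nlSym ζ * conv a a ζ‖ₑ ^ 2 ≤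
      ENNReal.ofReal (((n : ℝ) + 1)⁻¹ ^ 2) * (C * energy weightX a ^ 2) := by
  obtain ⟨Q, hQ⟩ := dominates_one_add_abs
  have hp := Real.pi_pos
  refine ⟨Real.toNNReal (4 * (8 * Real.pi) ^ 2) * Q, fun a ha n => ?_⟩
  have hn : (0 : ℝ) < n + 1 := by positivity
  refine (lintegral_mul_conv_le (r := ((n : ℝ) + 1)⁻¹ * (8 * Real.pi)) (by positivity) ?_
    ha).trans ?_
  · intro x₁ y₁ x₂ y₂ h1 h2 ζ h3 h4
    have h5 := mul_one_add_add_le x₁ y₁ x₂ y₂ h1 h2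
    have w1 : 1 ≤ √(weightX x₁ y₁) := Real.one_le_sqrt.2 (weightX_pos _ _)
    have w2 : 1 ≤ √(weightX x₂ y₂) := Real.one_le_sqrt.2 (weightX_pos _ _)
    set Z := (1 + |x₁|) * √(weightX x₂ y₂) + (1 + |x₂|) * √(weightX x₁ y₁) with hZ
    have hZ1 : 1 ≤ 8 * Z := by
      have : 1 * 1 ≤ (1 + |x₁|) * √(weightX x₂ y₂) := by
        gcongr
        linarith [abs_nonneg x₁]
      have : 0 ≤ (1 + |x₂|) * √(weightX x₁ y₁) := by positivity
      linarith
    by_cases hζ : ζ ∈ band n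
    · rw [bandFn_mem hζ, sub_self, zero_mul, norm_zero]
      positivity
    · rw [bandFn_notMem hζ, sub_zero, one_mul, norm_nlSym]
      have key : |ζ 0| * (n + 1) ≤ 8 * Z := by
        unfold band at hζ
        simp only [Set.mem_ofPred_eq, not_and_or, not_le] at hζ
        rw [← h3, ← h4] at h5
        have p0 := abs_nonneg (ζ 0)
        have p1 := abs_nonneg (ζ 1)
        -- Off the band either `|ξ|` is below `1/(n+1)`, where the derivative itself is small, or
        -- one coordinate exceeds `n + 1`, where the spare factor `1 + |ξ| + |η|` pays.
        rcases hζ with h | h | h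
        · have : |ζ 0| * (n + 1) ≤ 1 := by
            rw [← le_div_iff₀ hn, one_div]
            exact h.le
          linarith
        · nlinarith
        · nlinarith
      have h6 : |ζ 0| ≤ ((n : ℝ) + 1)⁻¹ * (8 * Z) := by
        rw [← div_eq_inv_mul, le_div_iff₀ hn]
        exact key
      calc _ ≤ Real.pi * (((n : ℝ) + 1)⁻¹ * (8 * Z)) := by gcongr
        _ = _ := by ring
  · rw [ENNReal.coe_mul, mul_pow, mul_left_comm (4 : ℝ), ENNReal.ofReal_mul (by positivity),
      mul_assoc, mul_assoc, sq (energy weightX a), ← mul_assoc (Q : ℝ≥0∞)]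
    gcongr
    · exact le_rfl
    · exact hQ a ha

/-- The linear term is bounded in `L²` by the energy. -/
theorem lintegral_disp_le (a : Plane → ℂ) :
    ∫⁻ ζ, ‖disp ζ * a ζ‖ₑ ^ 2 ≤ ENNReal.ofReal ((2 * Real.pi) ^ 6 * 8) * energy weightX a := by
  unfold energy
  rw [← lintegral_const_mul' _ _ ENNReal.ofReal_ne_top]
  refine lintegral_mono_ae ?_
  filter_upwards [ae_coord_ne_zero] with ζ h
  rw [enorm_mul, mul_pow, ← mul_assoc, ← ENNReal.ofReal_mul (by positivity)]
  gcongr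
  rw [← ofReal_norm, ← ENNReal.ofReal_pow (norm_nonneg _), norm_disp]
  refine ENNReal.ofReal_le_ofReal ?_
  rw [sq_abs]
  set x := ζ 0
  set y := ζ 1
  set q := y ^ 2 / x with hq
  have hW : weightX x y = 1 + x ^ 6 + q ^ 2 := by
    unfold weightX
    rw [hq]
    field_simp
  have h2 : 1 ≤ 2 * Real.pi := by linarith [Real.pi_gt_three]
  have e1 : (1 : ℝ) ≤ (2 * Real.pi) ^ 4 := one_le_pow₀ h2
  have e2 : (2 * Real.pi) ^ 2 * 1 ≤ (2 * Real.pi) ^ 2 * (2 * Real.pi) ^ 4 := by gcongr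
  have e3 : (-(2 * Real.pi * x) ^ 3 + 2 * Real.pi * x - 2 * Real.pi * q) ^ 2 ≤
      3 * ((2 * Real.pi) ^ 6 * x ^ 6 + (2 * Real.pi) ^ 2 * x ^ 2 + (2 * Real.pi) ^ 2 * q ^ 2) := by
    nlinarith [sq_nonneg (-(2 * Real.pi * x) ^ 3 - 2 * Real.pi * x),
      sq_nonneg (-(2 * Real.pi * x) ^ 3 + 2 * Real.pi * q),
      sq_nonneg (2 * Real.pi * x + 2 * Real.pi * q)]
  have e4 : x ^ 2 ≤ 1 + x ^ 6 := by
    nlinarith [sq_nonneg (x ^ 2 - 1), sq_nonneg x, mul_nonneg (sq_nonneg x)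
      (sq_nonneg (x ^ 2 - 1))]
  rw [hW]
  set P := (2 * Real.pi) ^ 6 with hP
  have e5 : (2 * Real.pi) ^ 2 ≤ P := by rw [hP]; linarith [e2]
  have hx6 : 0 ≤ x ^ 6 := by positivity
  have hq2 : 0 ≤ q ^ 2 := by positivity
  have hP0 : 0 ≤ P := by positivity
  calc _ ≤ _ := e3
    _ ≤ 3 * (P * x ^ 6 + P * (1 + x ^ 6) + P * q ^ 2) := by gcongr
    _ ≤ _ := by nlinarith [mul_nonneg hP0 hx6, mul_nonneg hP0 hq2]

/-- The right hand side is bounded in `L²` by the energy. -/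
theorem exists_lintegral_rhs_le (E : ℝ) : ∃ B : ℝ≥0, ∀ a : Plane → ℂ, Measurable a →
    energy weightX a ≤ ENNReal.ofReal E → ∫⁻ ζ, ‖rhs a ζ‖ₑ ^ 2 ≤ B := by
  obtain ⟨C, hC⟩ := exists_lintegral_nl_le
  set S : ℝ≥0 := 4 * (Real.toNNReal ((2 * Real.pi) ^ 6 * 8) * Real.toNNReal E +
    C * Real.toNNReal E ^ 2) with hS
  refine ⟨S, fun a ha hE => ?_⟩
  have hm := measurable_disp
  have h1 : ∫⁻ ζ, ‖rhs a ζ‖ₑ ^ 2 ≤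
      ∫⁻ ζ, 4 * (‖disp ζ * a ζ‖ₑ ^ 2 + ‖nlSym ζ * conv a a ζ‖ₑ ^ 2) := by
    refine lintegral_mono fun ζ => ?_
    refine le_trans (pow_le_pow_left' ?_ 2) (ennreal_add_sq_le _ _)
    unfold rhs
    refine (enorm_sub_le).trans ?_
    rw [enorm_neg]
  refine h1.trans ?_
  rw [lintegral_const_mul' _ _ (by norm_num), lintegral_add_left (by fun_prop)]
  rw [hS]
  push_cast
  gcongr
  · exact (lintegral_disp_le a).trans (mul_le_mul_right hE _)
  · exact (hC a ha).trans (mul_le_mul_right (pow_le_pow_left' hE 2) _)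

end KPI
-- Stability and uniqueness in `L²`
namespace KPI

/-- A solution of the equation on the Fourier side, up to an error of size `ε` in `L²`, with
energy at most `E`. -/
structure ApproxSolution (T ε E : ℝ) (a b : ℝ → L2C) : Prop where
  int : IntervalIntegrable b volume 0 T
  bdd : ∃ B : ℝ, ∀ᵐ t ∂(volume.restrict (Set.Icc 0 T)), ‖b t‖ ≤ B
  eq_int : ∀ t ∈ Set.Icc 0 T, a t = a 0 + ∫ s in (0 : ℝ)..t, b s
  err : ∀ᵐ t ∂(volume.restrict (Set.Icc 0 T)), ∃ e : L2C, ‖e‖ ≤ ε ∧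
    b t =ᵐ[volume] fun ζ => rhs (a t) ζ + e ζ
  herm : ∀ t ∈ Set.Icc 0 T, Herm (a t)
  energy : ∀ t ∈ Set.Icc 0 T, energy weightX (a t) ≤ ENNReal.ofReal E

theorem wiener_congr {c : ℝ → ℝ → ℝ} {a b : Plane → ℂ} (h : a =ᵐ[volume] b) :
    wiener c a = wiener c b := by
  refine lintegral_congr_ae ?_
  filter_upwards [h] with ζ h
  rw [h]

theorem wiener_add_le {c : ℝ → ℝ → ℝ} (hc : Measurable (Function.uncurry c)) (a b : L2C) :
    wiener c (a + b : L2C) ≤ wiener c a + wiener c b := by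
  have hm := measurable_weight hc
  have ha := measurable_coeFn a
  rw [wiener_congr (Lp.coeFn_add a b)]
  unfold wiener
  rw [← lintegral_add_left (by fun_prop)]
  refine lintegral_mono fun ζ => ?_
  rw [← mul_add]
  gcongr
  exact enorm_add_le _ _

theorem wiener_sub_le {c : ℝ → ℝ → ℝ} (hc : Measurable (Function.uncurry c)) (a b : L2C) :
    wiener c (a - b : L2C) ≤ wiener c a + wiener c b := by
  have hm := measurable_weight hc
  have ha := measurable_coeFn a
  rw [wiener_congr (Lp.coeFn_sub a b)]
  unfold wiener
  rw [← lintegral_add_left (by fun_prop)]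
  refine lintegral_mono fun ζ => ?_
  rw [← mul_add]
  gcongr
  exact enorm_sub_le

theorem conv_sub_self (a₁ a₂ : L2C) (ζ : Plane) :
    conv (a₁ + a₂ : L2C) (a₁ - a₂ : L2C) ζ = conv a₁ a₁ ζ - conv a₂ a₂ ζ := by
  have h1 := conv_add_left a₁ a₂ (a₁ - a₂) ζ
  have h2 : ∀ b : L2C, conv b (a₁ - a₂ : L2C) ζ = conv b a₁ ζ - conv b a₂ ζ := by
    intro b
    have h3 := conv_add_left (a₁ - a₂) a₂ b ζ
    rw [sub_add_cancel, conv_comm a₁, conv_comm (a₁ - a₂ : L2C), conv_comm a₂ b] at h3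
    rw [h3]; ring
  rw [h1, h2, h2, conv_comm a₂ a₁]
  ring

/-- The difference of the squares factors as `(a₁ + a₂) * (a₁ - a₂)`, and the flux estimate puts the
derivative on the sum. So no derivative of the difference is lost; finiteness of its weighted `L¹`
norm serves only to justify the integrals. -/
theorem enorm_inner_rhs_sub_le {a₁ a₂ r : L2C} (h₁ : Herm a₁) (h₂ : Herm a₂)
    (hr : r =ᵐ[volume] fun ζ => rhs a₁ ζ - rhs a₂ ζ)
    (hw : wiener (fun x _ => |x|) (a₁ - a₂ : L2C) < ∞) :
    ‖inner ℝ (a₁ - a₂) r‖ₑ ≤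
      ENNReal.ofReal Real.pi * (wiener (fun x _ => |x|) (a₁ + a₂ : L2C) * ‖a₁ - a₂‖ₑ ^ 2) := by
  set d := a₁ - a₂ with hd
  set s := a₁ + a₂ with hs
  have hodd : ∀ ζ : Plane, (-ζ) 0 = -(ζ 0) := fun ζ => rfl
  have hH : Herm d := h₁.sub h₂
  have hL1 : ∫⁻ ζ, ‖((ζ 0 : ℝ) : ℂ) * d ζ‖ₑ < ∞ := by
    refine lt_of_eq_of_lt (lintegral_congr fun ζ => ?_) hw
    rw [enorm_mul, ← ofReal_norm, Complex.norm_real, Real.norm_eq_abs]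
  have hint := integrable_trilinear (m := fun ζ => ζ 0) (measurable_coeFn d) (measurable_coeFn s)
    (measurable_coeFn d) (by fun_prop) hL1 (lintegral_sq_lt_top s) (lintegral_sq_lt_top d)
  obtain ⟨hi, he⟩ := integral_conj_mul_conv (m := fun ζ => ζ 0) hodd hH hint
  have hflux := enorm_difference_flux_le (measurable_coeFn d) (measurable_coeFn s) hint
  have h3 : inner ℝ d r =
      ((-(Real.pi * Complex.I)) * ∫ ζ, (starRingEnd ℂ) (d ζ) * ((ζ 0 : ℂ) * conv s d ζ)).re := by
    rw [inner_L2C, ← integral_const_mul]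
    refine (integral_congr_ae ?_).trans (integral_re (hi.const_mul _))
    filter_upwards [hr, Lp.coeFn_sub a₁ a₂] with ζ h4 h5
    have h2 : (starRingEnd ℂ) (d ζ) * r ζ =
        -(((Complex.normSq (d ζ) : ℝ) : ℂ) * disp ζ) +
        (-(Real.pi * Complex.I)) * ((starRingEnd ℂ) (d ζ) * ((ζ 0 : ℂ) * conv s d ζ)) := by
      rw [h4, Complex.normSq_eq_conj_mul_self, hs, hd, conv_sub_self, ← hd]
      have h6 : d ζ = a₁ ζ - a₂ ζ := h5
      unfold rhs nlSym
      rw [h6]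
      ring
    rw [h2, Complex.add_re, Complex.neg_re, Complex.re_ofReal_mul, disp_re, mul_zero, neg_zero,
      zero_add]
    rfl
  rw [h3, he, enorm_sq_eq]
  refine (enorm_le_iff_norm_le.2 (Complex.abs_re_le_norm _)).trans ?_
  rw [enorm_mul, enorm_neg, enorm_neg, enorm_mul]
  refine mul_le_mul' ?_ hflux
  rw [← ofReal_norm, ← ofReal_norm, Complex.norm_I, Complex.norm_real,
    Real.norm_of_nonneg Real.pi_pos.le]
  simp

/-- Stability in `L²`. -/
theorem exists_stability (E : ℝ) (hE : 0 ≤ E) : ∃ A : ℝ, 0 ≤ A ∧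
    ∀ (T ε : ℝ) (a₁ b₁ a₂ b₂ : ℝ → L2C), ApproxSolution T ε E a₁ b₁ → ApproxSolution T ε E a₂ b₂ →
      ∀ t ∈ Set.Icc 0 T, ‖a₁ t - a₂ t‖ ^ 2 + ε ^ 2 ≤
        (‖a₁ 0 - a₂ 0‖ ^ 2 + ε ^ 2) * Real.exp (A * t) := by
  obtain ⟨Q, hQ⟩ := dominates_one_add_abs
  have hp := Real.pi_pos
  set W := √(Q * E) with hW
  -- The flux gives `2 · π · 2W ‖d‖²`, as each solution has weighted `L¹` norm at most `W`. The
  -- errors give `4 ε ‖d‖ ≤ 2 (‖d‖² + ε²)`.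
  refine ⟨4 * Real.pi * W + 2, by positivity, fun T ε a₁ b₁ a₂ b₂ h₁ h₂ t ht => ?_⟩
  obtain ⟨B₁, hB₁⟩ := h₁.bdd
  obtain ⟨B₂, hB₂⟩ := h₂.bdd
  have hT : 0 ≤ T := ht.1.trans ht.2
  have hwm : Measurable (Function.uncurry fun x _ : ℝ => |x|) := by
    unfold Function.uncurry; fun_prop
  have hw : ∀ a : L2C, energy weightX a ≤ ENNReal.ofReal E →
      wiener (fun x _ => |x|) a ≤ ENNReal.ofReal W := by
    intro a ha
    refine (wiener_mono (l := fun x _ => 1 + |x|) (fun x y => by linarith) a).trans ?_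
    refine (ENNReal.pow_le_pow_left_iff two_ne_zero).1 ?_
    rw [← ENNReal.ofReal_pow (Real.sqrt_nonneg _), Real.sq_sqrt (by positivity),
      ENNReal.ofReal_mul (NNReal.coe_nonneg Q), ENNReal.ofReal_coe_nnreal]
    exact (hQ _ (measurable_coeFn _)).trans (by gcongr)
  refine norm_sq_add_le_exp (D := fun t => a₁ t - a₂ t) (β := fun t => b₁ t - b₂ t)
    (B := B₁ + B₂) (by positivity) (h₁.int.sub h₂.int) ?_ ?_ ?_ ht
  · filter_upwards [hB₁, hB₂] with s h3 h4
    exact (norm_sub_le _ _).trans (add_le_add h3 h4)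
  · intro s hs
    have hsub : Set.uIcc 0 s ⊆ Set.uIcc 0 T := by
      rw [Set.uIcc_of_le hs.1, Set.uIcc_of_le hT]
      exact Set.Icc_subset_Icc_right hs.2
    rw [intervalIntegral.integral_sub (h₁.int.mono_set hsub) (h₂.int.mono_set hsub),
      h₁.eq_int s hs, h₂.eq_int s hs]
    abel
  · filter_upwards [h₁.err, h₂.err, ae_restrict_mem measurableSet_Icc] with s
      ⟨e₁, he₁, hb₁⟩ ⟨e₂, he₂, hb₂⟩ hs
    set d := a₁ s - a₂ s with hd
    set r := b₁ s - b₂ s - (e₁ - e₂) with hr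
    have hr' : r =ᵐ[volume] fun ζ => rhs (a₁ s) ζ - rhs (a₂ s) ζ := by
      filter_upwards [hb₁, hb₂, Lp.coeFn_sub (b₁ s) (b₂ s), Lp.coeFn_sub e₁ e₂,
        Lp.coeFn_sub (b₁ s - b₂ s) (e₁ - e₂)] with ζ h3 h4 h5 h6 h7
      rw [hr, h7, Pi.sub_apply, h5, h6, Pi.sub_apply, Pi.sub_apply, h3, h4]
      ring
    have hw₁ := hw _ (h₁.energy s hs)
    have hw₂ := hw _ (h₂.energy s hs)
    have h3 := enorm_inner_rhs_sub_le (h₁.herm s hs) (h₂.herm s hs) hr'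
      ((wiener_sub_le hwm _ _).trans_lt (ENNReal.add_lt_top.2
        ⟨hw₁.trans_lt ENNReal.ofReal_lt_top, hw₂.trans_lt ENNReal.ofReal_lt_top⟩))
    have hW0 : 0 ≤ W := Real.sqrt_nonneg _
    have h4 : inner ℝ d r ≤ Real.pi * (2 * W * ‖d‖ ^ 2) := by
      have h5 : ENNReal.ofReal (inner ℝ d r) ≤ ENNReal.ofReal (Real.pi * (2 * W * ‖d‖ ^ 2)) := by
        refine le_trans ?_ (h3.trans ?_)
        · rw [← ofReal_norm, Real.norm_eq_abs]
          exact ENNReal.ofReal_le_ofReal (le_abs_self _)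
        · rw [ENNReal.ofReal_mul hp.le, ENNReal.ofReal_mul (by positivity),
            ENNReal.ofReal_pow (norm_nonneg _), ofReal_norm]
          gcongr
          refine ((wiener_add_le hwm _ _).trans (add_le_add hw₁ hw₂)).trans_eq ?_
          rw [← ENNReal.ofReal_add hW0 hW0, two_mul]
      exact (ENNReal.ofReal_le_ofReal_iff (by positivity)).1 h5
    have h5 : inner ℝ d (e₁ - e₂) ≤ ‖d‖ * (2 * ε) := by
      refine (real_inner_le_norm _ _).trans ?_
      have := norm_sub_le e₁ e₂
      gcongr
      linarith
    have h6 : inner ℝ d (b₁ s - b₂ s) = inner ℝ d r + inner ℝ d (e₁ - e₂) := by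
      rw [← inner_add_right, hr, sub_add_cancel]
    rw [h6]
    nlinarith [sq_nonneg (‖d‖ - ε), mul_nonneg (mul_nonneg hp.le hW0) (sq_nonneg ε)]

theorem ApproxSolution.unique {T E : ℝ} (hE : 0 ≤ E) {a₁ b₁ a₂ b₂ : ℝ → L2C}
    (h₁ : ApproxSolution T 0 E a₁ b₁) (h₂ : ApproxSolution T 0 E a₂ b₂) (h0 : a₁ 0 = a₂ 0)
    {t : ℝ} (ht : t ∈ Set.Icc 0 T) : a₁ t = a₂ t := by
  obtain ⟨A, _, hA⟩ := exists_stability E hE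
  have h := hA T 0 a₁ b₁ a₂ b₂ h₁ h₂ t ht
  rw [h0, sub_self, norm_zero, zero_pow two_ne_zero, add_zero, add_zero, zero_mul] at h
  have h1 : ‖a₁ t - a₂ t‖ = 0 := by nlinarith [norm_nonneg (a₁ t - a₂ t)]
  exact sub_eq_zero.1 (norm_eq_zero.1 h1)

end KPI
-- Convergence of the Galerkin solutions
namespace KPI

theorem enorm_bandFn_le (n : ℕ) (ζ : Plane) : ‖bandFn n ζ‖ₑ ≤ 1 := by
  rw [← ofReal_norm]
  exact ENNReal.ofReal_le_one.2 (norm_bandFn_le n ζ)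

theorem energy_cut_le (M : ℝ → ℝ → ℝ) (n : ℕ) (a : L2C) : energy M (cut n a) ≤ energy M a := by
  refine lintegral_mono_ae ?_
  filter_upwards [coeFn_cut n a] with ζ h
  rw [h]
  gcongr
  rw [enorm_mul]
  exact mul_le_of_le_one_left' (enorm_bandFn_le n ζ)

theorem norm_le_of_lintegral_sq_le {f : L2C} {B : ℝ} (hB : 0 ≤ B)
    (h : ∫⁻ ζ, ‖f ζ‖ₑ ^ 2 ≤ ENNReal.ofReal (B ^ 2)) : ‖f‖ ≤ B := by
  rw [← enorm_sq_eq, ENNReal.ofReal_pow hB, ENNReal.pow_le_pow_left_iff two_ne_zero,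
    ← ofReal_norm, ENNReal.ofReal_le_ofReal_iff hB] at h
  exact h

theorem memLp_of_lintegral_sq_lt_top {f : Plane → ℂ} (hf : Measurable f)
    (h : ∫⁻ ζ, ‖f ζ‖ₑ ^ 2 < ∞) : MemLp f 2 volume := by
  refine ⟨hf.aestronglyMeasurable, ?_⟩
  have h2 := eLpNorm_nnreal_pow_eq_lintegral (μ := (volume : Measure Plane)) (f := f)
    (p := 2) two_ne_zero
  have h3 : eLpNorm f 2 volume ^ ((2 : ℝ≥0) : ℝ) < ∞ := by
    refine lt_of_eq_of_lt h2 (lt_of_eq_of_lt (lintegral_congr fun ζ => ?_) h)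
    exact ENNReal.rpow_natCast _ 2
  by_contra hc
  rw [not_lt_top_iff] at hc
  rw [hc] at h3
  simp at h3

/-- Weighted energies are lower semicontinuous. -/
theorem energy_le_of_tendsto {M : ℝ → ℝ → ℝ} (hM : Measurable (Function.uncurry M))
    {a : ℕ → L2C} {l : L2C} (h : Filter.Tendsto a Filter.atTop (nhds l)) {B : ℝ≥0∞}
    (hB : ∀ᶠ n in Filter.atTop, energy M (a n) ≤ B) : energy M l ≤ B := by
  have hm := measurable_weight hM
  have h1 : TendstoInMeasure volume (fun n => (a n : Plane → ℂ)) Filter.atTop l :=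
    tendstoInMeasure_of_tendsto_Lp h
  obtain ⟨ns, hns, h2⟩ := h1.exists_seq_tendsto_ae
  have h3 : energy M l ≤ ∫⁻ ζ, Filter.liminf
      (fun k => ENNReal.ofReal (M (ζ 0) (ζ 1)) * ‖a (ns k) ζ‖ₑ ^ 2) Filter.atTop := by
    refine lintegral_mono_ae ?_
    filter_upwards [h2] with ζ hζ
    refine le_of_eq (Filter.Tendsto.liminf_eq ?_).symm
    refine ENNReal.Tendsto.const_mul ?_ (Or.inr ENNReal.ofReal_ne_top)
    exact (ENNReal.continuous_pow 2).continuousAt.tendsto.comp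
      (continuous_enorm.continuousAt.tendsto.comp hζ)
  refine h3.trans ((lintegral_liminf_le fun k => ?_).trans ?_)
  · have := measurable_coeFn (a (ns k))
    fun_prop
  · refine (Filter.liminf_le_liminf (v := fun _ => B) ?_).trans (by simp)
    exact hns.tendsto_atTop.eventually hB

theorem isClosed_herm : IsClosed {a : L2C | Herm a} := by
  have : {a : L2C | Herm a} = {a : L2C | conjL (reflL a) = a} := by
    ext a
    exact herm_iff a
  rw [this]
  exact isClosed_eq (conjL.continuous.comp (Lp.isometry_compMeasurePreserving
    measurePreserving_neg_plane).continuous) continuous_id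

theorem Galerkin.continuousOn {n : ℕ} {T : ℝ} {a : ℝ → L2C} (h : Galerkin n T a) :
    ContinuousOn a (Set.Icc 0 T) := fun t ht => (h.deriv t ht).continuousWithinAt

theorem Galerkin.eq_int {n : ℕ} {T : ℝ} {a : ℝ → L2C} (h : Galerkin n T a) {t : ℝ}
    (ht : t ∈ Set.Icc 0 T) : a t = a 0 + ∫ s in (0 : ℝ)..t, field n (a s) := by
  have hsub : Set.Icc 0 t ⊆ Set.Icc 0 T := Set.Icc_subset_Icc_right ht.2
  have hc : ContinuousOn (fun s => field n (a s)) (Set.Icc 0 t) :=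
    (continuous_field n).comp_continuousOn (h.continuousOn.mono hsub)
  have hi : IntervalIntegrable (fun s => field n (a s)) volume 0 t := by
    refine ContinuousOn.intervalIntegrable ?_
    rwa [Set.uIcc_of_le ht.1]
  have := intervalIntegral.integral_eq_sub_of_hasDerivAt_of_le ht.1 (h.continuousOn.mono hsub)
    (fun s hs => (h.deriv s (hsub (Set.Ioo_subset_Icc_self hs))).hasDerivAt
      (Icc_mem_nhds hs.1 (hs.2.trans_le ht.2))) hi
  rw [this]
  abel

theorem norm_field_le {n : ℕ} {a : L2C} {B : ℝ≥0} (hB : ∫⁻ ζ, ‖rhs a ζ‖ₑ ^ 2 ≤ B) :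
    ‖field n a‖ ≤ √B := by
  refine norm_le_of_lintegral_sq_le (Real.sqrt_nonneg _) ?_
  rw [Real.sq_sqrt (NNReal.coe_nonneg B), ENNReal.ofReal_coe_nnreal]
  refine le_trans (lintegral_mono_ae ?_) hB
  filter_upwards [coeFn_field n a] with ζ h
  rw [h, enorm_mul]
  exact pow_le_pow_left' (mul_le_of_le_one_left' (enorm_bandFn_le n ζ)) 2

/-- The only discrepancy with the full equation is the part of the nonlinearity outside the band,
and its `L²` norm is `O(1/n)` on bounded sets of the `X⁰` energy. -/
theorem exists_galerkin_approx (E : ℝ) : ∃ κ : ℝ, 0 ≤ κ ∧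
    ∀ (n : ℕ) (T : ℝ) (a : ℝ → L2C), 0 ≤ T → Galerkin n T a →
      (∀ t ∈ Set.Icc 0 T, energy weightX (a t) ≤ ENNReal.ofReal E) → ∀ ε : ℝ, κ / (n + 1) ≤ ε →
      ApproxSolution T ε E a (fun t => field n (a t)) := by
  obtain ⟨C, hC⟩ := exists_lintegral_nl_tail_le
  obtain ⟨B, hB⟩ := exists_lintegral_rhs_le E
  refine ⟨√(C * Real.toNNReal E ^ 2), Real.sqrt_nonneg _, fun n T a hT ha hE ε hε => ?_⟩
  have hc : ContinuousOn (fun s => field n (a s)) (Set.Icc 0 T) :=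
    (continuous_field n).comp_continuousOn ha.continuousOn
  refine ⟨?_, ⟨√B, ?_⟩, fun t ht => ha.eq_int ht, ?_, ha.herm, hE⟩
  · refine ContinuousOn.intervalIntegrable ?_
    rwa [Set.uIcc_of_le hT]
  · filter_upwards [ae_restrict_mem measurableSet_Icc] with t ht
    exact norm_field_le (hB _ (measurable_coeFn _) (hE t ht))
  · filter_upwards [ae_restrict_mem measurableSet_Icc] with t ht
    have h1 := hC (a t) (measurable_coeFn _) n
    set f : Plane → ℂ := fun ζ => (1 - bandFn n ζ) * nlSym ζ * conv (a t) (a t) ζ with hf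
    have h2 : ∫⁻ ζ, ‖f ζ‖ₑ ^ 2 ≤ ENNReal.ofReal ((√(C * Real.toNNReal E ^ 2) / (n + 1)) ^ 2) := by
      refine h1.trans ?_
      rw [div_pow, Real.sq_sqrt (by positivity), div_eq_inv_mul, ← inv_pow,
        ENNReal.ofReal_mul (by positivity), ENNReal.ofReal_mul (NNReal.coe_nonneg C),
        ENNReal.ofReal_coe_nnreal, ENNReal.ofReal_pow (NNReal.coe_nonneg _),
        ENNReal.ofReal_coe_nnreal]
      exact mul_le_mul_right (mul_le_mul_right (pow_le_pow_left' (hE t ht) 2) _) _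
    have hm : MemLp f 2 volume := by
      refine memLp_of_lintegral_sq_lt_top ?_ (h2.trans_lt ENNReal.ofReal_lt_top)
      have := measurable_conv (measurable_coeFn (a t)) (measurable_coeFn (a t))
      have := measurable_bandFn n
      have := measurable_nlSym
      fun_prop
    refine ⟨hm.toLp f, ?_, ?_⟩
    · refine (norm_le_of_lintegral_sq_le (by positivity) (le_trans (le_of_eq ?_) h2)).trans hε
      refine lintegral_congr_ae ?_
      filter_upwards [hm.coeFn_toLp] with ζ h
      rw [h]
    · have h3 := coeFn_cut n (a t)
      rw [ha.supp t ht] at h3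
      filter_upwards [coeFn_field n (a t), hm.coeFn_toLp, h3] with ζ h4 h5 h6
      rw [h4, h5, hf]
      unfold rhs
      -- Off the band `a t` vanishes, so the linear part of `rhs` is zero there and the error
      -- cancels the quadratic part.
      by_cases hζ : ζ ∈ band n
      · simp only [bandFn_mem hζ]
        ring
      · rw [bandFn_notMem hζ, zero_mul] at h6
        simp only [bandFn_notMem hζ, h6]
        ring

theorem cauchySeq_galerkin {φ : L2R} {E T : ℝ} (hE0 : 0 ≤ E) {a : ℕ → ℝ → L2C}
    (ha : ∀ n, Galerkin n T (a n)) (h0 : ∀ n, a n 0 = cut n (four φ))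
    (hE : ∀ n, ∀ t ∈ Set.Icc 0 T, energy weightX (a n t) ≤ ENNReal.ofReal E) {t : ℝ}
    (ht : t ∈ Set.Icc 0 T) : CauchySeq fun n => a n t := by
  obtain ⟨A, hA, hst⟩ := exists_stability E hE0
  obtain ⟨κ, hκ, hap⟩ := exists_galerkin_approx E
  have hT : 0 ≤ T := ht.1.trans ht.2
  rw [Metric.cauchySeq_iff']
  intro ε hε
  set X := Real.exp (A * t) with hX
  have hX1 : 1 ≤ X := Real.one_le_exp (mul_nonneg hA ht.1)
  -- The data differ by at most `2η` and the equation error is at most `η`, so stability gives `5 η²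
  -- X`, which is below `9 η² X² = ε²` since `X ≥ 1`.
  set η := ε / (3 * X) with hη
  have hη0 : 0 < η := by positivity
  have e1 : ∀ᶠ n : ℕ in Filter.atTop, κ / (n + 1) < η := by
    have : Filter.Tendsto (fun n : ℕ => κ / ((n : ℝ) + 1)) Filter.atTop (nhds 0) := by
      simpa [div_eq_mul_inv] using
        (tendsto_one_div_add_atTop_nhds_zero_nat (𝕜 := ℝ)).const_mul κ
    exact this.eventually_lt_const hη0
  have e2 : ∀ᶠ n : ℕ in Filter.atTop, ‖cut n (four φ) - four φ‖ < η :=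
    (tendsto_iff_norm_sub_tendsto_zero.1 (tendsto_cut (four φ))).eventually_lt_const hη0
  obtain ⟨N, hN⟩ := Filter.eventually_atTop.1 (e1.and e2)
  refine ⟨N, fun n hn => ?_⟩
  have h1 := hst T η _ _ _ _ (hap n T (a n) hT (ha n) (hE n) η (hN n hn).1.le)
    (hap N T (a N) hT (ha N) (hE N) η (hN N le_rfl).1.le) t ht
  rw [h0, h0] at h1
  have h2 : ‖cut n (four φ) - cut N (four φ)‖ ≤ 2 * η := by
    have h3 := norm_sub_le (cut n (four φ) - four φ) (cut N (four φ) - four φ)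
    rw [sub_sub_sub_cancel_right] at h3
    linarith [(hN n hn).2, (hN N le_rfl).2]
  have h3 : ‖a n t - a N t‖ ^ 2 < ε ^ 2 := by
    have h4 : ‖cut n (four φ) - cut N (four φ)‖ ^ 2 ≤ (2 * η) ^ 2 := by gcongr
    have h5 : (‖cut n (four φ) - cut N (four φ)‖ ^ 2 + η ^ 2) * X ≤ (5 * η ^ 2) * X := by
      gcongr
      linarith
    have h6 : (5 * η ^ 2) * X < ε ^ 2 := by
      have h7 : ε = η * (3 * X) := by rw [hη]; field_simp
      rw [h7, mul_pow]
      have h8 : 0 < η ^ 2 := by positivity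
      have h9 : 5 * X < (3 * X) ^ 2 := by nlinarith
      nlinarith
    have h10 := sq_pos_of_pos hη0
    linarith
  rw [dist_eq_norm]
  exact lt_of_pow_lt_pow_left₀ 2 hε.le h3

open Classical in
/-- The right hand side as an element of `L²` (zero if it is not square integrable). -/
noncomputable def rhsL (a : L2C) : L2C :=
  if h : MemLp (rhs a) 2 volume then h.toLp _ else 0

theorem coeFn_rhsL {a : L2C} (h : energy weightX a < ∞) : rhsL a =ᵐ[volume] rhs a := by
  obtain ⟨B, hB⟩ := exists_lintegral_rhs_le (energy weightX a).toReal
  have h1 : MemLp (rhs a) 2 volume := memLp_of_lintegral_sq_lt_top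
    (measurable_rhs (measurable_coeFn a)) ((hB a (measurable_coeFn a)
      (ENNReal.ofReal_toReal h.ne).ge).trans_lt ENNReal.coe_lt_top)
  unfold rhsL
  rw [dif_pos h1]
  exact h1.coeFn_toLp

theorem cut_rhsL {a : L2C} (h : energy weightX a < ∞) (k : ℕ) : cut k (rhsL a) = field k a := by
  apply Lp.ext
  filter_upwards [coeFn_cut k (rhsL a), coeFn_field k a, coeFn_rhsL h] with ζ h1 h2 h3
  rw [h1, h2, h3]

theorem norm_rhsL_le {a : L2C} {B : ℝ≥0} (h : energy weightX a < ∞)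
    (hB : ∫⁻ ζ, ‖rhs a ζ‖ₑ ^ 2 ≤ B) : ‖rhsL a‖ ≤ √B := by
  refine norm_le_of_lintegral_sq_le (Real.sqrt_nonneg _) ?_
  rw [Real.sq_sqrt (NNReal.coe_nonneg B), ENNReal.ofReal_coe_nnreal]
  refine le_trans (le_of_eq (lintegral_congr_ae ?_)) hB
  filter_upwards [coeFn_rhsL h] with ζ h
  rw [h]

/-- Passage to the limit in the truncated equations. -/
theorem approxSolution_of_galerkin {φ : L2R} {E T : ℝ} (hT : 0 ≤ T) {a : ℕ → ℝ → L2C}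
    {l : ℝ → L2C}
    (ha : ∀ n, Galerkin n T (a n)) (h0 : ∀ n, a n 0 = cut n (four φ))
    (hE : ∀ n, ∀ t ∈ Set.Icc 0 T, energy weightX (a n t) ≤ ENNReal.ofReal E)
    (hl : ∀ t ∈ Set.Icc 0 T, Filter.Tendsto (fun n => a n t) Filter.atTop (nhds (l t))) :
    l 0 = four φ ∧ ApproxSolution T 0 E l (fun t => rhsL (l t)) := by
  obtain ⟨B, hB⟩ := exists_lintegral_rhs_le E
  have hz : (0 : ℝ) ∈ Set.Icc 0 T := ⟨le_rfl, hT⟩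
  have hl0 : l 0 = four φ := by
    refine tendsto_nhds_unique (hl 0 hz) ?_
    simp only [h0]
    exact tendsto_cut _
  have hEl : ∀ t ∈ Set.Icc 0 T, energy weightX (l t) ≤ ENNReal.ofReal E := fun t ht =>
    energy_le_of_tendsto measurable_weightX (hl t ht) (Filter.Eventually.of_forall fun n => hE n t ht)
  have hEt : ∀ t ∈ Set.Icc 0 T, energy weightX (l t) < ∞ := fun t ht =>
    (hEl t ht).trans_lt ENNReal.ofReal_lt_top
  have hbd : ∀ t ∈ Set.Icc 0 T, ‖rhsL (l t)‖ ≤ √B := fun t ht =>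
    norm_rhsL_le (hEt t ht) (hB _ (measurable_coeFn _) (hEl t ht))
  have hlm : AEStronglyMeasurable l (volume.restrict (Set.Icc 0 T)) := by
    refine aestronglyMeasurable_of_tendsto_ae Filter.atTop
      (fun n => (ha n).continuousOn.aestronglyMeasurable measurableSet_Icc) ?_
    filter_upwards [ae_restrict_mem measurableSet_Icc] with t ht
    exact hl t ht
  -- Continuity of `rhsL` on `L²` is not at hand, but at each time `rhsL (l t)` is the limit of the
  -- continuous fields `field k` at `l t`.
  have hbm : AEStronglyMeasurable (fun t => rhsL (l t)) (volume.restrict (Set.Icc 0 T)) := by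
    refine aestronglyMeasurable_of_tendsto_ae (f := fun k t => field k (l t)) Filter.atTop
      (fun k => (continuous_field k).comp_aestronglyMeasurable hlm) ?_
    filter_upwards [ae_restrict_mem measurableSet_Icc] with t ht
    have := tendsto_cut (rhsL (l t))
    simpa only [cut_rhsL (hEt t ht)] using this
  have hbi : IntegrableOn (fun t => rhsL (l t)) (Set.Icc 0 T) := by
    refine Integrable.of_bound hbm (√B) ?_
    filter_upwards [ae_restrict_mem measurableSet_Icc] with t ht
    exact hbd t ht
  have hint : ∀ t ∈ Set.Icc 0 T, IntervalIntegrable (fun t => rhsL (l t)) volume 0 t := by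
    intro t ht
    rw [intervalIntegrable_iff_integrableOn_Icc_of_le ht.1]
    exact hbi.mono_set (Set.Icc_subset_Icc_right ht.2)
  refine ⟨hl0, hint T ⟨hT, le_rfl⟩, ⟨√B, ?_⟩, fun t ht => ?_, ?_, fun t ht => ?_, hEl⟩
  · filter_upwards [ae_restrict_mem measurableSet_Icc] with t ht
    exact hbd t ht
  · -- the equation holds after every cut
    have hk : ∀ k, cut k (l t) = cut k (l 0) + ∫ s in (0 : ℝ)..t, field k (l s) := by
      intro k
      have h1 : Filter.Tendsto (fun n => cut k (a n t)) Filter.atTop (nhds (cut k (l t))) :=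
        ((cut k).continuous.tendsto _).comp (hl t ht)
      have h2 : Filter.Tendsto (fun n => cut k (a n 0)) Filter.atTop (nhds (cut k (l 0))) :=
        ((cut k).continuous.tendsto _).comp (hl 0 hz)
      have h3 : Filter.Tendsto (fun n => ∫ s in (0 : ℝ)..t, field k (a n s)) Filter.atTop
          (nhds (∫ s in (0 : ℝ)..t, field k (l s))) := by
        refine intervalIntegral.tendsto_integral_filter_of_dominated_convergence (fun _ => √B)
          ?_ ?_ (intervalIntegrable_const) ?_
        · refine Filter.Eventually.of_forall fun n => ?_
          rw [Set.uIoc_of_le ht.1]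
          refine ContinuousOn.aestronglyMeasurable ?_ measurableSet_Ioc
          exact (continuous_field k).comp_continuousOn ((ha n).continuousOn.mono
            (Set.Ioc_subset_Icc_self.trans (Set.Icc_subset_Icc_right ht.2)))
        · refine Filter.Eventually.of_forall fun n => Filter.Eventually.of_forall fun s hs => ?_
          rw [Set.uIoc_of_le ht.1] at hs
          exact norm_field_le (hB _ (measurable_coeFn _) (hE n s ⟨hs.1.le, hs.2.trans ht.2⟩))
        · refine Filter.Eventually.of_forall fun s hs => ?_
          rw [Set.uIoc_of_le ht.1] at hs
          exact ((continuous_field k).tendsto _).comp (hl s ⟨hs.1.le, hs.2.trans ht.2⟩)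
      refine tendsto_nhds_unique h1 ((h2.add h3).congr' ?_)
      filter_upwards [Filter.eventually_ge_atTop k] with n hn
      have h4 := (ha n).eq_int ht
      have hfi : IntervalIntegrable (fun s => field n (a n s)) volume 0 t := by
        refine ContinuousOn.intervalIntegrable ?_
        rw [Set.uIcc_of_le ht.1]
        exact (continuous_field n).comp_continuousOn
          ((ha n).continuousOn.mono (Set.Icc_subset_Icc_right ht.2))
      have h5 := ((cut k).restrictScalars ℝ).intervalIntegral_comp_comm hfi
      simp only [ContinuousLinearMap.coe_restrictScalars', cut_field hn] at h5
      rw [h5, ← map_add, ← h4]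
    -- All band restrictions of the defect in the integral equation vanish, so the defect itself
    -- does, because the bands exhaust the plane up to a null set.
    have hk2 : ∀ k, cut k (l t - (l 0 + ∫ s in (0 : ℝ)..t, rhsL (l s))) = 0 := by
      intro k
      have h5 := ((cut k).restrictScalars ℝ).intervalIntegral_comp_comm (hint t ht)
      simp only [ContinuousLinearMap.coe_restrictScalars'] at h5
      rw [map_sub, map_add, ← h5, hk k, sub_eq_zero]
      congr 1
      refine intervalIntegral.integral_congr fun s hs => ?_
      rw [Set.uIcc_of_le ht.1] at hs
      exact (cut_rhsL (hEt s ⟨hs.1, hs.2.trans ht.2⟩) k).symm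
    have h6 := tendsto_cut (l t - (l 0 + ∫ s in (0 : ℝ)..t, rhsL (l s)))
    simp only [hk2] at h6
    exact sub_eq_zero.1 (tendsto_nhds_unique h6 tendsto_const_nhds)
  · filter_upwards [ae_restrict_mem measurableSet_Icc] with t ht
    refine ⟨0, by simp, ?_⟩
    filter_upwards [coeFn_rhsL (hEt t ht), Lp.coeFn_zero ℂ 2 (volume : Measure Plane)] with ζ h1 h2
    rw [h1, h2]
    simp
  · exact isClosed_herm.mem_of_tendsto (hl t ht)
      (Filter.Eventually.of_forall fun n => (ha n).herm t ht)

/-- Local existence on the Fourier side, on an interval depending only on the `X⁰` energy, and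
persistence of the higher energies. -/
theorem exists_approxSolution : ∃ A : ℝ, 0 < A ∧ ∀ (K T : ℝ) (φ : L2R), 0 ≤ K → 0 < T →
    2 * A * T * (1 + K) ≤ 1 → energy weightX (four φ) ≤ ENNReal.ofReal K →
    ∃ a : ℝ → L2C, a 0 = four φ ∧ ApproxSolution T 0 (2 * (1 + K)) a (fun t => rhsL (a t)) ∧
      ∀ N, energy (weightY N) (four φ) < ∞ →
        ∃ B : ℝ≥0, ∀ t ∈ Set.Icc 0 T, energy (weightY N) (a t) ≤ B := by
  obtain ⟨A, hA, hX⟩ := Galerkin.exists_energyX_le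
  refine ⟨A, hA, fun K T φ hK hT hAT hφ => ?_⟩
  choose a ha h0 using fun n => exists_galerkin n φ hT
  have hE : ∀ n, ∀ t ∈ Set.Icc 0 T, energy weightX (a n t) ≤ ENNReal.ofReal (2 * (1 + K)) :=
    fun n => hX n T (a n) (ha n) K hK (by rw [h0]; exact (energy_cut_le _ _ _).trans hφ) hAT
  have hE0 : 0 ≤ 2 * (1 + K) := by positivity
  choose! l hl using fun t ht => cauchySeq_tendsto_of_complete
    (cauchySeq_galerkin hE0 ha h0 hE (t := t) ht)
  obtain ⟨hl0, hls⟩ := approxSolution_of_galerkin hT.le ha h0 hE hl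
  refine ⟨l, hl0, hls, fun N hN => ?_⟩
  obtain ⟨B, _, hB⟩ := Galerkin.exists_energyY_le N (T := T) hE0
    (energy (weightY N) (four φ)).toReal ENNReal.toReal_nonneg
  refine ⟨B.toNNReal, fun t ht => energy_le_of_tendsto (measurable_weightY N) (hl t ht)
    (Filter.Eventually.of_forall fun n => hB n (a n) (ha n) (hE n) ?_ t ht)⟩
  rw [h0, ENNReal.ofReal_toReal hN.ne]
  exact energy_cut_le _ _ _

end KPI
-- Comparison of the norms of `X^N` and `Y^N` with the energies
namespace KPI

theorem norm_derivSym (a b : ℕ) (ζ : Plane) :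
    ‖derivSym a b ζ‖ = (2 * Real.pi) ^ (a + b) * (|ζ 0| ^ a * |ζ 1| ^ b) := by
  unfold derivSym
  simp only [norm_mul, norm_pow, Complex.norm_I, Complex.norm_real, Real.norm_eq_abs,
    Complex.norm_ofNat, mul_one, abs_of_pos Real.pi_pos]
  ring

theorem norm_invSym (a b : ℕ) (ζ : Plane) :
    ‖invSym a b ζ‖ = (2 * Real.pi) ^ (a + b + 1) * (|ζ 0| ^ a * |ζ 1| ^ (b + 2) / |ζ 0|) := by
  unfold invSym
  rw [norm_div, norm_derivSym]
  simp only [norm_mul, Complex.norm_I, Complex.norm_real, Real.norm_eq_abs,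
    Complex.norm_ofNat, mul_one, abs_of_pos Real.pi_pos]
  have := Real.pi_pos
  rcases eq_or_ne (ζ 0) 0 with h | h
  · simp [h]
  · have : |ζ 0| ≠ 0 := abs_ne_zero.2 h
    field_simp
    ring

theorem measurable_derivSym (a b : ℕ) : Measurable (derivSym a b) := by
  unfold derivSym
  fun_prop

theorem measurable_invSym (a b : ℕ) : Measurable (invSym a b) := by
  unfold invSym
  have := measurable_derivSym a (b + 2)
  fun_prop

theorem sqNorm_eq (m : Plane → ℂ) (f : L2R) : sqNorm m f = ∫⁻ ζ, ‖m ζ * four f ζ‖ₑ ^ 2 := rfl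

theorem energy_le_sqNorm {M : ℝ → ℝ → ℝ} {m : Plane → ℂ}
    (h : ∀ ζ : Plane, ζ 0 ≠ 0 → M (ζ 0) (ζ 1) ≤ ‖m ζ‖ ^ 2) (f : L2R) :
    energy M (four f) ≤ sqNorm m f := by
  rw [sqNorm_eq]
  refine lintegral_mono_ae ?_
  filter_upwards [ae_coord_ne_zero] with ζ hζ
  rw [enorm_mul, mul_pow]
  gcongr
  rw [← ofReal_norm, ← ENNReal.ofReal_pow (norm_nonneg _)]
  exact ENNReal.ofReal_le_ofReal (h ζ hζ)

theorem sqNorm_le_energy {M : ℝ → ℝ → ℝ} {m : Plane → ℂ} {C : ℝ} (hC : 0 ≤ C)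
    (h : ∀ ζ : Plane, ζ 0 ≠ 0 → ‖m ζ‖ ^ 2 ≤ C * M (ζ 0) (ζ 1)) (f : L2R) :
    sqNorm m f ≤ ENNReal.ofReal C * energy M (four f) := by
  rw [sqNorm_eq]
  unfold energy
  rw [← lintegral_const_mul' _ _ ENNReal.ofReal_ne_top]
  refine lintegral_mono_ae ?_
  filter_upwards [ae_coord_ne_zero] with ζ hζ
  rw [enorm_mul, mul_pow, ← mul_assoc, ← ENNReal.ofReal_mul hC]
  gcongr
  rw [← ofReal_norm, ← ENNReal.ofReal_pow (norm_nonneg _)]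
  exact ENNReal.ofReal_le_ofReal (h ζ hζ)

theorem energy_add {M L : ℝ → ℝ → ℝ} (hM : Measurable (Function.uncurry M))
    (hM0 : ∀ x y, 0 ≤ M x y) (hL0 : ∀ x y, 0 ≤ L x y) (a : L2C) :
    energy (fun x y => M x y + L x y) a = energy M a + energy L a := by
  have hm := measurable_weight hM
  have ha := measurable_coeFn a
  unfold energy
  rw [← lintegral_add_left (by fun_prop)]
  refine lintegral_congr fun ζ => ?_
  rw [← add_mul, ENNReal.ofReal_add (hM0 _ _) (hL0 _ _)]

theorem one_le_two_pi_pow (k : ℕ) : 1 ≤ (2 * Real.pi) ^ k :=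
  one_le_pow₀ (by linarith [Real.pi_gt_three])

theorem sq_abs_pow (z : ℝ) (k : ℕ) : (|z| ^ k) ^ 2 = z ^ (2 * k) := by
  rw [← abs_pow, sq_abs, ← pow_mul, mul_comm]

theorem sq_norm_derivSym (a b : ℕ) (ζ : Plane) : ‖derivSym a b ζ‖ ^ 2 =
    (2 * Real.pi) ^ (2 * (a + b)) * (ζ 0 ^ (2 * a) * ζ 1 ^ (2 * b)) := by
  rw [norm_derivSym, ← sq_abs_pow (ζ 0), ← sq_abs_pow (ζ 1)]
  ring

theorem sq_norm_invSym (a b : ℕ) (ζ : Plane) : ‖invSym a b ζ‖ ^ 2 =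
    (2 * Real.pi) ^ (2 * (a + b + 1)) * (ζ 0 ^ (2 * a) * ζ 1 ^ (2 * b) * (ζ 1 ^ 4 / ζ 0 ^ 2)) := by
  rw [norm_invSym, ← sq_abs_pow (ζ 0) a, ← sq_abs_pow (ζ 1) b, ← sq_abs (ζ 0),
    (by rw [← sq_abs_pow (ζ 1) 2] : ζ 1 ^ 4 = (|ζ 1| ^ 2) ^ 2)]
  ring

theorem le_sq_norm_derivSym (a b : ℕ) (ζ : Plane) :
    ζ 0 ^ (2 * a) * ζ 1 ^ (2 * b) ≤ ‖derivSym a b ζ‖ ^ 2 := by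
  rw [sq_norm_derivSym]
  exact le_mul_of_one_le_left (mul_nonneg ((even_two_mul a).pow_nonneg _)
    ((even_two_mul b).pow_nonneg _)) (one_le_two_pi_pow _)

theorem le_sq_norm_invSym (b : ℕ) (ζ : Plane) :
    ζ 1 ^ (2 * b + 4) / ζ 0 ^ 2 ≤ ‖invSym 0 b ζ‖ ^ 2 := by
  rw [sq_norm_invSym, mul_zero, pow_zero, one_mul, ← mul_div_assoc, ← pow_add]
  exact le_mul_of_one_le_left (div_nonneg (Even.pow_nonneg ⟨b + 2, by ring⟩ _) (sq_nonneg _))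
    (one_le_two_pi_pow _)

theorem pow_mul_pow_le {a b N : ℕ} (h : a + b ≤ N) (x y : ℝ) :
    x ^ (2 * a) * y ^ (2 * b) ≤ 1 + x ^ (2 * N) + y ^ (2 * N) := by
  rw [pow_mul, pow_mul, pow_mul, pow_mul]
  have hx := sq_nonneg x
  have hy := sq_nonneg y
  set p := x ^ 2
  set q := y ^ 2
  set m := max p q with hm
  have hm0 : 0 ≤ m := le_max_of_le_left hx
  have h1 : p ^ a * q ^ b ≤ m ^ (a + b) := by
    rw [pow_add]
    gcongr
    · exact le_max_left _ _
    · exact le_max_right _ _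
  have hp : 0 ≤ p ^ N := by positivity
  have hq : 0 ≤ q ^ N := by positivity
  have h2 : m ^ (a + b) ≤ 1 + m ^ N := by
    rcases le_total m 1 with h3 | h3
    · have := pow_le_one₀ (n := a + b) hm0 h3
      have : 0 ≤ m ^ N := by positivity
      linarith
    · have := pow_le_pow_right₀ h3 h
      linarith
  have h3 : m ^ N ≤ p ^ N + q ^ N := by
    rcases max_choice p q with h4 | h4
    · rw [hm, h4]; linarith
    · rw [hm, h4]; linarith
  linarith

theorem monomials_le_weightY {a b N : ℕ} (h : a + b ≤ N) {x : ℝ} (y : ℝ) (hx : x ≠ 0) :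
    x ^ (2 * a) * y ^ (2 * b) * x ^ 6 ≤ 8 * weightY N x y ∧
    x ^ (2 * a) * y ^ (2 * b) * (y ^ 4 / x ^ 2) ≤ 8 * weightY N x y ∧
    x ^ (2 * a) * y ^ (2 * b) * y ^ 4 ≤ 8 * weightY N x y := by
  have h0 := pow_mul_pow_le h x y
  set q := y ^ 4 / x ^ 2 with hq
  have hW : weightY N x y = 1 + x ^ 6 + q + x ^ (2 * N) * x ^ 6 + x ^ 6 * y ^ (2 * N)
      + y ^ (2 * N) * y ^ 4 + y ^ (2 * N) * q := by
    unfold weightY weightX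
    rw [hq]
    ring
  have hx6 : 0 ≤ x ^ 6 := by positivity
  have hy4 : 0 ≤ y ^ 4 := by positivity
  have hq0 : 0 ≤ q := by positivity
  have hX : 0 ≤ x ^ (2 * N) := (even_two_mul N).pow_nonneg x
  have hY : 0 ≤ y ^ (2 * N) := (even_two_mul N).pow_nonneg y
  have p1 : 0 ≤ x ^ (2 * N) * x ^ 6 := by positivity
  have p2 : 0 ≤ x ^ 6 * y ^ (2 * N) := by positivity
  have p3 : 0 ≤ y ^ (2 * N) * y ^ 4 := by positivity
  have p4 : 0 ≤ y ^ (2 * N) * q := by positivity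
  have k1 := mul_le_mul_of_nonneg_right h0 hx6
  have k2 := mul_le_mul_of_nonneg_right h0 hq0
  have k3 := mul_le_mul_of_nonneg_right h0 hy4
  have hpow : ∀ {s t : ℝ}, 0 ≤ s → s ≤ t → s ^ N ≤ t ^ N := fun h1 h2 => pow_le_pow_left₀ h1 h2 N
  -- The weight contains no term `x^(2N) y⁴ / x²`. If `y⁴ ≤ x⁸` then `q ≤ x⁶`; otherwise `x⁴ ≤ y²`,
  -- so that `x^(2N) ≤ 1 + y^(2N)`.
  have k4 : x ^ (2 * N) * q ≤ x ^ (2 * N) * x ^ 6 + q + y ^ (2 * N) * q := by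
    rcases le_total (y ^ 4) (x ^ 8) with h1 | h1
    · have : q ≤ x ^ 6 := by
        rw [hq, div_le_iff₀ (by positivity)]
        calc _ ≤ _ := h1
          _ = _ := by ring
      have := mul_le_mul_of_nonneg_left this hX
      linarith
    · have h2 : x ^ 4 ≤ y ^ 2 := by
        refine le_of_sq_le_sq ?_ (sq_nonneg y)
        calc _ = x ^ 8 := by ring
          _ ≤ _ := h1
          _ = _ := by ring
      have h3 : x ^ (2 * N) ≤ 1 + y ^ (2 * N) := by
        rcases le_total (x ^ 2) 1 with h4 | h4
        · have := pow_le_one₀ (n := N) (sq_nonneg x) h4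
          rw [← pow_mul] at this
          linarith
        · have h5 : x ^ 2 ≤ y ^ 2 := by nlinarith
          have := hpow (sq_nonneg x) h5
          rw [← pow_mul, ← pow_mul] at this
          linarith
      have := mul_le_mul_of_nonneg_right h3 hq0
      linarith
  -- The same dichotomy, now with `y⁴` against `x⁶`.
  have k5 : x ^ (2 * N) * y ^ 4 ≤ x ^ (2 * N) * x ^ 6 + y ^ 4 + y ^ (2 * N) * y ^ 4 := by
    rcases le_total (y ^ 4) (x ^ 6) with h1 | h1
    · have := mul_le_mul_of_nonneg_left h1 hX
      linarith
    · have h3 : x ^ (2 * N) ≤ 1 + y ^ (2 * N) := by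
        rcases le_total (x ^ 2) 1 with h4 | h4
        · have := pow_le_one₀ (n := N) (sq_nonneg x) h4
          rw [← pow_mul] at this
          linarith
        · have h5 : x ^ 2 ≤ y ^ 2 := by
            refine le_of_sq_le_sq ?_ (sq_nonneg y)
            nlinarith [sq_nonneg (x ^ 2)]
          have := hpow (sq_nonneg x) h5
          rw [← pow_mul, ← pow_mul] at this
          linarith
      have := mul_le_mul_of_nonneg_right h3 hy4
      linarith
  have k6 : y ^ 4 ≤ 1 + y ^ (2 * N) * y ^ 4 := by
    rcases le_total (y ^ 2) 1 with h4 | h4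
    · have := pow_le_one₀ (n := 2) (sq_nonneg y) h4
      rw [← pow_mul] at this
      norm_num at this
      linarith
    · have := one_le_pow₀ (n := N) h4
      rw [← pow_mul] at this
      nlinarith
  rw [hW]
  refine ⟨?_, ?_, ?_⟩
  · linarith
  · linarith
  · linarith

theorem mem_multiIdx {N : ℕ} {α : ℕ × ℕ} : α ∈ multiIdx N ↔ α.1 + α.2 ≤ N := by
  unfold multiIdx
  simp only [Finset.mem_filter, Finset.mem_product, Finset.mem_range]
  omega

theorem multiIdx_zero : multiIdx 0 = {(0, 0)} := by
  ext ⟨a, b⟩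
  rw [mem_multiIdx]
  simp

theorem rpow_half_le_iff {x y : ℝ≥0∞} : x ^ (1 / 2 : ℝ) ≤ y ↔ x ≤ y ^ 2 := by
  rw [one_div, ← ENNReal.le_rpow_inv_iff (by norm_num : (0 : ℝ) < 2⁻¹), inv_inv]
  norm_num

/-- The squared norm of `Y^N`. -/
noncomputable def sqNormY (N : ℕ) (f : L2R) : ℝ≥0∞ :=
  sqNorm 1 f + ∑ α ∈ multiIdx N,
    (sqNorm (derivSym (α.1 + 3) α.2) f + sqNorm (invSym α.1 α.2) f
      + sqNorm (derivSym α.1 (α.2 + 2)) f)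

theorem YNorm_eq (N : ℕ) (f : L2R) : YNorm N f = sqNormY N f ^ (1 / 2 : ℝ) := rfl

theorem XNorm_le_YNorm (N : ℕ) (f : L2R) : XNorm N f ≤ YNorm N f := by
  unfold XNorm YNorm
  exact ENNReal.rpow_le_rpow (add_le_add le_rfl (Finset.sum_le_sum fun α _ => le_self_add))
    (by norm_num)

theorem XNorm_zero_le_YNorm (N : ℕ) (f : L2R) : XNorm 0 f ≤ YNorm N f := by
  refine le_trans ?_ (XNorm_le_YNorm N f)
  unfold XNorm
  refine ENNReal.rpow_le_rpow (add_le_add le_rfl (Finset.sum_le_sum_of_subset fun α hα => ?_))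
    (by norm_num)
  rw [mem_multiIdx] at hα ⊢
  omega

theorem le_sqNorm_one (f : L2R) : energy (fun _ _ => 1) (four f) ≤ sqNorm 1 f :=
  energy_le_sqNorm (fun ζ _ => by simp) f

theorem energyX_le_of_XNorm_le {f : L2R} {K : ℝ≥0} (h : XNorm 0 f ≤ K) :
    energy weightX (four f) ≤ ENNReal.ofReal (K ^ 2) := by
  unfold XNorm at h
  rw [rpow_half_le_iff, multiIdx_zero, Finset.sum_singleton] at h
  rw [ENNReal.ofReal_pow (NNReal.coe_nonneg K), ENNReal.ofReal_coe_nnreal]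
  refine le_trans ?_ h
  have e : weightX = fun x y => (1 + x ^ 6) + y ^ 4 / x ^ 2 := rfl
  rw [e, energy_add (by unfold Function.uncurry; fun_prop) (fun x y => by positivity)
    (fun x y => by positivity), energy_add (M := fun _ _ => 1) (L := fun x _ => x ^ 6)
    (by unfold Function.uncurry; fun_prop)
    (fun x y => by positivity) (fun x y => by positivity), add_assoc]
  refine add_le_add (le_sqNorm_one f) (add_le_add ?_ ?_)
  · refine energy_le_sqNorm (fun ζ _ => ?_) f
    have := le_sq_norm_derivSym 3 0 ζ
    simpa using this
  · refine energy_le_sqNorm (fun ζ _ => ?_) f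
    have := le_sq_norm_invSym 0 ζ
    simpa using this

theorem sq_norm_symbols_le {a b N : ℕ} (h : a + b ≤ N) (ζ : Plane) (hζ : ζ 0 ≠ 0) :
    ‖derivSym (a + 3) b ζ‖ ^ 2 ≤ (2 * Real.pi) ^ (2 * (N + 3)) * 8 * weightY N (ζ 0) (ζ 1) ∧
    ‖invSym a b ζ‖ ^ 2 ≤ (2 * Real.pi) ^ (2 * (N + 3)) * 8 * weightY N (ζ 0) (ζ 1) ∧
    ‖derivSym a (b + 2) ζ‖ ^ 2 ≤ (2 * Real.pi) ^ (2 * (N + 3)) * 8 * weightY N (ζ 0) (ζ 1) := by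
  obtain ⟨h1, h2, h3⟩ := monomials_le_weightY h (ζ 1) hζ
  have hp : 1 ≤ 2 * Real.pi := by linarith [Real.pi_gt_three]
  have hx : 0 ≤ ζ 0 ^ (2 * a) := (even_two_mul a).pow_nonneg _
  have hy : 0 ≤ ζ 1 ^ (2 * b) := (even_two_mul b).pow_nonneg _
  rw [sq_norm_derivSym, sq_norm_invSym, sq_norm_derivSym, mul_assoc _ (8 : ℝ)]
  refine ⟨?_, ?_, ?_⟩
  · refine mul_le_mul (pow_le_pow_right₀ hp (by omega)) (le_of_eq_of_le (by ring) h1) ?_ ?_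
    · exact mul_nonneg ((even_two_mul (a + 3)).pow_nonneg _) hy
    · positivity
  · refine mul_le_mul (pow_le_pow_right₀ hp (by omega)) h2 ?_ ?_
    · positivity
    · positivity
  · refine mul_le_mul (pow_le_pow_right₀ hp (by omega)) (le_of_eq_of_le (by ring) h3) ?_ ?_
    · exact mul_nonneg hx ((even_two_mul (b + 2)).pow_nonneg _)
    · positivity

theorem exists_sqNormY_le (N : ℕ) : ∃ C : ℝ≥0, ∀ f : L2R,
    sqNormY N f ≤ C * energy (weightY N) (four f) := by
  set c : ℝ := (2 * Real.pi) ^ (2 * (N + 3)) * 8 with hc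
  have hc0 : 0 ≤ c := by have := Real.pi_pos; positivity
  refine ⟨1 + (multiIdx N).card * (3 * c.toNNReal), fun f => ?_⟩
  have h1 : sqNorm 1 f ≤ energy (weightY N) (four f) := by
    have := sqNorm_le_energy (M := weightY N) (m := 1) (C := 1) zero_le_one (fun ζ _ => by
      simpa using weightY_pos N (ζ 0) (ζ 1)) f
    simpa using this
  unfold sqNormY
  push_cast
  rw [add_mul, one_mul]
  refine add_le_add h1 ?_
  rw [mul_assoc, ← nsmul_eq_mul]
  refine Finset.sum_le_card_nsmul _ _ _ fun α hα => ?_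
  have hα := mem_multiIdx.1 hα
  have k1 := sqNorm_le_energy hc0 (fun ζ hζ => (sq_norm_symbols_le hα ζ hζ).1) f
  have k2 := sqNorm_le_energy hc0 (fun ζ hζ => (sq_norm_symbols_le hα ζ hζ).2.1) f
  have k3 := sqNorm_le_energy hc0 (fun ζ hζ => (sq_norm_symbols_le hα ζ hζ).2.2) f
  refine (add_le_add (add_le_add k1 k2) k3).trans_eq ?_
  change _ = 3 * ENNReal.ofReal c * _
  ring

theorem exists_YNorm_le (N : ℕ) (B : ℝ≥0) : ∃ C : ℝ≥0, ∀ f : L2R,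
    energy (weightY N) (four f) ≤ B → YNorm N f ≤ C := by
  obtain ⟨C, hC⟩ := exists_sqNormY_le N
  refine ⟨NNReal.sqrt (C * B), fun f hf => ?_⟩
  rw [YNorm_eq, rpow_half_le_iff, ← ENNReal.coe_pow, NNReal.sq_sqrt, ENNReal.coe_mul]
  exact (hC f).trans (mul_le_mul_right hf _)

/-- Every summand of `weightY` is dominated by the constant symbol or by a symbol with multi-index
`(0, 0)`, `(N, 0)` or `(0, N)`; the powers of `2π` in the symbols are at least 1 and only help. -/
theorem energyY_lt_top {N : ℕ} {f : L2R} (h : MemY N f) : energy (weightY N) (four f) < ∞ := by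
  have hY : sqNormY N f < ∞ := by
    unfold MemY at h
    rw [YNorm_eq] at h
    by_contra hc
    rw [not_lt_top_iff] at hc
    rw [hc] at h
    simp at h
  have hsum := (ENNReal.add_lt_top.1 hY).2
  have hα : ∀ a b : ℕ, a + b ≤ N → sqNorm (derivSym (a + 3) b) f < ∞ ∧
      sqNorm (invSym a b) f < ∞ ∧ sqNorm (derivSym a (b + 2)) f < ∞ := by
    intro a b hab
    have h1 := ENNReal.sum_lt_top.1 hsum (a, b) (mem_multiIdx.2 hab)
    rw [ENNReal.add_lt_top, ENNReal.add_lt_top] at h1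
    exact ⟨h1.1.1, h1.1.2, h1.2⟩
  have e : weightY N = fun x y => ((((((1 + x ^ 6) + y ^ 4 / x ^ 2) + x ^ (2 * N + 6))
      + x ^ 6 * y ^ (2 * N)) + y ^ (2 * N + 4)) + y ^ (2 * N + 4) / x ^ 2) := rfl
  have n1 : ∀ x : ℝ, 0 ≤ x ^ (2 * N + 6) := fun x => Even.pow_nonneg ⟨N + 3, by ring⟩ x
  have n2 : ∀ y : ℝ, 0 ≤ y ^ (2 * N) := fun y => (even_two_mul N).pow_nonneg y
  have n3 : ∀ y : ℝ, 0 ≤ y ^ (2 * N + 4) := fun y => Even.pow_nonneg ⟨N + 2, by ring⟩ y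
  rw [e]
  repeat rw [energy_add (by unfold Function.uncurry; fun_prop) (fun x y => by
    have := n1 x; have := n2 y; have := n3 y; positivity) (fun x y => by
    have := n1 x; have := n2 y; have := n3 y; positivity)]
  simp only [ENNReal.add_lt_top]
  have z0 := hα 0 0 (by omega)
  refine ⟨⟨⟨⟨⟨⟨?_, ?_⟩, ?_⟩, ?_⟩, ?_⟩, ?_⟩, ?_⟩
  · exact (le_sqNorm_one f).trans_lt (ENNReal.add_lt_top.1 hY).1
  · refine (energy_le_sqNorm (fun ζ _ => ?_) f).trans_lt z0.1
    simpa using le_sq_norm_derivSym 3 0 ζ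
  · refine (energy_le_sqNorm (fun ζ _ => ?_) f).trans_lt z0.2.1
    simpa using le_sq_norm_invSym 0 ζ
  · refine (energy_le_sqNorm (fun ζ _ => ?_) f).trans_lt (hα N 0 (by omega)).1
    simpa [mul_add] using le_sq_norm_derivSym (N + 3) 0 ζ
  · refine (energy_le_sqNorm (fun ζ _ => ?_) f).trans_lt (hα 0 N (by omega)).1
    simpa using le_sq_norm_derivSym 3 N ζ
  · refine (energy_le_sqNorm (fun ζ _ => ?_) f).trans_lt (hα 0 N (by omega)).2.2
    simpa [mul_add] using le_sq_norm_derivSym 0 (N + 2) ζ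
  · refine (energy_le_sqNorm (fun ζ _ => ?_) f).trans_lt (hα 0 N (by omega)).2.1
    exact le_sq_norm_invSym N ζ

end KPI
-- Return to physical space: the equation, local existence and the maximal solution
namespace KPI

theorem memLp_derivSym_three {a : L2C} (h : energy weightX a < ∞) :
    MemLp (fun ζ => derivSym 3 0 ζ * a ζ) 2 volume ∧ MemLp (fun ζ => derivSym 1 0 ζ * a ζ) 2 volume ∧
    MemLp (fun ζ => invSym 0 0 ζ * a ζ) 2 volume := by
  have ha := measurable_coeFn a
  have h' : ∀ m : Plane → ℂ, Measurable m →
      (∀ ζ : Plane, ζ 0 ≠ 0 → ‖m ζ‖ ^ 2 ≤ (2 * Real.pi) ^ 6 * weightX (ζ 0) (ζ 1)) →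
      MemLp (fun ζ => m ζ * a ζ) 2 volume := by
    intro m hm hb
    refine memLp_of_lintegral_sq_lt_top (by fun_prop) ?_
    have h1 : ∫⁻ ζ, ‖m ζ * a ζ‖ₑ ^ 2 ≤ ENNReal.ofReal ((2 * Real.pi) ^ 6) * energy weightX a := by
      unfold energy
      rw [← lintegral_const_mul' _ _ ENNReal.ofReal_ne_top]
      refine lintegral_mono_ae ?_
      filter_upwards [ae_coord_ne_zero] with ζ hζ
      have hp := Real.pi_pos
      rw [enorm_mul, mul_pow, ← mul_assoc, ← ENNReal.ofReal_mul (by positivity)]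
      gcongr
      rw [← ofReal_norm, ← ENNReal.ofReal_pow (norm_nonneg _)]
      exact ENNReal.ofReal_le_ofReal (hb ζ hζ)
    exact h1.trans_lt (ENNReal.mul_lt_top ENNReal.ofReal_lt_top h)
  have hp : 1 ≤ 2 * Real.pi := by linarith [Real.pi_gt_three]
  refine ⟨h' _ (measurable_derivSym 3 0) fun ζ _ => ?_, h' _ (measurable_derivSym 1 0) fun ζ _ => ?_,
    h' _ (measurable_invSym 0 0) fun ζ _ => ?_⟩
  · rw [sq_norm_derivSym]
    have : 0 ≤ ζ 1 ^ 4 / ζ 0 ^ 2 := by positivity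
    refine mul_le_mul (pow_le_pow_right₀ hp (by omega)) ?_ (mul_nonneg
      ((even_two_mul _).pow_nonneg _) ((even_two_mul _).pow_nonneg _)) (by positivity)
    unfold weightX
    simp only [mul_zero, pow_zero, mul_one]
    norm_num
    linarith
  · rw [sq_norm_derivSym]
    have : 0 ≤ ζ 1 ^ 4 / ζ 0 ^ 2 := by positivity
    refine mul_le_mul (pow_le_pow_right₀ hp (by omega)) ?_ (mul_nonneg
      ((even_two_mul _).pow_nonneg _) ((even_two_mul _).pow_nonneg _)) (by positivity)
    unfold weightX
    simp only [mul_zero, pow_zero, mul_one]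
    have := sq_nonneg (ζ 0 ^ 2 - 1)
    nlinarith [sq_nonneg (ζ 0), mul_nonneg (sq_nonneg (ζ 0)) this]
  · rw [sq_norm_invSym]
    refine mul_le_mul (pow_le_pow_right₀ hp (by omega)) ?_ (mul_nonneg (mul_nonneg
      ((even_two_mul _).pow_nonneg _) ((even_two_mul _).pow_nonneg _)) (by positivity))
      (by positivity)
    unfold weightX
    simp only [mul_zero, pow_zero, one_mul]
    have : 0 ≤ ζ 0 ^ 6 := by positivity
    linarith

theorem fourierMul_eq {m : Plane → ℂ} {f : L2R} (h : MemLp (fun ζ => m ζ * four f ζ) 2 volume) :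
    fourierMul m f = 𝓕⁻ (h.toLp (fun ζ => m ζ * four f ζ)) := by
  unfold fourierMul
  exact dif_pos h

/-- This is `u u_x = ½ (u²)_x`: the first coordinates of `w` and `ζ - w` add up to that of `ζ`, and
the two convolutions agree by commutativity. -/
theorem conv_deriv_eq {a d : L2C} (hd : d =ᵐ[volume] fun ζ => derivSym 1 0 ζ * a ζ) (ζ : Plane) :
    conv a d ζ = nlSym ζ * conv a a ζ := by
  have h1 : conv a d ζ + conv d a ζ = 2 * Real.pi * Complex.I * (ζ 0 : ℂ) * conv a a ζ := by
    unfold conv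
    rw [← integral_add (integrable_mul_sub a d ζ) (integrable_mul_sub d a ζ), ← integral_const_mul]
    refine integral_congr_ae ?_
    filter_upwards [hd, (Measure.measurePreserving_sub_left volume
      ζ).quasiMeasurePreserving.ae_eq_comp hd] with w h2 h3
    simp only [Function.comp_apply] at h3
    simp only [h2, h3]
    unfold derivSym
    simp only [PiLp.sub_apply]
    push_cast
    ring
  rw [conv_comm d a, ← two_mul] at h1
  have h2 : (2 : ℂ) ≠ 0 := two_ne_zero
  apply mul_left_cancel₀ h2
  rw [h1]
  unfold nlSym
  ring

theorem integrable_of_energy {a : L2C} (h : energy weightX a < ∞) :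
    Integrable (fun ζ => ((1 + |ζ 0| : ℝ) : ℂ) * a ζ) := by
  obtain ⟨Q, hQ⟩ := dominates_one_add_abs
  have ha := measurable_coeFn a
  refine ⟨Measurable.aestronglyMeasurable (by fun_prop), ?_⟩
  have h1 : wiener (fun x _ => 1 + |x|) a < ∞ := by
    have h2 := (hQ a ha).trans_lt (ENNReal.mul_lt_top ENNReal.coe_lt_top h)
    by_contra hc
    rw [not_lt_top_iff] at hc
    rw [hc] at h2
    simp at h2
  refine lt_of_eq_of_lt (lintegral_congr fun ζ => ?_) h1
  rw [enorm_mul, ← ofReal_norm, Complex.norm_real, Real.norm_of_nonneg (by positivity)]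

/-- The equation in physical space is the equation on the Fourier side. -/
theorem equation_iff {f v : L2R} (h : energy weightX (four f) < ∞) :
    (∀ᵐ z ∂(volume : Measure Plane),
      (v z : ℂ) + fourierMul (derivSym 3 0) f z + fourierMul (derivSym 1 0) f z
        + (f z : ℂ) * fourierMul (derivSym 1 0) f z - fourierMul (invSym 0 0) f z = 0) ↔
    four v = rhsL (four f) := by
  obtain ⟨m3, m1, m0⟩ := memLp_derivSym_three h
  set a := four f with ha
  set d3 := m3.toLp (fun ζ => derivSym 3 0 ζ * a ζ) with hd3
  set d1 := m1.toLp (fun ζ => derivSym 1 0 ζ * a ζ) with hd1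
  set d0 := m0.toLp (fun ζ => invSym 0 0 ζ * a ζ) with hd0
  -- The transform of `u u_x` is defined as what remains of the right hand side after removing the
  -- linear terms. It is in `L²` by construction, and is then recognised as a convolution.
  set c : L2C := -rhsL a - (d3 + d1 - d0) with hc
  have hcc : c =ᵐ[volume] conv a d1 := by
    filter_upwards [coeFn_rhsL h, m3.coeFn_toLp, m1.coeFn_toLp, m0.coeFn_toLp,
      Lp.coeFn_sub (-rhsL a) (d3 + d1 - d0), Lp.coeFn_neg (rhsL a), Lp.coeFn_sub (d3 + d1) d0,
      Lp.coeFn_add d3 d1] with ζ h1 h2 h3 h4 h5 h6 h7 h8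
    rw [hc, h5, Pi.sub_apply, h6, Pi.neg_apply, h1, h7, Pi.sub_apply, h8, Pi.add_apply, hd3, h2,
      hd1, h3, hd0, h4, ← hd1, conv_deriv_eq m1.coeFn_toLp]
    unfold rhs disp
    ring
  have hi := integrable_of_energy h
  have hia : Integrable a := by
    refine hi.mono (Lp.aestronglyMeasurable a) (Filter.Eventually.of_forall fun ζ => ?_)
    rw [norm_mul, Complex.norm_real, Real.norm_of_nonneg (by positivity)]
    exact le_mul_of_one_le_left (norm_nonneg _) (by linarith [abs_nonneg (ζ 0)])
  have hid : Integrable d1 := by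
    refine (hi.const_mul ((2 * Real.pi : ℝ) : ℂ)).mono (Lp.aestronglyMeasurable d1) ?_
    filter_upwards [m1.coeFn_toLp] with ζ h1
    rw [h1, norm_mul, norm_derivSym, norm_mul, norm_mul, Complex.norm_real, Complex.norm_real,
      Real.norm_of_nonneg (by positivity), Real.norm_of_nonneg (by positivity)]
    have := Real.pi_pos
    calc _ = 2 * Real.pi * |ζ 0| * ‖a ζ‖ := by ring
      _ ≤ 2 * Real.pi * (1 + |ζ 0|) * ‖a ζ‖ := by
        gcongr
        linarith
      _ = _ := by ring
  have hprod := fourierInv_conv hia hid hcc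
  have hfa : (𝓕⁻ a : L2C) = toC f := by
    rw [ha, four, FourierTransform.fourierInv_fourier_eq]
  rw [hfa] at hprod
  have hlin : (𝓕⁻ (rhsL a) : L2C) = -(𝓕⁻ c + (𝓕⁻ d3 + 𝓕⁻ d1 - 𝓕⁻ d0)) := by
    have e : rhsL a = -(c + (d3 + d1 - d0)) := by rw [hc]; abel
    set Φ := (Lp.fourierTransformₗᵢ Plane ℂ).symm with hΦ
    have hΦe : ∀ x : L2C, (𝓕⁻ x : L2C) = Φ x := fun x => rfl
    rw [e]
    simp only [hΦe, map_neg, map_add, map_sub]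
  have key : (∀ᵐ z ∂(volume : Measure Plane),
      (v z : ℂ) + fourierMul (derivSym 3 0) f z + fourierMul (derivSym 1 0) f z
        + (f z : ℂ) * fourierMul (derivSym 1 0) f z - fourierMul (invSym 0 0) f z = 0) ↔
      toC v = 𝓕⁻ (rhsL a) := by
    rw [fourierMul_eq m3, fourierMul_eq m1, fourierMul_eq m0, Lp.ext_iff, hlin]
    have hall := Lp.coeFn_neg (𝓕⁻ c + (𝓕⁻ d3 + 𝓕⁻ d1 - 𝓕⁻ d0) : L2C)
    have hall2 := Lp.coeFn_add (𝓕⁻ c : L2C) (𝓕⁻ d3 + 𝓕⁻ d1 - 𝓕⁻ d0)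
    have hall3 := Lp.coeFn_sub (𝓕⁻ d3 + 𝓕⁻ d1 : L2C) (𝓕⁻ d0)
    have hall4 := Lp.coeFn_add (𝓕⁻ d3 : L2C) (𝓕⁻ d1)
    refine Filter.eventually_congr ?_
    filter_upwards [hall, hall2, hall3, hall4, hprod, coeFn_toC f, coeFn_toC v]
      with z h1 h2 h3 h4 h5 h6 h7
    rw [h1, Pi.neg_apply, h2, Pi.add_apply, h3, Pi.sub_apply, h4, Pi.add_apply, h5, h6, h7]
    constructor
    · intro h8
      linear_combination h8
    · intro h8
      linear_combination h8
  rw [key]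
  constructor
  · intro h1
    rw [four, h1, FourierTransform.fourier_fourierInv_eq]
  · intro h1
    rw [← h1, four, FourierTransform.fourierInv_fourier_eq]

/-- All energy bounds above a threshold are allowed so that two solutions can be compared under a
common bound. -/
theorem IsSolutionOn.exists_approxSolution {T : ℝ} (hT : 0 ≤ T) {φ : L2R} {u : ℝ → L2R}
    (h : IsSolutionOn T φ u) : ∃ E : ℝ, ∀ E', E ≤ E' → ∃ b,
      ApproxSolution T 0 E' (fun t => four (u t)) b := by
  obtain ⟨C, hC⟩ := h.bounded
  obtain ⟨v, hv, hu, heq⟩ := h.equation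
  have hE : ∀ t ∈ Set.Icc 0 T, energy weightX (four (u t)) ≤ ENNReal.ofReal (C ^ 2) := fun t ht =>
    energyX_le_of_XNorm_le (hC t ht)
  have hvi : IntegrableOn v (Set.Icc 0 T) := hv.integrable le_top
  have hint : ∀ t ∈ Set.Icc 0 T, IntervalIntegrable v volume 0 t := by
    intro t ht
    rw [intervalIntegrable_iff_integrableOn_Icc_of_le ht.1]
    exact hvi.mono_set (Set.Icc_subset_Icc_right ht.2)
  have h0 : u 0 = φ := by
    have := hu 0 ⟨le_rfl, hT⟩
    simpa using this
  have hcomm : ∀ t ∈ Set.Icc 0 T, ∫ s in (0 : ℝ)..t, four (v s) = four (∫ s in (0 : ℝ)..t, v s) :=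
    fun t ht => fourL.toContinuousLinearMap.intervalIntegral_comp_comm (hint t ht)
  refine ⟨C ^ 2, fun E' hE' => ⟨fun t => four (v t), ?_, ?_, fun t ht => ?_, ?_, fun t _ => herm_four _,
    fun t ht => (hE t ht).trans (ENNReal.ofReal_le_ofReal hE')⟩⟩
  · rw [intervalIntegrable_iff_integrableOn_Icc_of_le hT]
    exact fourL.toContinuousLinearMap.integrable_comp hvi
  · refine ⟨(eLpNormEssSup v (volume.restrict (Set.Icc 0 T))).toReal, ?_⟩
    filter_upwards [ae_le_eLpNormEssSup (f := v) (μ := volume.restrict (Set.Icc 0 T))] with t ht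
    rw [norm_four]
    have h1 : eLpNormEssSup v (volume.restrict (Set.Icc 0 T)) ≠ ∞ := by
      have := hv.2
      rw [eLpNorm_exponent_top] at this
      exact this.ne
    rw [← toReal_enorm]
    exact ENNReal.toReal_mono h1 ht
  · rw [hcomm t ht, h0]
    have : four (φ + ∫ s in (0 : ℝ)..t, v s) = four φ + four (∫ s in (0 : ℝ)..t, v s) :=
      fourL.map_add _ _
    rw [← this, ← hu t ht]
  · filter_upwards [heq, ae_restrict_mem measurableSet_Icc] with t h1 ht
    have hEt := (hE t ht).trans_lt ENNReal.ofReal_lt_top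
    rw [equation_iff hEt] at h1
    refine ⟨0, by simp, ?_⟩
    rw [h1]
    filter_upwards [coeFn_rhsL hEt, Lp.coeFn_zero ℂ 2 (volume : Measure Plane)] with ζ h2 h3
    rw [h2, h3]
    simp

/-- Solutions with the same data agree. -/
theorem IsSolutionOn.unique {T : ℝ} {φ : L2R} {u w : ℝ → L2R} (hu : IsSolutionOn T φ u)
    (hw : IsSolutionOn T φ w) {t : ℝ} (ht : t ∈ Set.Icc 0 T) : u t = w t := by
  have hT : 0 ≤ T := ht.1.trans ht.2
  obtain ⟨E₁, h₁⟩ := hu.exists_approxSolution hT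
  obtain ⟨E₂, h₂⟩ := hw.exists_approxSolution hT
  obtain ⟨b₁, h₁⟩ := h₁ (max (max E₁ E₂) 0) ((le_max_left _ _).trans (le_max_left _ _))
  obtain ⟨b₂, h₂⟩ := h₂ (max (max E₁ E₂) 0) ((le_max_right _ _).trans (le_max_left _ _))
  have h0 : ∀ {u}, IsSolutionOn T φ u → u 0 = φ := by
    intro u hu
    obtain ⟨v, _, hu, _⟩ := hu.equation
    have := hu 0 ⟨le_rfl, hT⟩
    simpa using this
  have h := ApproxSolution.unique (le_max_right _ _) h₁ h₂ (by simp only [h0 hu, h0 hw]) ht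
  rw [← fourInv_four (u t), h, fourInv_four]

/-- Local existence in `Y^N`, on an interval depending only on the `X⁰` norm. -/
theorem exists_isYSolutionOn (K : ℝ≥0) : ∃ T : ℝ, 0 < T ∧ ∀ (N : ℕ) (φ : L2R), MemY N φ →
    XNorm 0 φ ≤ K → ∃ u, IsYSolutionOn N T φ u := by
  obtain ⟨A, hA, hex⟩ := KPI.exists_approxSolution
  -- This is the longest time admitted by the Riccati argument for initial energy at most `K²`.
  set T := 1 / (2 * A * (1 + K ^ 2)) with hT
  have hT0 : 0 < T := by positivity
  refine ⟨T, hT0, fun N φ hN hK => ?_⟩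
  obtain ⟨a, ha0, ha, haY⟩ := hex (K ^ 2) T φ (by positivity) hT0 (by
    rw [hT]
    refine le_of_eq ?_
    field_simp) (energyX_le_of_XNorm_le hK)
  obtain ⟨B, hB⟩ := haY N (energyY_lt_top hN)
  obtain ⟨C, hC⟩ := exists_YNorm_le N B
  have hEt : ∀ t ∈ Set.Icc 0 T, energy weightX (a t) < ∞ := fun t ht =>
    (ha.energy t ht).trans_lt ENNReal.ofReal_lt_top
  have hfour : ∀ t ∈ Set.Icc 0 T, four (fourInv (a t)) = a t := fun t ht =>
    four_fourInv (ha.herm t ht)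
  have hYb : ∀ t ∈ Set.Icc 0 T, YNorm N (fourInv (a t)) ≤ C := fun t ht =>
    hC _ (by rw [hfour t ht]; exact hB t ht)
  have hint : ∀ t ∈ Set.Icc 0 T, IntervalIntegrable (fun t => rhsL (a t)) volume 0 t := by
    intro t ht
    refine ha.int.mono_set ?_
    rw [Set.uIcc_of_le ht.1, Set.uIcc_of_le hT0.le]
    exact Set.Icc_subset_Icc_right ht.2
  refine ⟨fun t => fourInv (a t), ⟨⟨C, fun t ht => (XNorm_zero_le_YNorm N _).trans (hYb t ht)⟩,
    fun t => fourInv (rhsL (a t)), ?_, fun t ht => ?_, ?_⟩, C, hYb⟩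
  · obtain ⟨R, hR⟩ := ha.bdd
    have hm : AEStronglyMeasurable (fun t => rhsL (a t)) (volume.restrict (Set.Icc 0 T)) := by
      have := ha.int
      rw [intervalIntegrable_iff_integrableOn_Icc_of_le hT0.le] at this
      exact this.aestronglyMeasurable
    refine memLp_top_of_bound (fourInv.continuous.comp_aestronglyMeasurable hm) R ?_
    filter_upwards [hR] with t ht
    exact (norm_fourInv_le _).trans ht
  · have h1 := fourInv.intervalIntegral_comp_comm (hint t ht)
    rw [h1]
    have h2 : φ = fourInv (a 0) := by rw [ha0, fourInv_four]
    conv_rhs => rw [h2]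
    rw [← map_add, ← ha.eq_int t ht]
  · filter_upwards [ae_restrict_mem measurableSet_Icc] with t ht
    have hEt' : energy weightX (four (fourInv (a t))) < ∞ := by
      rw [hfour t ht]; exact hEt t ht
    rw [equation_iff hEt', hfour t ht]
    exact four_fourInv (herm_of_ae_eq (coeFn_rhsL (hEt t ht)) (ha.herm t ht).rhs)

/-- Besides restricting the interval, this permits replacing the curve by one that agrees with it on
`[0, S]`, as is needed for gluing. -/
theorem IsYSolutionOn.mono {N : ℕ} {S T : ℝ} (hST : S ≤ T) {φ : L2R} {u w : ℝ → L2R}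
    (h : IsYSolutionOn N T φ u) (hw : ∀ t ∈ Set.Icc 0 S, w t = u t) : IsYSolutionOn N S φ w := by
  have hsub : Set.Icc 0 S ⊆ Set.Icc 0 T := Set.Icc_subset_Icc_right hST
  obtain ⟨⟨⟨C, hC⟩, v, hv, hu, heq⟩, D, hD⟩ := h
  have hm : volume.restrict (Set.Icc 0 S) ≤ volume.restrict (Set.Icc 0 T) :=
    Measure.restrict_mono hsub le_rfl
  refine ⟨⟨⟨C, fun t ht => by rw [hw t ht]; exact hC t (hsub ht)⟩, v, hv.mono_measure hm,
    fun t ht => by rw [hw t ht]; exact hu t (hsub ht), ?_⟩,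
    D, fun t ht => by rw [hw t ht]; exact hD t (hsub ht)⟩
  filter_upwards [ae_mono hm heq, ae_restrict_mem measurableSet_Icc] with t h1 ht
  rw [hw t ht]
  exact h1

theorem exists_isYSolutionOn_of_lt_lifespan {N : ℕ} {φ : L2R} {S : ℝ}
    (h : ENNReal.ofReal S < lifespan N φ) : ∃ u, IsYSolutionOn N S φ u := by
  unfold lifespan at h
  obtain ⟨s, ⟨T, hT, rfl, u, hu⟩, hs⟩ := lt_sSup_iff.1 h
  have hST : S ≤ T := ((ENNReal.ofReal_lt_ofReal_iff hT).1 hs).le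
  exact ⟨u, hu.mono hST fun t _ => rfl⟩

/-- The value at `t` is the endpoint value of some chosen solution on `[0, t]`. By uniqueness it
coincides with the value of any solution on a longer interval, so the choices are consistent. -/
theorem exists_isMaximalSolution (N : ℕ) (φ : L2R) : ∃ u, IsMaximalSolution N φ u := by
  classical
  refine ⟨fun t => if h : ∃ w, IsYSolutionOn N t φ w then h.choose t else 0, fun S hS hSl => ?_⟩
  obtain ⟨w, hw⟩ := exists_isYSolutionOn_of_lt_lifespan hSl
  refine hw.mono le_rfl fun t ht => ?_
  have h : ∃ w, IsYSolutionOn N t φ w := ⟨w, hw.mono ht.2 fun _ _ => rfl⟩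
  rw [dif_pos h]
  exact h.choose_spec.1.unique (hw.mono ht.2 fun _ _ => rfl).1 ⟨ht.1, le_rfl⟩

end KPI

theorem corollary4p4 (K : ℝ≥0) :
    ∃ T' : ℝ, 0 < T' ∧ ∀ (N : ℕ) (φ : KPI.L2R), KPI.MemY N φ → KPI.XNorm 0 φ ≤ K →
      ENNReal.ofReal T' ≤ KPI.lifespan N φ ∧
      (∃ u : ℝ → KPI.L2R, KPI.IsMaximalSolution N φ u) ∧
      ∀ u : ℝ → KPI.L2R, KPI.IsMaximalSolution N φ u →
        (∀ w : ℝ → KPI.L2R, KPI.IsMaximalSolution N φ w →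
          ∀ t : ℝ, 0 ≤ t → ENNReal.ofReal t < KPI.lifespan N φ → w t = u t) ∧
        KPI.IsSolutionOn T' φ u ∧ KPI.BoundedIn (KPI.XNorm N) T' u := by
  obtain ⟨T, hT, hex⟩ := KPI.exists_isYSolutionOn K
  -- Halving makes the time strictly smaller than the life span, so every maximal solution is a
  -- solution on the closed interval, endpoint included.
  refine ⟨T / 2, half_pos hT, fun N φ hN hK => ?_⟩
  obtain ⟨u₀, hu₀⟩ := hex N φ hN hK
  have hle : ENNReal.ofReal T ≤ KPI.lifespan N φ := le_sSup ⟨T, hT, rfl, u₀, hu₀⟩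
  have hlt : ENNReal.ofReal (T / 2) < KPI.lifespan N φ :=
    ((ENNReal.ofReal_lt_ofReal_iff hT).2 (half_lt_self hT)).trans_le hle
  refine ⟨hlt.le, KPI.exists_isMaximalSolution N φ, fun u hu => ⟨fun w hw t ht htl => ?_, ?_⟩⟩
  · have h1 : ENNReal.ofReal (max t (T / 2)) < KPI.lifespan N φ := by
      rcases max_choice t (T / 2) with h | h
      · rwa [h]
      · rwa [h]
    have h0 : 0 < max t (T / 2) := lt_max_of_lt_right (half_pos hT)
    exact (hw _ h0 h1).1.unique (hu _ h0 h1).1 ⟨ht, le_max_left _ _⟩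
  · obtain ⟨h1, C, hC⟩ := hu _ (half_pos hT) hlt
    exact ⟨h1, C, fun t ht => (KPI.XNorm_le_YNorm N _).trans (hC t ht)⟩
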